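/- Let $\mathbb K$ be a field of characteristic $0$. A *3-Lie algebra* is a vector space with an alternating trilinear bracket satisfying $$[x_1,x_2,[x_3,x_4,x_5]]=[[x_1,x_2,x_3],x_4,x_5]+[x_3,[x_1,x_2,x_4],x_5]+[x_3,x_4,[x_1,x_2,x_5]].$$ Let $(\mathfrak g,\pi=[\cdot,\cdot,\cdot]_{\mathfrak g})$ and $(\mathfrak h,\mu=[\cdot,\cdot,\cdot]_{\mathfrak h})$ be 3-Lie algebras over $\mathbb K$, and let $\rho:\wedge^2\mathfrak g\to\mathfrak{gl}(\mathfrak h)$ be an *action*, i.e. a linear map with $$\rho(x_1,x_2)\rho(x_3,x_4)=\rho([x_1,x_2,x_3]_{\mathfrak g},x_4)+\rho(x_3,[x_1,x_2,x_4]_{\mathfrak g})+\rho(x_3,x_4)\rho(x_1,x_2),$$ $$\rho(x_1,[x_2,x_3,x_4]_{\mathfrak g})=\rho(x_3,x_4)\rho(x_1,x_2)-\rho(x_2,x_4)\rho(x_1,x_3)+\rho(x_2,x_3)\rho(x_1,x_4),$$ $[\rho(x,y)u,v,w]_{\mathfrak h}=0$ and $\rho(x,y)[u,v,w]_{\mathfrak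 h}=0$. Let $H:\mathfrak g\to\mathfrak h$ be a *crossed homomorphism*, i.e. a linear map with $$H[x,y,z]_{\mathfrak g}=\rho(x,y)(Hz)+\rho(y,z)(Hx)+\rho(z,x)(Hy)+[Hx,Hy,Hz]_{\mathfrak h}.$$ For vector spaces $V,W$ and $n\ge 0$ let $C^n(V,W)=\mathrm{Hom}(\underbrace{\wedge^2V\otimes\cdots\otimes\wedge^2V}_{n}\wedge V,W)$, where the last factor $\wedge^2V$ and the final $V$ are wedged together to $\wedge^3V$ (so $C^0(V,W)=\mathrm{Hom}(V,W)$), and put $C^*(V,W)=\bigoplus_{n\ge0}C^n(V,W)$, graded by $n$. On $C^*(V,V)$ let $[P,Q]=P\circ Q-(-1)^{pq}Q\circ P$ for $P\in C^p(V,V)$, $Q\in C^q(V,V)$, where, for $\mathfrak X_i=x_i\wedge y_i$ and with $\mathbb S(a,b)$ the set of $(a,b)$-shuffles, $$\begin{aligned}(P\circ Q)(\mathfrak X_1,\dots,\mathfrak X_{p+q},x)=\ &\sum_{k=1}^{p}(-1)^{(k-1)q}\sum_{\sigma\in\mathbb S(k-1,q)}(-1)^\sigma P\big(\mathfrak X_{\sigma(1)},\dots,\mathfrak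 X_{\sigma(k-1)},\,Q_\sigma(x_{k+q})\wedge y_{k+q}+x_{k+q}\wedge Q_\sigma(y_{k+q}),\,\mathfrak X_{k+q+1},\dots,\mathfrak X_{p+q},x\big)\\&+\sum_{\sigma\in\mathbb S(p,q)}(-1)^{pq}(-1)^\sigma P\big(\mathfrak X_{\sigma(1)},\dots,\mathfrak X_{\sigma(p)},Q(\mathfrak X_{\sigma(p+1)},\dots,\mathfrak X_{\sigma(p+q)},x)\big),\end{aligned}$$ with $Q_\sigma(z)=Q(\mathfrak X_{\sigma(k)},\dots,\mathfrak X_{\sigma(k+q-1)},z)$. Let $\Delta=\pi+\rho+\mu\in C^1(\mathfrak g\oplus\mathfrak h,\mathfrak g\oplus\mathfrak h)$ be $$\Delta(x+u,y+v,z+w)=[x,y,z]_{\mathfrak g}+\rho(x,y)w+\rho(y,z)u+\rho(z,x)v+[u,v,w]_{\mathfrak h}.$$ Regard $C^*(\mathfrak g,\mathfrak h)$ as a subspace of $C^*(\mathfrak g\oplus\mathfrak h,\mathfrak g\oplus\mathfrak h)$ (extending by zero on $\mathfrak h$), let $\mathcal P$ be the projection onto it (restrict to $\mathfrak g$ and take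 the $\mathfrak h$-component), and for $k\ge1$ let $$l_k(a_1,\dots,a_k)=\mathcal P[\cdots[[\Delta,a_1],a_2],\cdots,a_k],\qquad a_1,\dots,a_k\in C^*(\mathfrak g,\mathfrak h).$$ An *$L_\infty$-algebra* is a $\mathbb Z$-graded vector space with multilinear maps $l_k$ ($k\ge1$) of degree $1$ such that, for homogeneous elements and with $\varepsilon(\sigma)$ the Koszul sign, $l_n(x_{\sigma(1)},\dots,x_{\sigma(n)})=\varepsilon(\sigma)l_n(x_1,\dots,x_n)$ for all $\sigma\in\mathbb S_n$, and $$\sum_{i=1}^n\sum_{\sigma\in\mathbb S(i,n-i)}\varepsilon(\sigma)\,l_{n-i+1}\big(l_i(x_{\sigma(1)},\dots,x_{\sigma(i)}),x_{\sigma(i+1)},\dots,x_{\sigma(n)}\big)=0\qquad(n\ge1).$$ A *Maurer–Cartan element* is a degree-$0$ element $\alpha$ with $\sum_{n\ge1}\frac1{n!}l_n(\alpha,\dots,\alpha)=0$ (a finite sum), and the *twisted brackets* are $l_k^\alpha(x_1,\dots,x_k)=\sum_{n\ge0}\frac1{n!}l_{n+k}(\underbrace{\alpha,\dots,\alpha}_n,x_1,\dots,x_k)$.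 **Proposition.** $(C^*(\mathfrak g,\mathfrak h),\{l_k\}_{k\ge1})$ is an $L_\infty$-algebra with $l_k=0$ for all $k\ne1,3$, the map $H\in C^0(\mathfrak g,\mathfrak h)$ is a Maurer–Cartan element of it, and the twisted brackets $\{l_k^H\}_{k\ge1}$ again form an $L_\infty$-algebra structure on $C^*(\mathfrak g,\mathfrak h)$. For all $P,Q,R\in C^*(\mathfrak g,\mathfrak h)$ they are given by $$l_1^H(P)=l_1(P)+\tfrac12\,l_3(H,H,P),\qquad l_2^H(P,Q)=l_3(H,P,Q),\qquad l_3^H(P,Q,R)=l_3(P,Q,R),\qquad l_k^H=0\ \ (k\ge4).$$ -/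

import Mathlib

namespace ThreeLie

section AltTwo
variable {K M N : Type*} [Field K] [AddCommGroup M] [Module K M] [AddCommGroup N] [Module K N]

theorem alt_add_left (f : M [⋀^Fin 2]→ₗ[K] N) (x y z : M) :
    f ![x + y, z] = f ![x, z] + f ![y, z] := f.toMultilinearMap.cons_add ![z] x y

theorem alt_smul_left (f : M [⋀^Fin 2]→ₗ[K] N) (t : K) (x z : M) :
    f ![t • x, z] = t • f ![x, z] := f.toMultilinearMap.cons_smul ![z] t x

theorem alt_swap (f : M [⋀^Fin 2]→ₗ[K] N) (x y : M) : f ![x, y] = - f ![y, x] := by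
  have := f.map_swap ![y, x] (i := 0) (j := 1) (by decide)
  rw [← this]; congr 1; ext k; fin_cases k <;> simp

theorem alt_self (f : M [⋀^Fin 2]→ₗ[K] N) (x : M) : f ![x, x] = 0 :=
  f.map_eq_zero_of_eq ![x, x] (i := 0) (j := 1) rfl (by decide)

theorem alt_add_right (f : M [⋀^Fin 2]→ₗ[K] N) (x y z : M) :
    f ![z, x + y] = f ![z, x] + f ![z, y] := by
  rw [alt_swap, alt_add_left, alt_swap f z x, alt_swap f z y]; abel

theorem alt_smul_right (f : M [⋀^Fin 2]→ₗ[K] N) (t : K) (x z : M) :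
    f ![z, t • x] = t • f ![z, x] := by
  rw [alt_swap, alt_smul_left, alt_swap f z x, smul_neg]

end AltTwo

section Algebra
variable {K g h : Type*} [Field K] [AddCommGroup g] [Module K g] [AddCommGroup h] [Module K h]

/-- The Fundamental Identity: the alternating trilinear map `π` is a 3-Lie bracket. -/
def IsThreeLieBracket (π : g [⋀^Fin 3]→ₗ[K] g) : Prop :=
  ∀ x₁ x₂ x₃ x₄ x₅ : g, π ![x₁, x₂, π ![x₃, x₄, x₅]] =
    π ![π ![x₁, x₂, x₃], x₄, x₅] + π ![x₃, π ![x₁, x₂, x₄], x₅] + π ![x₃, x₄, π ![x₁, x₂, x₅]]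

/-- A representation `ρ : ∧²g → gl(h)` of the 3-Lie algebra `(g, π)` on the vector space `h`. -/
structure IsRepresentation (π : g [⋀^Fin 3]→ₗ[K] g) (ρ : g [⋀^Fin 2]→ₗ[K] Module.End K h) :
    Prop where
  rho_mul_rho : ∀ x₁ x₂ x₃ x₄ : g, ρ ![x₁, x₂] * ρ ![x₃, x₄] =
    ρ ![π ![x₁, x₂, x₃], x₄] + ρ ![x₃, π ![x₁, x₂, x₄]] + ρ ![x₃, x₄] * ρ ![x₁, x₂]
  rho_bracket : ∀ x₁ x₂ x₃ x₄ : g, ρ ![x₁, π ![x₂, x₃, x₄]] =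
    ρ ![x₃, x₄] * ρ ![x₁, x₂] - ρ ![x₂, x₄] * ρ ![x₁, x₃] + ρ ![x₂, x₃] * ρ ![x₁, x₄]

/-- The center of the 3-Lie algebra `(h, μ)`. -/
def center (μ : h [⋀^Fin 3]→ₗ[K] h) : Set h := {u | ∀ v w : h, μ ![u, v, w] = 0}

/-- An action of the 3-Lie algebra `(g, π)` on the 3-Lie algebra `(h, μ)`. -/
structure IsAction (π : g [⋀^Fin 3]→ₗ[K] g) (μ : h [⋀^Fin 3]→ₗ[K] h)
    (ρ : g [⋀^Fin 2]→ₗ[K] Module.End K h) : Prop extends IsRepresentation π ρ where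
  rho_mem_center : ∀ (x y : g) (u : h), ρ ![x, y] u ∈ center μ
  rho_bracket_eq_zero : ∀ (x y : g) (u v w : h), ρ ![x, y] (μ ![u, v, w]) = 0

/-- `H` is a crossed homomorphism from `(g, π)` to `(h, μ)` with respect to the action `ρ`. -/
def IsCrossedHom (π : g [⋀^Fin 3]→ₗ[K] g) (μ : h [⋀^Fin 3]→ₗ[K] h)
    (ρ : g [⋀^Fin 2]→ₗ[K] Module.End K h) (H : g →ₗ[K] h) : Prop :=
  ∀ x y z : g, H (π ![x, y, z]) =
    ρ ![x, y] (H z) + ρ ![y, z] (H x) + ρ ![z, x] (H y) + μ ![H x, H y, H z]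

/-- The mixed part `(x + u, y + v, z + w) ↦ ρ(x, y) w + ρ(y, z) u + ρ(z, x) v`. -/
def mixedBracket (ρ : g [⋀^Fin 2]→ₗ[K] Module.End K h) : (g × h) [⋀^Fin 3]→ₗ[K] h :=
  { MultilinearMap.mk' (fun a : Fin 3 → g × h =>
      ρ ![(a 0).1, (a 1).1] (a 2).2 + ρ ![(a 1).1, (a 2).1] (a 0).2
        + ρ ![(a 2).1, (a 0).1] (a 1).2)
      (by
        intro a i b c
        fin_cases i <;> simp [alt_add_left, alt_add_right] <;> abel)
      (by
        intro a i b c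
        fin_cases i <;> simp [alt_smul_left, alt_smul_right]) with
    map_eq_zero_of_eq' := by
      intro a i j hij hne
      change ρ ![(a 0).1, (a 1).1] (a 2).2 + ρ ![(a 1).1, (a 2).1] (a 0).2
        + ρ ![(a 2).1, (a 0).1] (a 1).2 = 0
      have h3 : a 0 = a 1 ∨ a 1 = a 2 ∨ a 2 = a 0 := by
        fin_cases i <;> fin_cases j <;> simp_all
      rcases h3 with e | e | e
      · rw [e, alt_self, alt_swap ρ (a 2).1]; simp
      · rw [e, alt_self, alt_swap ρ (a 2).1]; simp
      · rw [e, alt_self, alt_swap ρ (a 1).1]; simp }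

/-- The semidirect product bracket `π + ρ + μ` on `g ⊕ h`, see `semidirectBracket_apply`. -/
def semidirectBracket (π : g [⋀^Fin 3]→ₗ[K] g) (μ : h [⋀^Fin 3]→ₗ[K] h)
    (ρ : g [⋀^Fin 2]→ₗ[K] Module.End K h) : (g × h) [⋀^Fin 3]→ₗ[K] (g × h) :=
  (LinearMap.inl K g h).compAlternatingMap (π.compLinearMap (LinearMap.fst K g h)) +
  (LinearMap.inr K g h).compAlternatingMap
    (mixedBracket ρ + μ.compLinearMap (LinearMap.snd K g h))

theorem semidirectBracket_apply (π : g [⋀^Fin 3]→ₗ[K] g) (μ : h [⋀^Fin 3]→ₗ[K] h)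
    (ρ : g [⋀^Fin 2]→ₗ[K] Module.End K h) (x y z : g) (u v w : h) :
    semidirectBracket π μ ρ ![(x, u), (y, v), (z, w)] =
      (π ![x, y, z], ρ ![x, y] w + ρ ![y, z] u + ρ ![z, x] v + μ ![u, v, w]) := by
  have e1 : (fun i => (![(x, u), (y, v), (z, w)] i).1) = ![x, y, z] := by
    ext i; fin_cases i <;> rfl
  have e2 : (fun i => (![(x, u), (y, v), (z, w)] i).2) = ![u, v, w] := by
    ext i; fin_cases i <;> rfl
  simp [semidirectBracket, mixedBracket, e1, e2]
end Algebra

section Cochain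
variable (K V W : Type*) [Field K] [AddCommGroup V] [Module K V] [AddCommGroup W] [Module K W]

/-- The decomposable element `x ∧ y` of `∧²V`. -/
def wedge {V : Type*} [AddCommGroup V] [Module K V] (x y : V) : ⋀[K]^2 V :=
  exteriorPower.ιMulti K 2 ![x, y]

/-- `Hom(∧²V ⊗ ⋯ ⊗ ∧²V ⊗ V, W)` with `n` factors `∧²V`, in curried form. -/
abbrev PreCochain (n : ℕ) : Type _ := MultilinearMap K (fun _ : Fin n => ⋀[K]^2 V) (V →ₗ[K] W)

/-- `Cⁿ(V, W) = Hom(∧²V ⊗ ⋯ ⊗ ∧²V ∧ V, W)` with `n` factors `∧²V`. The last `∧` means that the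
last factor `∧²V` and the final `V` are wedged to `∧³V`: the value at `(X₁, …, X_{n-1}, x ∧ y, z)`
is alternating in `x, y, z`. As it is alternating in `x, y` anyway, this amounts to its
vanishing for `z = y`. In particular `C⁰ = Hom(V, W)` and `C¹ = Hom(∧³V, W)`. -/
def Cochain (n : ℕ) : Submodule K (PreCochain K V W n) where
  carrier := {f | ∀ (X : Fin n → ⋀[K]^2 V) (i : Fin n) (x y : V), (i : ℕ) + 1 = n →
    X i = wedge K x y → f X y = 0}
  add_mem' := by
    intro f f' hf hf' X i x y hi hX
    simp [hf X i x y hi hX, hf' X i x y hi hX]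
  zero_mem' := by intro X i x y hi hX; simp
  smul_mem' := by
    intro c f hf X i x y hi hX
    simp [hf X i x y hi hX]

instance (n : ℕ) : AddCommGroup (Cochain K V W n) := inferInstance

instance (n : ℕ) : Module K (Cochain K V W n) := inferInstance

variable {K V W}

/-- The endomorphism `x ∧ y ↦ T x ∧ y + x ∧ T y` of `∧²V`, linear in `T`. -/
noncomputable def wedgeDer : (V →ₗ[K] V) →ₗ[K] (⋀[K]^2 V →ₗ[K] ⋀[K]^2 V) :=
  (exteriorPower.alternatingMapLinearEquiv (R := K) (n := 2)).toLinearMap ∘ₗ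
  { toFun := fun T =>
    { MultilinearMap.mk' (fun a : Fin 2 → V => wedge K (T (a 0)) (a 1) + wedge K (a 0) (T (a 1)))
        (by
          intro a i b c
          fin_cases i <;> simp [wedge, alt_add_left, alt_add_right] <;> abel)
        (by
          intro a i b c
          fin_cases i <;> simp [wedge, alt_smul_left, alt_smul_right]) with
      map_eq_zero_of_eq' := by
        intro a i j hij hne
        change wedge K (T (a 0)) (a 1) + wedge K (a 0) (T (a 1)) = 0
        have e : a 0 = a 1 := by
          fin_cases i <;> fin_cases j <;> simp_all
        rw [e, wedge, alt_swap, wedge, neg_add_cancel] }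
    map_add' := by
      intro S T
      ext a : 1
      change wedge K (S (a 0) + T (a 0)) (a 1) + wedge K (a 0) (S (a 1) + T (a 1)) =
        (wedge K (S (a 0)) (a 1) + wedge K (a 0) (S (a 1))) +
        (wedge K (T (a 0)) (a 1) + wedge K (a 0) (T (a 1)))
      simp only [wedge, alt_add_left, alt_add_right]; abel
    map_smul' := by
      intro t T
      ext a : 1
      change wedge K (t • T (a 0)) (a 1) + wedge K (a 0) (t • T (a 1)) =
        t • (wedge K (T (a 0)) (a 1) + wedge K (a 0) (T (a 1)))
      simp only [wedge, alt_smul_left, alt_smul_right, smul_add] }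

theorem wedgeDer_wedge (T : V →ₗ[K] V) (x y : V) :
    wedgeDer T (wedge K x y) = wedge K (T x) y + wedge K x (T y) := by
  simp [wedgeDer, wedge]


/-- The `(i, n - i)`-shuffles: `σ(1) < ⋯ < σ(i)` and `σ(i+1) < ⋯ < σ(n)`
(positions are numbered from `0` in the code). -/
def shuffles (i n : ℕ) : Finset (Equiv.Perm (Fin n)) :=
  Finset.univ.filter fun σ => ∀ a b : Fin n, a < b → ((b : ℕ) < i ∨ i ≤ (a : ℕ)) → σ a < σ b

/-- The list of arguments
`X_{σ(1)}, …, X_{σ(k)}, Q(X_{σ(k+1)}, …, X_{σ(k+q)}, x) ∧ y + x ∧ Q(X_{σ(k+1)}, …, X_{σ(k+q)}, y),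
X_{k+q+2}, …, X_{p+q}`, where `X_{k+q+1} = x ∧ y` and `k = 0, …, p - 1`. -/
noncomputable def insertArgs {p q : ℕ} (Q : PreCochain K V V q) (k : Fin p)
    (σ : Equiv.Perm (Fin (k + q))) (X : Fin (p + q) → ⋀[K]^2 V) (j : Fin p) : ⋀[K]^2 V :=
  if hj : (j : ℕ) < k then X (Fin.castLE (by omega) (σ ⟨j, by omega⟩))
  else if j = k then
    wedgeDer (Q fun i => X (Fin.castLE (by omega) (σ (Fin.natAdd k i)))) (X ⟨k + q, by omega⟩)
  else X ⟨j + q, by omega⟩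

theorem insertArgs_update {p q : ℕ} (Q : PreCochain K V V q) (k : Fin p)
    (σ : Equiv.Perm (Fin (k + q))) (X : Fin (p + q) → ⋀[K]^2 V) (m : Fin (p + q)) :
    ∃ (j : Fin p) (A : Fin p → ⋀[K]^2 V) (T : ⋀[K]^2 V →ₗ[K] ⋀[K]^2 V), ∀ v,
      insertArgs Q k σ (Function.update X m v) = Function.update A j (T v) := by
  by_cases hm : (m : ℕ) < k + q
  · obtain ⟨s, hs⟩ := σ.surjective ⟨m, hm⟩
    have key (t : Fin (k + q)) (h : (k : ℕ) + q ≤ p + q) (v) :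
        Function.update X m v (Fin.castLE h (σ t)) =
          if t = s then v else X (Fin.castLE h (σ t)) := by
      by_cases ht : t = s
      · subst ht; rw [if_pos rfl]
        have : Fin.castLE h (σ t) = m := by rw [hs]; rfl
        rw [this, Function.update_self]
      · rw [if_neg ht, Function.update_of_ne]
        intro hc
        apply ht
        apply σ.injective
        rw [hs]
        have := congrArg Fin.val hc
        exact Fin.ext (by simpa using this)
    by_cases hsk : (s : ℕ) < k
    · refine ⟨⟨s, by omega⟩, insertArgs Q k σ X, LinearMap.id, fun v => ?_⟩
      ext1 j
      by_cases hj : j = ⟨s, by omega⟩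
      · subst hj
        simp only [Function.update_self, insertArgs, dif_pos hsk, key, if_pos, LinearMap.id_apply]
      · rw [Function.update_of_ne hj]
        have hjs : (j : ℕ) ≠ s := fun h => hj (Fin.ext h)
        unfold insertArgs
        split_ifs with h1 h2
        · rw [key, if_neg (by rw [Fin.ext_iff]; exact hjs)]
        · have e1 : ∀ i : Fin q, ¬ (Fin.natAdd (k : ℕ) i = s) := by
            intro i hi
            have := congrArg Fin.val hi
            simp at this; omega
          simp only [key, e1, if_false]
          rw [Function.update_of_ne]
          intro hc; have := congrArg Fin.val hc; simp at this; omega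
        · rw [Function.update_of_ne]
          intro hc; have := congrArg Fin.val hc; simp at this
          have : (j : ℕ) ≠ k := fun h => h2 (Fin.ext h)
          omega
    · refine ⟨k, insertArgs Q k σ X,
        (wedgeDer.flip (X ⟨k + q, by omega⟩)) ∘ₗ Q.toLinearMap
          (fun i => X (Fin.castLE (by omega) (σ (Fin.natAdd k i)))) ⟨s - k, by omega⟩,
        fun v => ?_⟩
      ext1 j
      by_cases hj : j = k
      · subst hj
        have e2 : (fun i : Fin q => Function.update X m v (Fin.castLE (by omega)
            (σ (Fin.natAdd (j : ℕ) i)))) = Function.update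
            (fun i => X (Fin.castLE (by omega) (σ (Fin.natAdd j i)))) ⟨s - j, by omega⟩ v := by
          ext1 i
          rw [key]
          by_cases hi : i = ⟨s - j, by omega⟩
          · subst hi
            rw [if_pos (by apply Fin.ext; simp; omega), Function.update_self]
          · rw [Function.update_of_ne hi, if_neg]
            intro hc
            apply hi
            apply Fin.ext
            have := congrArg Fin.val hc
            simp at this ⊢; omega
        have e3 : (⟨j + q, by omega⟩ : Fin (p + q)) ≠ m := by
          intro hc; have := congrArg Fin.val hc; simp at this; omega
        simp only [Function.update_self, insertArgs, lt_irrefl, dif_neg, not_false_eq_true, if_pos,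
          LinearMap.comp_apply, LinearMap.flip_apply, MultilinearMap.toLinearMap_apply]
        rw [e2, Function.update_of_ne e3]
      · rw [Function.update_of_ne hj]
        have hjk : (j : ℕ) ≠ k := fun h => hj (Fin.ext h)
        unfold insertArgs
        split_ifs with h1
        · rw [key, if_neg (by rw [Fin.ext_iff]; simp; omega)]
        · rw [Function.update_of_ne]
          intro hc; have := congrArg Fin.val hc; simp at this; omega
  · have key (t : Fin (k + q)) (h : (k : ℕ) + q ≤ p + q) (v) :
        Function.update X m v (Fin.castLE h (σ t)) = X (Fin.castLE h (σ t)) := by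
      rw [Function.update_of_ne]
      intro hc; have := congrArg Fin.val hc; simp at this; omega
    by_cases hmk : (m : ℕ) = k + q
    · refine ⟨k, insertArgs Q k σ X,
        wedgeDer (Q fun i => X (Fin.castLE (by omega) (σ (Fin.natAdd k i)))), fun v => ?_⟩
      have e3 : (⟨k + q, by omega⟩ : Fin (p + q)) = m := Fin.ext hmk.symm
      ext1 j
      by_cases hj : j = k
      · subst hj
        simp only [Function.update_self, insertArgs, lt_irrefl, dif_neg, not_false_eq_true, if_pos,
          key]
        rw [e3, Function.update_self]
      · rw [Function.update_of_ne hj]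
        have hjk : (j : ℕ) ≠ k := fun h => hj (Fin.ext h)
        unfold insertArgs
        rw [if_neg hj, if_neg hj]
        simp only [key]
        rw [Function.update_of_ne]
        intro hc; have := congrArg Fin.val hc; simp at this; omega
    · refine ⟨⟨m - q, by omega⟩, insertArgs Q k σ X, LinearMap.id, fun v => ?_⟩
      ext1 j
      by_cases hj : j = ⟨m - q, by omega⟩
      · have h1 : (j : ℕ) = m - q := congrArg Fin.val hj
        rw [hj, Function.update_self, ← hj]
        have h2 : ¬ (j : ℕ) < k := by omega
        have h3 : j ≠ k := fun h => by subst h; omega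
        have e3 : (⟨j + q, by omega⟩ : Fin (p + q)) = m := Fin.ext (by simp; omega)
        rw [insertArgs, dif_neg h2, if_neg h3, e3, Function.update_self, LinearMap.id_apply]
      · rw [Function.update_of_ne hj]
        have hjk : (j : ℕ) ≠ m - q := fun h => hj (Fin.ext h)
        unfold insertArgs
        simp only [key]
        rw [Function.update_of_ne (a := (⟨k + q, by omega⟩ : Fin (p + q))),
          Function.update_of_ne (a := (⟨j + q, by omega⟩ : Fin (p + q)))]
        · intro hc; have := congrArg Fin.val hc; simp at this; omega
        · intro hc; have := congrArg Fin.val hc; simp at this; omega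

/-- `P` evaluated at `insertArgs`. -/
noncomputable def insertTerm {p q : ℕ} (P : PreCochain K V V p) (Q : PreCochain K V V q)
    (k : Fin p) (σ : Equiv.Perm (Fin (k + q))) : PreCochain K V V (p + q) :=
  MultilinearMap.mk' (fun X => P (insertArgs Q k σ X))
    (by
      intro X m v w
      obtain ⟨j, A, T, hT⟩ := insertArgs_update Q k σ X m
      simp only [hT, map_add, MultilinearMap.map_update_add])
    (by
      intro X m c v
      obtain ⟨j, A, T, hT⟩ := insertArgs_update Q k σ X m
      simp only [hT, map_smul, MultilinearMap.map_update_smul])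

theorem outer_update_left {M : Type*} {p q : ℕ} (σ : Equiv.Perm (Fin (p + q)))
    (X : Fin (p + q) → M) (j : Fin p) (v : M) :
    (fun t => Function.update X (σ (Fin.castAdd q j)) v (σ (Fin.castAdd q t))) =
      Function.update (fun t => X (σ (Fin.castAdd q t))) j v := by
  ext1 t
  by_cases ht : t = j
  · subst ht; simp
  · rw [Function.update_of_ne ht, Function.update_of_ne]
    intro hc; exact ht (Fin.castAdd_injective _ _ (σ.injective hc))

theorem outer_update_left' {M : Type*} {p q : ℕ} (σ : Equiv.Perm (Fin (p + q)))
    (X : Fin (p + q) → M) (j : Fin p) (v : M) :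
    (fun t => Function.update X (σ (Fin.castAdd q j)) v (σ (Fin.natAdd p t))) =
      (fun t => X (σ (Fin.natAdd p t))) := by
  ext1 t
  rw [Function.update_of_ne]
  intro hc
  have := congrArg Fin.val (σ.injective hc)
  simp at this; omega

theorem outer_update_right {M : Type*} {p q : ℕ} (σ : Equiv.Perm (Fin (p + q)))
    (X : Fin (p + q) → M) (j : Fin q) (v : M) :
    (fun t => Function.update X (σ (Fin.natAdd p j)) v (σ (Fin.natAdd p t))) =
      Function.update (fun t => X (σ (Fin.natAdd p t))) j v := by
  ext1 t
  by_cases ht : t = j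
  · subst ht; simp
  · rw [Function.update_of_ne ht, Function.update_of_ne]
    intro hc; exact ht (Fin.natAdd_injective _ _ (σ.injective hc))

theorem outer_update_right' {M : Type*} {p q : ℕ} (σ : Equiv.Perm (Fin (p + q)))
    (X : Fin (p + q) → M) (j : Fin q) (v : M) :
    (fun t => Function.update X (σ (Fin.natAdd p j)) v (σ (Fin.castAdd q t))) =
      (fun t => X (σ (Fin.castAdd q t))) := by
  ext1 t
  rw [Function.update_of_ne]
  intro hc
  have := congrArg Fin.val (σ.injective hc)
  simp at this; omega

/-- `P(X_{σ(1)}, …, X_{σ(p)}, Q(X_{σ(p+1)}, …, X_{σ(p+q)}, x))`. -/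
noncomputable def outerTerm {p q : ℕ} (P : PreCochain K V V p) (Q : PreCochain K V V q)
    (σ : Equiv.Perm (Fin (p + q))) : PreCochain K V V (p + q) :=
  MultilinearMap.mk' (fun X => (P fun j => X (σ (Fin.castAdd q j))) ∘ₗ
      (Q fun i => X (σ (Fin.natAdd p i))))
    (by
      intro X m v w
      obtain ⟨s, rfl⟩ := σ.surjective m
      refine Fin.addCases (fun j => ?_) (fun i => ?_) s
      · simp only [outer_update_left, outer_update_left', MultilinearMap.map_update_add,
          LinearMap.add_comp]
      · simp only [outer_update_right, outer_update_right', MultilinearMap.map_update_add,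
          LinearMap.comp_add])
    (by
      intro X m c v
      obtain ⟨s, rfl⟩ := σ.surjective m
      refine Fin.addCases (fun j => ?_) (fun i => ?_) s
      · simp only [outer_update_left, outer_update_left', MultilinearMap.map_update_smul,
          LinearMap.smul_comp]
      · simp only [outer_update_right, outer_update_right', MultilinearMap.map_update_smul,
          LinearMap.comp_smul])

/-- The circle product `P ∘ Q`; here `k` runs through `0, …, p - 1`, so it is the usual summation
index minus one. -/
noncomputable def circ {p q : ℕ} (P : PreCochain K V V p) (Q : PreCochain K V V q) :
    PreCochain K V V (p + q) :=
  (∑ k : Fin p, ∑ σ ∈ shuffles k (k + q),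
    ((-1 : K) ^ ((k : ℕ) * q) * ((Equiv.Perm.sign σ : ℤ) : K)) • insertTerm P Q k σ) +
  ∑ σ ∈ shuffles p (p + q),
    ((-1 : K) ^ (p * q) * ((Equiv.Perm.sign σ : ℤ) : K)) • outerTerm P Q σ

theorem insertArgs_eq_update {p q : ℕ} (Q Q' : PreCochain K V V q) (k : Fin p)
    (σ : Equiv.Perm (Fin (k + q))) (X : Fin (p + q) → ⋀[K]^2 V) :
    insertArgs Q k σ X = Function.update (insertArgs Q' k σ X) k
      (wedgeDer (Q fun i => X (Fin.castLE (by omega) (σ (Fin.natAdd k i))))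
        (X ⟨k + q, by omega⟩)) := by
  ext1 j
  by_cases hj : j = k
  · subst hj; simp [insertArgs]
  · rw [Function.update_of_ne hj]; simp [insertArgs, hj]

theorem insertTerm_add_right {p q : ℕ} (P : PreCochain K V V p) (Q Q' : PreCochain K V V q)
    (k : Fin p) (σ : Equiv.Perm (Fin (k + q))) :
    insertTerm P (Q + Q') k σ = insertTerm P Q k σ + insertTerm P Q' k σ := by
  ext1 X
  change P (insertArgs _ k σ X) = P (insertArgs _ k σ X) + P (insertArgs _ k σ X)
  rw [insertArgs_eq_update (Q + Q') 0, insertArgs_eq_update Q 0, insertArgs_eq_update Q' 0]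
  simp

theorem insertTerm_smul_right {p q : ℕ} (P : PreCochain K V V p) (c : K) (Q : PreCochain K V V q)
    (k : Fin p) (σ : Equiv.Perm (Fin (k + q))) :
    insertTerm P (c • Q) k σ = c • insertTerm P Q k σ := by
  ext1 X
  change P (insertArgs _ k σ X) = c • P (insertArgs _ k σ X)
  rw [insertArgs_eq_update (c • Q) 0, insertArgs_eq_update Q 0]
  simp

/-- The circle product as a bilinear map. -/
noncomputable def circLinear (p q : ℕ) :
    PreCochain K V V p →ₗ[K] PreCochain K V V q →ₗ[K] PreCochain K V V (p + q) :=
  LinearMap.mk₂ K circ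
    (by
      intro P P' Q
      have e1 (k σ) : insertTerm (P + P') Q k σ = insertTerm P Q k σ + insertTerm P' Q k σ := rfl
      have e2 (σ) : outerTerm (P + P') Q σ = outerTerm P Q σ + outerTerm P' Q σ := rfl
      simp only [circ, e1, e2, smul_add, Finset.sum_add_distrib]; abel)
    (by
      intro c P Q
      have e1 (k σ) : insertTerm (c • P) Q k σ = c • insertTerm P Q k σ := rfl
      have e2 (σ) : outerTerm (c • P) Q σ = c • outerTerm P Q σ := rfl
      simp only [circ, e1, e2, smul_add, Finset.smul_sum, smul_comm c])
    (by
      intro P Q Q'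
      have e2 (σ) : outerTerm P (Q + Q') σ = outerTerm P Q σ + outerTerm P Q' σ := by
        ext1 X; exact LinearMap.comp_add _ _ _
      simp only [circ, insertTerm_add_right, e2, smul_add, Finset.sum_add_distrib]; abel)
    (by
      intro c P Q
      have e2 (σ) : outerTerm P (c • Q) σ = c • outerTerm P Q σ := by
        ext1 X; exact LinearMap.comp_smul _ _ _
      simp only [circ, insertTerm_smul_right, e2, smul_add, Finset.smul_sum, smul_comm c])


theorem exists_shuffle_ext (n k m : ℕ) (hk : k ≤ n) (hm : m = n + 1) :
    ∃ e : Equiv.Perm (Fin n) → Equiv.Perm (Fin m),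
      (∀ τ (j : ℕ) (hj : j < k), (e τ ⟨j, by omega⟩ : ℕ) = τ ⟨j, by omega⟩) ∧
      (∀ τ, (e τ ⟨k, by omega⟩ : ℕ) = n) ∧
      (∀ τ (j : ℕ) (_ : k ≤ j) (hn : j < n), (e τ ⟨j + 1, by omega⟩ : ℕ) = τ ⟨j, hn⟩) ∧
      (∀ τ, Equiv.Perm.sign (e τ) = (-1) ^ (n - k) * Equiv.Perm.sign τ) ∧
      (∀ (M : Type _) [AddCommMonoid M] (F : Equiv.Perm (Fin m) → M),
        ∑ σ ∈ (shuffles (k + 1) m).filter (fun σ => (σ ⟨k, by omega⟩ : ℕ) = n), F σ =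
          ∑ τ ∈ shuffles k n, F (e τ)) := by
  subst hm
  set k' : Fin (n + 1) := ⟨k, by omega⟩ with hk'
  let e₁ : Fin (n + 1) ≃ Option (Fin n) := finSuccEquiv' k'
  let e₂ : Fin (n + 1) ≃ Option (Fin n) := finSuccEquiv' (Fin.last n)
  let e : Equiv.Perm (Fin n) → Equiv.Perm (Fin (n + 1)) := fun τ =>
    (e₁.trans (Equiv.optionCongr τ)).trans e₂.symm
  have ek (τ) : e τ k' = Fin.last n := by simp [e, e₁, e₂]
  have es (τ) (j : Fin n) : e τ (k'.succAbove j) = (τ j).castSucc := by simp [e, e₁, e₂]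
  have hlt (j : Fin n) (hj : (j : ℕ) < k) : k'.succAbove j = j.castSucc :=
    Fin.succAbove_of_castSucc_lt _ _ (by simpa [Fin.lt_def, hk'] using hj)
  have hge (j : Fin n) (hj : k ≤ (j : ℕ)) : k'.succAbove j = j.succ :=
    Fin.succAbove_of_le_castSucc _ _ (by simpa [Fin.le_def, hk'] using hj)
  have hmem (τ) : e τ ∈ shuffles (k + 1) (n + 1) ↔ τ ∈ shuffles k n := by
    simp only [shuffles, Finset.mem_filter, Finset.mem_univ, true_and]
    constructor
    · intro h a b hab hc
      have := h (k'.succAbove a) (k'.succAbove b) ((Fin.strictMono_succAbove k') hab) (by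
        rcases hc with hc | hc
        · left; rw [hlt b hc]; simp; omega
        · right; rw [hge a hc]; simp; omega)
      rwa [es, es, Fin.castSucc_lt_castSucc_iff] at this
    · intro h a b hab hc
      rcases Fin.eq_self_or_eq_succAbove k' a with rfl | ⟨a, rfl⟩
      · have : (k' : ℕ) < b := hab
        simp [hk'] at this hc; omega
      rcases Fin.eq_self_or_eq_succAbove k' b with rfl | ⟨b, rfl⟩
      · rw [ek, es]; exact Fin.castSucc_lt_last _
      rw [es, es, Fin.castSucc_lt_castSucc_iff]
      apply h a b ((Fin.strictMono_succAbove k').lt_iff_lt.1 hab)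
      rcases hc with hc | hc
      · left
        by_contra hb
        rw [hge b (by omega)] at hc; simp at hc; omega
      · right
        by_contra hb
        rw [hlt a (by omega)] at hc; simp at hc; omega
  refine ⟨e, ?_, ?_, ?_, ?_, ?_⟩
  · intro τ j hj
    have := es τ ⟨j, by omega⟩
    rw [hlt _ hj] at this
    exact congrArg Fin.val this
  · intro τ; exact congrArg Fin.val (ek τ)
  · intro τ j hj hn
    have := es τ ⟨j, by omega⟩
    rw [hge _ hj] at this
    exact congrArg Fin.val this
  · intro τ
    have h1 : e τ = e₂.symm.permCongr (Equiv.optionCongr τ) * (e₁.trans e₂.symm) := by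
      ext x; simp [e]
    have h2 : Fin.cycleIcc k' (Fin.last n) * (e₁.trans e₂.symm) = 1 := by
      ext x
      rcases Fin.eq_self_or_eq_succAbove k' x with rfl | ⟨x, rfl⟩
      · simp [e₁, e₂, Fin.cycleIcc_of_last (Fin.le_last _), -Fin.cycleIcc_def_le]
      · have := congrFun (Fin.cycleIcc_comp_succAbove k' (Fin.last n) (Fin.le_last _)) x
        simp only [Function.comp_apply, Fin.succAbove_last] at this
        simp [e₁, e₂, this, -Fin.cycleIcc_def_le]
    have h3 := congrArg Equiv.Perm.sign h2
    rw [Equiv.Perm.sign_mul, Fin.sign_cycleIcc_of_le (Fin.le_last _), Equiv.Perm.sign_one] at h3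
    have h4 : Equiv.Perm.sign (e₁.trans e₂.symm) = (-1) ^ (n - k) := by
      have h5 : ((-1 : ℤˣ) ^ (n - k)) * (-1) ^ (n - k) = 1 := by
        rw [← mul_pow]; simp
      have : ((Fin.last n : ℕ) - (k' : ℕ)) = n - k := rfl
      rw [this] at h3
      exact mul_left_cancel (h3.trans h5.symm)
    rw [h1, Equiv.Perm.sign_mul, h4, Equiv.Perm.sign_permCongr, Equiv.optionCongr_sign, mul_comm]
  · intro M _ F
    symm
    refine Finset.sum_bij (fun τ _ => e τ) ?_ ?_ ?_ ?_
    · intro τ hτ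
      rw [Finset.mem_filter]
      exact ⟨(hmem τ).2 hτ, congrArg Fin.val (ek τ)⟩
    · intro τ _ τ' _ h
      ext j
      have := congrArg (fun f => f (k'.succAbove j)) h
      simp only [es] at this
      exact congrArg Fin.val (Fin.castSucc_injective _ this)
    · intro σ hσ
      rw [Finset.mem_filter] at hσ
      let f : Equiv.Perm (Option (Fin n)) := (e₁.symm.trans σ).trans e₂
      have hf : f none = none := by
        have : σ k' = Fin.last n := Fin.ext hσ.2
        simp [f, e₁, e₂, this]
      have h1 : Equiv.optionCongr (Equiv.removeNone f) = f := by
        rw [map_equiv_removeNone, hf, Equiv.swap_self]; rfl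
      have h2 : e (Equiv.removeNone f) = σ := by
        simp only [e, h1]; ext x; simp [f]
      exact ⟨Equiv.removeNone f, (hmem _).1 (h2 ▸ hσ.1), h2⟩
    · intro τ _; rfl


theorem Cochain.swap_last {p : ℕ} {P : PreCochain K V W p} (hP : P ∈ Cochain K V W p)
    (A : Fin p → ⋀[K]^2 V) (j : Fin p) (hj : (j : ℕ) + 1 = p) (x y z : V) :
    P (Function.update A j (wedge K x z)) y = - P (Function.update A j (wedge K x y)) z := by
  have h (u v : V) : P (Function.update A j (wedge K u v)) v = 0 :=
    hP _ j u v hj (Function.update_self ..)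
  have h1 := h x (y + z)
  have e : wedge K x (y + z) = wedge K x y + wedge K x z := alt_add_right _ _ _ _
  rw [e, P.map_update_add, map_add, LinearMap.add_apply, LinearMap.add_apply, h x y, h x z] at h1
  rw [zero_add, add_zero] at h1
  exact eq_neg_of_add_eq_zero_left h1

theorem outerTerm_eq_zero {p q : ℕ} (P : PreCochain K V V p) {Q : PreCochain K V V q}
    (hQ : Q ∈ Cochain K V V q) (σ : Equiv.Perm (Fin (p + q))) (hσ : σ ∈ shuffles p (p + q))
    (X : Fin (p + q) → ⋀[K]^2 V) (i : Fin (p + q)) (x y : V) (hi : (i : ℕ) + 1 = p + q)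
    (hX : X i = wedge K x y) (hne : ∀ j : Fin p, (j : ℕ) + 1 = p → σ (Fin.castAdd q j) ≠ i) :
    outerTerm P Q σ X y = 0 := by
  simp only [shuffles, Finset.mem_filter, Finset.mem_univ, true_and] at hσ
  obtain ⟨s, hs⟩ := σ.surjective i
  have hmax (t : Fin (p + q)) : ¬ σ s < σ t := by
    rw [hs]; intro h; have := Fin.lt_def.1 h; omega
  have hsp : p ≤ (s : ℕ) := by
    by_contra hsp
    by_cases h1 : (s : ℕ) + 1 = p
    · exact hne ⟨s, by omega⟩ h1 hs
    · exact hmax ⟨s + 1, by omega⟩ (hσ _ _ (by simp [Fin.lt_def]) (by left; simp; omega))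
  have hsq : (s : ℕ) + 1 = p + q := by
    by_contra h1
    exact hmax ⟨s + 1, by omega⟩ (hσ _ _ (by simp [Fin.lt_def]) (by right; exact hsp))
  change (P _) ((Q fun i => X (σ (Fin.natAdd p i))) y) = 0
  have : (Q fun i => X (σ (Fin.natAdd p i))) y = 0 := by
    refine hQ _ ⟨s - p, by omega⟩ x y (by simp; omega) ?_
    have e : Fin.natAdd p (⟨s - p, by omega⟩ : Fin q) = s := Fin.ext (by simp; omega)
    simp only [e, hs, hX]
  rw [this, map_zero]

theorem circ_mem {p q : ℕ} {P : PreCochain K V V p} {Q : PreCochain K V V q}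
    (hP : P ∈ Cochain K V V p) (hQ : Q ∈ Cochain K V V q) : circ P Q ∈ Cochain K V V (p + q) := by
  intro X i x y hi hX
  rcases p with _ | p
  · simp only [circ, Finset.univ_eq_empty, Finset.sum_empty, zero_add, sum_apply,
      LinearMap.sum_apply, smul_apply, LinearMap.smul_apply]
    refine Finset.sum_eq_zero fun σ hσ => ?_
    rw [outerTerm_eq_zero P hQ σ hσ X i x y hi hX (fun j => j.elim0), smul_zero]
  obtain ⟨e, he1, he2, he3, hsgn, hsum⟩ :=
    exists_shuffle_ext (p + q) p (p + 1 + q) (by omega) (by omega)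
  have hi' : (i : ℕ) = p + q := by omega
  simp only [circ, add_apply, LinearMap.add_apply, sum_apply,
      LinearMap.sum_apply, smul_apply, LinearMap.smul_apply]
  rw [Fin.sum_univ_castSucc, Finset.sum_eq_zero, zero_add]
  · -- the two families of terms in which the last pair and the last vector meet cancel
    have hout : ∑ σ ∈ shuffles (p + 1) (p + 1 + q),
        ((-1 : K) ^ ((p + 1) * q) * ((Equiv.Perm.sign σ : ℤ) : K)) • outerTerm P Q σ X y =
        ∑ τ ∈ shuffles p (p + q), ((-1 : K) ^ ((p + 1) * q) * ((Equiv.Perm.sign (e τ) : ℤ) : K)) •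
          outerTerm P Q (e τ) X y := by
      rw [← hsum V (fun σ => ((-1 : K) ^ ((p + 1) * q) * ((Equiv.Perm.sign σ : ℤ) : K)) •
        outerTerm P Q σ X y)]
      refine (Finset.sum_filter_of_ne fun σ hσ hne => ?_).symm
      by_contra hc
      apply hne
      rw [outerTerm_eq_zero P hQ σ hσ X i x y hi hX, smul_zero]
      intro j hj hji
      apply hc
      have : (⟨p, by omega⟩ : Fin (p + 1 + q)) = Fin.castAdd q j := Fin.ext (by simp; omega)
      rw [this, hji, hi']
    rw [hout]
    refine (Finset.sum_add_distrib (s := shuffles p (p + q))).symm.trans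
      (Finset.sum_eq_zero fun τ hτ => ?_)
    have hins : insertTerm P Q (Fin.last p) τ X y = - outerTerm P Q (e τ) X y := by
      change P (insertArgs Q (Fin.last p) τ X) y =
        - P (fun j => X (e τ (Fin.castAdd q j))) ((Q fun i => X (e τ (Fin.natAdd (p + 1) i))) y)
      have hlast : (⟨(Fin.last p : ℕ) + q, by simp⟩ : Fin (p + 1 + q)) = i :=
        Fin.ext hi'.symm
      have hQe : (fun i : Fin q => X (e τ (Fin.natAdd (p + 1) i))) =
          fun i => X (Fin.castLE (by simp) (τ (Fin.natAdd ((Fin.last p : Fin (p + 1)) : ℕ) i))) := by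
        ext1 t
        congr 1
        apply Fin.ext
        have := he3 τ (p + t) (by omega) (by omega)
        have e4 : Fin.natAdd (p + 1) t = (⟨p + t + 1, by omega⟩ : Fin (p + 1 + q)) :=
          Fin.ext (by simp; omega)
        rw [e4, this]; rfl
      have hPe : (fun j => X (e τ (Fin.castAdd q j))) = Function.update
          (insertArgs Q (Fin.last p) τ X) (Fin.last p) (wedge K x y) := by
        ext1 j
        by_cases hj : j = Fin.last p
        · subst hj
          rw [Function.update_self, ← hX]
          congr 1
          apply Fin.ext
          rw [hi']; exact he2 τ
        · rw [Function.update_of_ne hj]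
          have hj' : (j : ℕ) < (Fin.last p : Fin (p + 1)) := Fin.lt_last_iff_ne_last.2 hj
          rw [insertArgs, dif_pos hj']
          congr 1
          apply Fin.ext
          exact he1 τ j hj'
      rw [hPe, hQe, insertArgs_eq_update Q Q, hlast, hX, wedgeDer_wedge, P.map_update_add,
        LinearMap.add_apply]
      rw [hP _ (Fin.last p) _ y (by simp) (Function.update_self ..), zero_add]
      rw [Function.update_idem]
      exact Cochain.swap_last hP _ (Fin.last p) (by simp) _ _ _
    rw [hins, hsgn, smul_neg, neg_add_eq_zero]
    congr 1
    have e5 : p + q - p = q := by omega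
    have e6 : ((Fin.last p : Fin (p + 1)) : ℕ) = p := rfl
    rw [e5]
    push_cast
    have e7 : ((-1 : K) ^ q) * (-1) ^ q = 1 := by rw [← mul_pow]; simp
    rw [add_mul, one_mul, pow_add, mul_assoc, ← mul_assoc ((-1 : K) ^ q), e7, one_mul]
  · intro k _
    refine Finset.sum_eq_zero fun σ hσ => ?_
    have : insertTerm P Q k.castSucc σ X y = 0 := by
      change P (insertArgs Q k.castSucc σ X) y = 0
      refine hP _ (Fin.last p) x y (by simp) ?_
      have h1 : ¬ ((Fin.last p : Fin (p + 1)) : ℕ) < k.castSucc := by simp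
      have h2 : Fin.last p ≠ k.castSucc := (Fin.castSucc_lt_last k).ne'
      rw [insertArgs, dif_neg h1, if_neg h2, ← hX]
      congr 1
      exact Fin.ext hi'.symm
    rw [this, smul_zero]

/-- The circle product `Cᵖ(V, V) × C^q(V, V) → C^{p+q}(V, V)`. -/
noncomputable def circC (p q : ℕ) :
    Cochain K V V p →ₗ[K] Cochain K V V q →ₗ[K] Cochain K V V (p + q) :=
  LinearMap.mk₂ K (fun P Q => ⟨circLinear p q P.1 Q.1, circ_mem P.2 Q.2⟩)
    (fun P P' Q => Subtype.ext (by simp))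
    (fun c P Q => Subtype.ext (by simp))
    (fun P Q Q' => Subtype.ext (by simp))
    (fun c P Q => Subtype.ext (by simp))

variable (K V W) in
/-- `C*(V, W) = ⊕_{n ≥ 0} Cⁿ(V, W)`. -/
abbrev TotalCochain : Type _ := DirectSum ℕ fun n => Cochain K V W n

noncomputable instance : AddCommGroup (TotalCochain K V W) := inferInstance

noncomputable instance : Module K (TotalCochain K V W) := inferInstance

/-- The graded commutator bracket `[P, Q] = P ∘ Q - (-1)^{pq} Q ∘ P` on `C*(V, V)`,
for `P` of degree `p` and `Q` of degree `q`, extended bilinearly. -/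
noncomputable def nrBracket :
    TotalCochain K V V →ₗ[K] TotalCochain K V V →ₗ[K] TotalCochain K V V :=
  DirectSum.toModule K ℕ _ fun p => LinearMap.flip <| DirectSum.toModule K ℕ _ fun q =>
    LinearMap.flip <|
      (circC p q).compr₂ (DirectSum.lof K ℕ (fun n => Cochain K V V n) (p + q)) -
      ((-1 : K) ^ (p * q)) •
        ((circC q p).compr₂ (DirectSum.lof K ℕ (fun n => Cochain K V V n) (q + p))).flip

theorem nrBracket_lof (p q : ℕ) (P : Cochain K V V p) (Q : Cochain K V V q) :
    nrBracket (DirectSum.lof K ℕ (fun n => Cochain K V V n) p P)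
      (DirectSum.lof K ℕ (fun n => Cochain K V V n) q Q) =
    DirectSum.lof K ℕ (fun n => Cochain K V V n) (p + q) (circC p q P Q) -
      ((-1 : K) ^ (p * q)) •
        DirectSum.lof K ℕ (fun n => Cochain K V V n) (q + p) (circC q p Q P) := by
  simp [nrBracket]

/-- Pull back along `f : V' → V` and push forward along `u : W → W'`:
`P ↦ u ∘ P ∘ (∧²f ⊗ ⋯ ⊗ ∧²f ⊗ f)`. -/
noncomputable def Cochain.map {V' W' : Type*} [AddCommGroup V'] [Module K V'] [AddCommGroup W']
    [Module K W'] (f : V' →ₗ[K] V) (u : W →ₗ[K] W') (n : ℕ) :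
    Cochain K V W n →ₗ[K] Cochain K V' W' n where
  toFun P := ⟨((LinearMap.lcomp K W' f) ∘ₗ (LinearMap.llcomp K V W W' u)).compMultilinearMap
      (P.1.compLinearMap fun _ => exteriorPower.map 2 f), by
    intro X i x y hi hX
    have h := P.2 (fun j => exteriorPower.map 2 f (X j)) i (f x) (f y) hi (by
      have e : (f ∘ ![x, y]) = ![f x, f y] := by ext t; fin_cases t <;> rfl
      simp only [hX, wedge, exteriorPower.map_apply_ιMulti, e])
    change u (P.1 (fun j => exteriorPower.map 2 f (X j)) (f y)) = 0
    rw [h, map_zero]⟩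
  map_add' P P' := by
    apply Subtype.ext; ext X v; simp
  map_smul' c P := by
    apply Subtype.ext; ext X v; simp

theorem Cochain.map_apply {V' W' : Type*} [AddCommGroup V'] [Module K V'] [AddCommGroup W']
    [Module K W'] (f : V' →ₗ[K] V) (u : W →ₗ[K] W') (n : ℕ) (P : Cochain K V W n)
    (X : Fin n → ⋀[K]^2 V') (v : V') :
    (Cochain.map f u n P).1 X v = u (P.1 (fun i => exteriorPower.map 2 f (X i)) (f v)) := rfl

/-- A trilinear alternating bracket, viewed as an element of `C¹(V, V) = Hom(∧³V, V)`. -/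
noncomputable def ofBracket (m : V [⋀^Fin 3]→ₗ[K] V) : Cochain K V V 1 :=
  ⟨MultilinearMap.ofSubsingleton K (⋀[K]^2 V) (V →ₗ[K] V) (0 : Fin 1)
    (LinearMap.flip ((exteriorPower.alternatingMapLinearEquiv (R := K) (n := 2)).toLinearMap ∘ₗ
      m.curryLeft)), by
    intro X i x y _ hX
    obtain rfl : i = 0 := Subsingleton.elim _ _
    simp only [MultilinearMap.ofSubsingleton_apply_apply, hX, wedge, LinearMap.flip_apply,
      LinearMap.comp_apply, LinearEquiv.coe_coe, exteriorPower.alternatingMapLinearEquiv_apply_ιMulti,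
      AlternatingMap.curryLeft_apply_apply]
    exact m.map_eq_zero_of_eq _ (i := 0) (j := 2) rfl (by decide)⟩

theorem ofBracket_apply (m : V [⋀^Fin 3]→ₗ[K] V) (x y z : V) :
    (ofBracket m).1 (fun _ => wedge K x y) z = m ![x, y, z] := by
  have e : (ofBracket m).1 (fun _ => wedge K x y) z = m ![z, x, y] := by
    simp [ofBracket, wedge]
  have h1 := m.map_swap ![z, x, y] (i := 0) (j := 1) (by decide)
  have h2 := m.map_swap ![x, z, y] (i := 1) (j := 2) (by decide)
  have e1 : ![z, x, y] ∘ Equiv.swap (0 : Fin 3) 1 = ![x, z, y] := by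
    ext t; fin_cases t <;> rfl
  have e2 : ![x, z, y] ∘ Equiv.swap (1 : Fin 3) 2 = ![x, y, z] := by
    ext t; fin_cases t <;> rfl
  rw [e1] at h1
  rw [e2] at h2
  rw [e, h2, h1, neg_neg]

/-- A linear map, viewed as an element of `C⁰(V, W) = Hom(V, W)`. -/
noncomputable def ofHom (f : V →ₗ[K] W) : TotalCochain K V W :=
  DirectSum.lof K ℕ (fun n => Cochain K V W n) 0
    ⟨MultilinearMap.constOfIsEmpty K _ f, fun _ i => i.elim0⟩

variable (K V W) in
/-- The `ℤ`-grading: `Cⁿ(V, W)` sits in degree `n`, and negative degrees are zero. -/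
def cochainGrading (d : ℤ) : Submodule K (TotalCochain K V W) where
  carrier := {P | ∀ n : ℕ, (n : ℤ) ≠ d → P n = 0}
  add_mem' := by
    intro P Q hP hQ n hn
    rw [DirectSum.add_apply, hP n hn, hQ n hn, add_zero]
  zero_mem' := fun _ _ => rfl
  smul_mem' := by
    intro c P hP n hn
    rw [DirectSum.smul_apply, hP n hn, smul_zero]

end Cochain

section LInfinity
variable {K A : Type*} [Field K] [AddCommGroup A] [Module K A]

/-- The Koszul sign `ε(σ)` of homogeneous elements of degrees `d`: the product of
`(-1)^{|x_i||x_j|}` over all pairs whose order is reversed in `x_{σ(1)}, …, x_{σ(n)}`. -/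
def koszulSign {n : ℕ} (d : Fin n → ℤ) (σ : Equiv.Perm (Fin n)) : ℤˣ :=
  ∏ a : Fin n, ∏ b : Fin n,
    if a < b ∧ σ b < σ a then (-1 : ℤˣ) ^ (d (σ a) * d (σ b)) else 1

/-- `L_∞`-algebra structure (graded symmetric brackets `l_k`, `k ≥ 1`, of degree `1`) on the graded
vector space `A = ⊕ 𝒜 d`; the map `l 0` plays no role. In the generalized Jacobi identity the inner
bracket is `l_{i+1}` with `i = 0, …, n - 1`, the outer one is `l_{n-i}`. -/
structure IsLInfinityAlgebra (𝒜 : ℤ → Submodule K A)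
    (l : (k : ℕ) → MultilinearMap K (fun _ : Fin k => A) A) : Prop where
  isInternal : DirectSum.IsInternal 𝒜
  degree_one : ∀ k : ℕ, 1 ≤ k → ∀ (d : Fin k → ℤ) (x : Fin k → A), (∀ i, x i ∈ 𝒜 (d i)) →
    l k x ∈ 𝒜 ((∑ i, d i) + 1)
  graded_symmetry : ∀ n : ℕ, 1 ≤ n → ∀ (d : Fin n → ℤ) (x : Fin n → A), (∀ i, x i ∈ 𝒜 (d i)) →
    ∀ σ : Equiv.Perm (Fin n),
      l n (fun i => x (σ i)) = ((koszulSign d σ : ℤ) : K) • l n x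
  generalized_jacobi : ∀ n : ℕ, 1 ≤ n → ∀ (d : Fin n → ℤ) (x : Fin n → A),
    (∀ i, x i ∈ 𝒜 (d i)) →
    ∑ i : Fin n, ∑ σ ∈ shuffles (i + 1) n, ((koszulSign d σ : ℤ) : K) •
      l (n - 1 - i + 1) (Matrix.vecCons
        (l (i + 1) fun s : Fin (i + 1) => x (σ ⟨s, by omega⟩))
        (fun t : Fin (n - 1 - i) => x (σ ⟨i + 1 + t, by omega⟩))) = 0

/-- Maurer-Cartan elements: degree zero elements with `∑_{n ≥ 1} (1 / n!) l_n(α, …, α) = 0`,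
where the sum is required to be finite. -/
structure IsMaurerCartan (𝒜 : ℤ → Submodule K A)
    (l : (k : ℕ) → MultilinearMap K (fun _ : Fin k => A) A) (α : A) : Prop where
  mem_zero : α ∈ 𝒜 0
  finite_support : {n : ℕ | l (n + 1) (fun _ => α) ≠ 0}.Finite
  equation : ∑ᶠ n : ℕ, (((n + 1).factorial : K))⁻¹ • l (n + 1) (fun _ => α) = 0

/-- `(x₁, …, x_k) ↦ f(α, …, α, x₁, …, x_k)` with `n` copies of `α`. -/
def insertLeft (α : A) (n k : ℕ) (f : MultilinearMap K (fun _ : Fin (n + k) => A) A) :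
    MultilinearMap K (fun _ : Fin k => A) A :=
  (f.domDomCongr finSumFinEquiv.symm).currySum (fun _ : Fin n => α)

theorem insertLeft_apply (α : A) (n k : ℕ) (f : MultilinearMap K (fun _ : Fin (n + k) => A) A)
    (x : Fin k → A) : insertLeft α n k f x = f (Fin.append (fun _ => α) x) := by
  simp only [insertLeft, MultilinearMap.currySum_apply', MultilinearMap.domDomCongr_apply]
  congr 1
  ext1 i
  refine Fin.addCases (fun j => ?_) (fun j => ?_) i <;> simp

/-- The twisted brackets `l_k^α = ∑_{n ≥ 0} (1 / n!) l_{n+k}(α, …, α, -)`. -/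
noncomputable def twist (l : (k : ℕ) → MultilinearMap K (fun _ : Fin k => A) A) (α : A) (k : ℕ) :
    MultilinearMap K (fun _ : Fin k => A) A :=
  ∑ᶠ n : ℕ, ((n.factorial : K))⁻¹ • insertLeft α n k (l (n + k))

end LInfinity

section DerivedBrackets
variable {K g h : Type*} [Field K] [AddCommGroup g] [Module K g] [AddCommGroup h] [Module K h]

variable (K g h) in
/-- The inclusion of `C*(g, h)` in `C*(g ⊕ h, g ⊕ h)`. -/
noncomputable def inclF : TotalCochain K g h →ₗ[K] TotalCochain K (g × h) (g × h) :=
  DirectSum.lmap (Cochain.map (LinearMap.fst K g h) (LinearMap.inr K g h))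

variable (K g h) in
/-- The projection of `C*(g ⊕ h, g ⊕ h)` onto `C*(g, h)`: restrict to `g`, then take the
`h`-component. -/
noncomputable def projF : TotalCochain K (g × h) (g × h) →ₗ[K] TotalCochain K g h :=
  DirectSum.lmap (Cochain.map (LinearMap.inl K g h) (LinearMap.snd K g h))

/-- `[⋯[[Δ, a₁], a₂], ⋯, a_k]`, for `a_i` in `C*(g, h)`. -/
noncomputable def iteratedBracket (Δ : TotalCochain K (g × h) (g × h)) :
    (k : ℕ) → MultilinearMap K (fun _ : Fin k => TotalCochain K g h) (TotalCochain K (g × h) (g × h))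
  | 0 => MultilinearMap.constOfIsEmpty K _ Δ
  | k + 1 => MultilinearMap.uncurryRight
      ((nrBracket.compl₂ (inclF K g h)).compMultilinearMap (iteratedBracket Δ k))

/-- The higher derived brackets `l_k(a₁, …, a_k)` on `C*(g, h)`: the projection of
`[⋯[[Δ, a₁], a₂], ⋯, a_k]` with `Δ = π + ρ + μ`. -/
noncomputable def derivedBracket (π : g [⋀^Fin 3]→ₗ[K] g) (μ : h [⋀^Fin 3]→ₗ[K] h)
    (ρ : g [⋀^Fin 2]→ₗ[K] Module.End K h) (k : ℕ) :
    MultilinearMap K (fun _ : Fin k => TotalCochain K g h) (TotalCochain K g h) :=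
  (projF K g h).compMultilinearMap (iteratedBracket
    (DirectSum.lof K ℕ (fun n => Cochain K (g × h) (g × h) n) 1
      (ofBracket (semidirectBracket π μ ρ))) k)

end DerivedBrackets
end ThreeLie

namespace ThreeLie

section Shuffles

/-- The permutation sending position `p` to `0` and the other positions, in order, to
`τ(0) + 1, τ(1) + 1, …`. -/
def insPerm {n : ℕ} (p : Fin (n + 1)) (τ : Equiv.Perm (Fin n)) : Equiv.Perm (Fin (n + 1)) :=
  ((finSuccEquiv' p).trans (Equiv.optionCongr τ)).trans (finSuccEquiv' 0).symm

theorem insPerm_self {n : ℕ} (p : Fin (n + 1)) (τ : Equiv.Perm (Fin n)) : insPerm p τ p = 0 := by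
  simp [insPerm]

theorem insPerm_succAbove {n : ℕ} (p : Fin (n + 1)) (τ : Equiv.Perm (Fin n)) (j : Fin n) :
    insPerm p τ (p.succAbove j) = (τ j).succ := by
  simp [insPerm]

theorem insPerm_bijective (n : ℕ) :
    Function.Bijective fun x : Fin (n + 1) × Equiv.Perm (Fin n) => insPerm x.1 x.2 := by
  rw [Fintype.bijective_iff_injective_and_card]
  constructor
  · rintro ⟨p, τ⟩ ⟨q, τ'⟩ h
    have h' : insPerm p τ = insPerm q τ' := h
    have hpq : p = q := by
      apply (insPerm q τ').injective
      rw [insPerm_self, ← h', insPerm_self]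
    subst hpq
    congr 1
    ext1 j
    have := congrArg (fun f => f (p.succAbove j)) h'
    simpa [insPerm_succAbove] using this
  · simp [Fintype.card_perm, Nat.factorial_succ]

theorem insPerm_zero_mem_shuffles {n i : ℕ} (τ : Equiv.Perm (Fin n)) :
    insPerm 0 τ ∈ shuffles (i + 1) (n + 1) ↔ τ ∈ shuffles i n := by
  have hs (j : Fin n) : insPerm 0 τ j.succ = (τ j).succ := insPerm_succAbove 0 τ j
  simp only [shuffles, Finset.mem_filter, Finset.mem_univ, true_and]
  constructor
  · intro h a b hab hc
    have := h a.succ b.succ (by simpa using hab) (by simpa using hc)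
    simpa [hs] using this
  · intro h a b hab hc
    rcases Fin.eq_zero_or_eq_succ a with rfl | ⟨a, rfl⟩
    · rcases Fin.eq_zero_or_eq_succ b with rfl | ⟨b, rfl⟩
      · simp at hab
      · rw [hs, insPerm_self]; exact Fin.succ_pos _
    · rcases Fin.eq_zero_or_eq_succ b with rfl | ⟨b, rfl⟩
      · simp at hab
      · have := h a b (by simpa using hab) (by simpa using hc)
        simpa [hs] using this

theorem insPerm_mem_shuffles {n : ℕ} (p : Fin (n + 1)) (τ : Equiv.Perm (Fin n)) :
    insPerm p τ ∈ shuffles p (n + 1) ↔ τ ∈ shuffles p n := by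
  have hlt (j : Fin n) (hj : (j : ℕ) < p) : p.succAbove j = j.castSucc :=
    Fin.succAbove_of_castSucc_lt _ _ (by simpa [Fin.lt_def] using hj)
  have hge (j : Fin n) (hj : (p : ℕ) ≤ (j : ℕ)) : p.succAbove j = j.succ :=
    Fin.succAbove_of_le_castSucc _ _ (by simpa [Fin.le_def] using hj)
  simp only [shuffles, Finset.mem_filter, Finset.mem_univ, true_and]
  constructor
  · intro h a b hab hc
    have := h (p.succAbove a) (p.succAbove b) ((Fin.strictMono_succAbove p) hab) (by
      rcases hc with hc | hc
      · left; rw [hlt b hc]; simpa using hc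
      · right; rw [hge a hc]; simp; omega)
    simpa [insPerm_succAbove] using this
  · intro h a b hab hc
    rcases Fin.eq_self_or_eq_succAbove p b with rfl | ⟨b, rfl⟩
    · have : (a : ℕ) < b := hab
      omega
    rcases Fin.eq_self_or_eq_succAbove p a with rfl | ⟨a, rfl⟩
    · rw [insPerm_self, insPerm_succAbove]; exact Fin.succ_pos _
    rw [insPerm_succAbove, insPerm_succAbove, Fin.succ_lt_succ_iff]
    apply h a b ((Fin.strictMono_succAbove p).lt_iff_lt.1 hab)
    rcases hc with hc | hc
    · left
      by_contra hb
      rw [hge b (by omega)] at hc; simp at hc; omega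
    · right
      by_contra hb
      rw [hlt a (by omega)] at hc; simp at hc; omega

theorem eq_zero_or_eq_of_mem_shuffles {n i : ℕ} {p : Fin (n + 1)} {τ : Equiv.Perm (Fin n)}
    (h : insPerm p τ ∈ shuffles i (n + 1)) : (p : ℕ) = 0 ∨ (p : ℕ) = i := by
  by_contra hc
  push Not at hc
  simp only [shuffles, Finset.mem_filter, Finset.mem_univ, true_and] at h
  have := h ⟨p - 1, by omega⟩ p (Fin.lt_def.2 (by dsimp only; omega))
    (by dsimp only; omega)
  rw [insPerm_self] at this
  simp at this

/-- The permutation `σ` of `{0, …, n - 1}`, extended to `ℕ` by the identity. -/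
def permFun {n : ℕ} (σ : Equiv.Perm (Fin n)) (a : ℕ) : ℕ := if h : a < n then σ ⟨a, h⟩ else a

/-- The function on `ℕ` with value `0` at `p` and otherwise, in order, `s(0) + 1, s(1) + 1, …`. -/
def insFun (p : ℕ) (s : ℕ → ℕ) (a : ℕ) : ℕ :=
  if a < p then s a + 1 else if a = p then 0 else s (a - 1) + 1

theorem permFun_insPerm {n : ℕ} (p : Fin (n + 1)) (τ : Equiv.Perm (Fin n)) :
    permFun (insPerm p τ) = insFun p (permFun τ) := by
  ext a
  by_cases ha : a < n + 1
  · rcases Fin.eq_self_or_eq_succAbove p ⟨a, ha⟩ with h | ⟨b, h⟩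
    · have h' : a = p := congrArg Fin.val h
      rw [permFun, dif_pos ha, h, insPerm_self, insFun, if_neg (by omega), if_pos h']; rfl
    · rw [permFun, dif_pos ha, h, insPerm_succAbove]
      by_cases hb : (b : ℕ) < p
      · rw [Fin.succAbove_of_castSucc_lt _ _ (by simpa [Fin.lt_def] using hb)] at h
        have h' : a = b := congrArg Fin.val h
        subst h'
        rw [insFun, if_pos hb, permFun, dif_pos b.2]; rfl
      · rw [Fin.succAbove_of_le_castSucc _ _ (by simpa [Fin.le_def] using hb)] at h
        have h' : a = b + 1 := congrArg Fin.val h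
        subst h'
        rw [insFun, if_neg (by omega), if_neg (by omega), permFun, dif_pos (by simp)]
        rfl
  · rw [permFun, dif_neg ha, insFun, if_neg (by omega), if_neg (by omega), permFun,
      dif_neg (by omega)]
    omega

theorem koszulSign_insPerm {n : ℕ} (d : Fin (n + 1) → ℤ) (p : Fin (n + 1))
    (τ : Equiv.Perm (Fin n)) : koszulSign d (insPerm p τ) =
      (∏ j : Fin n, if (j : ℕ) < p then (-1 : ℤˣ) ^ (d 0 * d (τ j).succ) else 1) *
        koszulSign (fun a => d a.succ) τ := by
  rw [koszulSign, Fin.prod_univ_succAbove _ p, Finset.prod_eq_one, one_mul, koszulSign,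
    ← Finset.prod_mul_distrib]
  · refine Finset.prod_congr rfl fun j _ => ?_
    rw [Fin.prod_univ_succAbove _ p]
    congr 1
    · rw [insPerm_self, insPerm_succAbove, mul_comm (d 0)]
      have : p.succAbove j < p ↔ (j : ℕ) < p := by
        rw [Fin.succAbove_lt_iff_castSucc_lt, Fin.lt_def]; rfl
      simp [this]
    · refine Finset.prod_congr rfl fun b _ => ?_
      simp only [insPerm_succAbove, Fin.succ_lt_succ_iff,
        (Fin.strictMono_succAbove p).lt_iff_lt]
  · intro b _
    rw [insPerm_self]; simp

theorem koszulSign_one {n : ℕ} (σ : Equiv.Perm (Fin n)) :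
    koszulSign (fun _ => 1) σ = Equiv.Perm.sign σ := by
  rw [Equiv.Perm.sign_eq_prod_prod_Ioi, koszulSign]
  refine Finset.prod_congr rfl fun a _ => ?_
  rw [← Finset.prod_filter_mul_prod_filter_not Finset.univ (fun b => a < b), mul_comm,
    Finset.prod_eq_one, one_mul]
  · have : Finset.filter (fun b => a < b) Finset.univ = Finset.Ioi a := by ext; simp
    rw [this]
    refine Finset.prod_congr rfl fun b hb => ?_
    have hab : a < b := by simpa using hb
    have hne : σ a ≠ σ b := fun h => hab.ne (σ.injective h)
    rcases lt_or_gt_of_ne hne with h | h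
    · simp [h, h.le, hab]
    · simp [h, hab, not_lt.2 h.le]
  · intro b hb
    have : ¬ a < b := by simpa using hb
    simp [this]

variable {K : Type*} [Field K]

variable (K) in
/-- The sign `(-1)^n`, for an integer `n`, in the field `K`. -/
def sg (n : ℤ) : K := (((-1 : ℤˣ) ^ n : ℤˣ) : ℤ)

theorem sg_add (a b : ℤ) : sg K (a + b) = sg K a * sg K b := by simp [sg, zpow_add]

theorem sg_zero : sg K 0 = 1 := by simp [sg]

theorem sg_one : sg K 1 = -1 := by simp [sg]

theorem sg_even {n : ℤ} (h : Even n) : sg K n = 1 := by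
  obtain ⟨m, rfl⟩ := h
  rcases Int.units_eq_one_or ((-1 : ℤˣ) ^ m) with h | h <;> simp [sg, zpow_add, h]

theorem sg_odd {n : ℤ} (h : Odd n) : sg K n = -1 := by
  obtain ⟨m, rfl⟩ := h
  rw [sg_add, sg_one, sg_even (even_two_mul m), one_mul]

theorem sg_natCast (n : ℕ) : sg K n = (-1) ^ n := by simp [sg]

theorem sg_eq_of_even {a b : ℤ} (h : Even (a + b)) : sg K a = sg K b := by
  rcases Int.even_or_odd a with ha | ha
  · rw [sg_even ha, sg_even ((Int.even_add.1 h).1 ha)]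
  · rw [sg_odd ha, sg_odd]
    rw [← Int.not_even_iff_odd] at ha ⊢
    rwa [← Int.even_add.1 h]

theorem sg_sum {ι : Type*} (s : Finset ι) (f : ι → ℤ) : sg K (∑ i ∈ s, f i) = ∏ i ∈ s, sg K (f i) := by
  classical
  induction s using Finset.induction_on with
  | empty => simp [sg_zero]
  | insert a s ha ih => rw [Finset.sum_insert ha, Finset.prod_insert ha, sg_add, ih]

variable {M : Type*} [AddCommMonoid M] [Module K M]

/-- The sum of `ε(σ) G(σ)` over all `(i, n - i)`-shuffles `σ`. -/
def shuffleSum (K : Type*) [Field K] {M : Type*} [AddCommMonoid M] [Module K M]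
    (d : ℕ → ℤ) (i n : ℕ) (G : (ℕ → ℕ) → M) : M :=
  ∑ σ ∈ shuffles i n, ((koszulSign (fun a : Fin n => d a) σ : ℤ) : K) • G (permFun σ)

theorem koszulSign_insPerm_cast {n : ℕ} (d : ℕ → ℤ) (p : Fin (n + 1)) (τ : Equiv.Perm (Fin n)) :
    ((koszulSign (fun a : Fin (n + 1) => d a) (insPerm p τ) : ℤ) : K) =
      ((koszulSign (fun a : Fin n => d (a + 1)) τ : ℤ) : K) *
        sg K (d 0 * ∑ j ∈ Finset.range p, d (permFun τ j + 1)) := by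
  rw [koszulSign_insPerm, mul_comm, Finset.mul_sum, sg_sum, Units.val_mul, Int.cast_mul]
  congr 1
  have h1 (j : Fin n) : d ((τ j).succ : Fin (n + 1)) = d (permFun τ j + 1) := by
    simp [permFun]
  simp only [Units.coe_prod, Int.cast_prod, h1, Fin.val_zero]
  rw [Fin.prod_univ_eq_prod_range (fun j => ((((if j < (p : ℕ) then
    (-1 : ℤˣ) ^ (d 0 * d (permFun τ j + 1)) else 1 : ℤˣ)) : ℤ) : K)) n]
  have hp : Finset.range p ⊆ Finset.range n := by
    intro j; simp; omega
  rw [← Finset.prod_subset hp]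
  · refine Finset.prod_congr rfl fun j hj => ?_
    rw [if_pos (by simpa using hj)]; rfl
  · intro j _ hj
    rw [if_neg (by simpa using hj)]; simp

theorem shuffleSum_eq_sum (d : ℕ → ℤ) (i n : ℕ) (G : (ℕ → ℕ) → M) :
    shuffleSum K d i (n + 1) G = ∑ p : Fin (n + 1), ∑ τ : Equiv.Perm (Fin n),
      if insPerm p τ ∈ shuffles i (n + 1) then
        (((koszulSign (fun a : Fin n => d (a + 1)) τ : ℤ) : K) *
          sg K (d 0 * ∑ j ∈ Finset.range p, d (permFun τ j + 1))) • G (insFun p (permFun τ))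
      else 0 := by
  rw [shuffleSum, shuffles, Finset.sum_filter,
    ← (Equiv.ofBijective _ (insPerm_bijective n)).sum_comp, Fintype.sum_prod_type]
  refine Finset.sum_congr rfl fun p _ => Finset.sum_congr rfl fun τ _ => ?_
  simp only [Equiv.ofBijective_apply, Finset.mem_filter, Finset.mem_univ, true_and,
    koszulSign_insPerm_cast, permFun_insPerm]

theorem shuffleSum_size_zero (d : ℕ → ℤ) (i : ℕ) (G : (ℕ → ℕ) → M) :
    shuffleSum K d i 0 G = G id := by
  have h : shuffles i 0 = Finset.univ := by
    ext σ; simp [shuffles]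
  have h2 (σ : Equiv.Perm (Fin 0)) : permFun σ = id := by ext a; simp [permFun]
  simp [shuffleSum, h, h2, koszulSign]

theorem shuffleSum_zero_succ (d : ℕ → ℤ) (n : ℕ) (G : (ℕ → ℕ) → M) :
    shuffleSum K d 0 (n + 1) G =
      shuffleSum K (fun a => d (a + 1)) 0 n (fun s => G (insFun 0 s)) := by
  rw [shuffleSum_eq_sum, Fin.sum_univ_succ]
  refine (congrArg₂ (· + ·) ?_ ?_).trans (add_zero _)
  · rw [shuffleSum, ← Finset.sum_filter]
    refine Finset.sum_congr ?_ fun τ _ => ?_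
    · ext τ
      simpa using insPerm_mem_shuffles 0 τ
    · simp [sg_zero]
  · refine Finset.sum_eq_zero fun p _ => Finset.sum_eq_zero fun τ _ => if_neg fun h => ?_
    have := eq_zero_or_eq_of_mem_shuffles h
    simp at this

theorem shuffleSum_succ_succ (d : ℕ → ℤ) (i n : ℕ) (G : (ℕ → ℕ) → M) :
    shuffleSum K d (i + 1) (n + 1) G =
      shuffleSum K (fun a => d (a + 1)) i n (fun s => G (insFun 0 s)) +
      if i < n then shuffleSum K (fun a => d (a + 1)) (i + 1) n (fun s =>
        sg K (d 0 * ∑ j ∈ Finset.range (i + 1), d (s j + 1)) • G (insFun (i + 1) s)) else 0 := by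
  rw [shuffleSum_eq_sum, Fin.sum_univ_succ]
  congr 1
  · rw [shuffleSum, ← Finset.sum_filter]
    refine Finset.sum_congr ?_ fun τ _ => ?_
    · ext τ
      simpa using insPerm_zero_mem_shuffles τ
    · simp [sg_zero]
  · split_ifs with hi
    · rw [Finset.sum_eq_single ⟨i, hi⟩]
      · rw [shuffleSum, ← Finset.sum_filter]
        refine Finset.sum_congr ?_ fun τ _ => ?_
        · ext τ
          simpa using insPerm_mem_shuffles (Fin.succ ⟨i, hi⟩) τ
        · simp [mul_smul]
      · intro p _ hp
        refine Finset.sum_eq_zero fun τ _ => if_neg fun h => hp ?_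
        have := eq_zero_or_eq_of_mem_shuffles h
        simp only [Fin.val_succ] at this
        exact Fin.ext (by simp; omega)
      · simp
    · refine Finset.sum_eq_zero fun p _ => Finset.sum_eq_zero fun τ _ => if_neg fun h => ?_
      have := eq_zero_or_eq_of_mem_shuffles h
      simp only [Fin.val_succ] at this
      omega

/-- Splitting the shuffles by the block that contains the first element. -/
theorem sum_shuffleSum_succ (d : ℕ → ℤ) (n : ℕ) (G : ℕ → (ℕ → ℕ) → M) :
    ∑ i ∈ Finset.range (n + 2), shuffleSum K d i (n + 1) (G i) =
      ∑ i ∈ Finset.range (n + 1),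
        shuffleSum K (fun a => d (a + 1)) i n (fun s => G (i + 1) (insFun 0 s)) +
      ∑ i ∈ Finset.range (n + 1), shuffleSum K (fun a => d (a + 1)) i n (fun s =>
        sg K (d 0 * ∑ j ∈ Finset.range i, d (s j + 1)) • G i (insFun i s)) := by
  rw [Finset.sum_range_succ', shuffleSum_zero_succ]
  simp only [shuffleSum_succ_succ, Finset.sum_add_distrib]
  rw [add_assoc]
  congr 1
  rw [Finset.sum_range_succ, if_neg (lt_irrefl n), add_zero,
    Finset.sum_range_succ' (n := n)]
  congr 1
  · exact Finset.sum_congr rfl fun i hi => if_pos (Finset.mem_range.1 hi)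
  · simp [sg_zero]

end Shuffles

section CircRecursion
variable {K V W : Type*} [Field K] [AddCommGroup V] [Module K V] [AddCommGroup W] [Module K W]

/-- The arguments of `P` in a term of the circle product `P ∘ Q`, for sequences of arguments. -/
noncomputable def insSeq {q : ℕ} (Q : PreCochain K V V q) (k : ℕ) (s : ℕ → ℕ)
    (Z : ℕ → ⋀[K]^2 V) (j : ℕ) : ⋀[K]^2 V :=
  if j < k then Z (s j)
  else if j = k then wedgeDer (Q fun i => Z (s (k + i))) (Z (k + q))
  else Z (j + q)

theorem insertArgs_seq {p q : ℕ} (Q : PreCochain K V V q) (k : Fin p)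
    (σ : Equiv.Perm (Fin (k + q))) (Z : ℕ → ⋀[K]^2 V) (j : Fin p) :
    insertArgs Q k σ (fun j : Fin (p + q) => Z j) j = insSeq Q k (permFun σ) Z j := by
  unfold insertArgs insSeq
  split_ifs with h1 h2 h3 h4
  · simp [permFun, show (j : ℕ) < k + q by omega]
  · have (i : Fin q) : permFun σ (k + i) = σ (Fin.natAdd k i) := by
      simp [permFun]; rfl
    simp only [this]; rfl
  · exact absurd (congrArg Fin.val h2) h3
  · exact absurd (Fin.ext h4) h2
  · rfl

theorem circ_seq {p q : ℕ} (P : PreCochain K V V p) (Q : PreCochain K V V q)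
    (Z : ℕ → ⋀[K]^2 V) :
    circ P Q (fun j : Fin (p + q) => Z j) =
      ∑ k ∈ Finset.range p, (-1 : K) ^ (k * q) • shuffleSum K (fun _ => 1) k (k + q)
        (fun s => P fun j => insSeq Q k s Z j) +
      (-1 : K) ^ (p * q) • shuffleSum K (fun _ => 1) p (p + q)
        (fun s => (P fun j => Z (s j)) ∘ₗ (Q fun i => Z (s (p + i)))) := by
  simp only [circ, add_apply, sum_apply, smul_apply]
  congr 1
  · rw [← Fin.sum_univ_eq_sum_range (fun k => (-1 : K) ^ (k * q) • shuffleSum K (fun _ => 1) k (k + q)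
        (fun s => P fun j => insSeq Q k s Z j))]
    refine Finset.sum_congr rfl fun k _ => ?_
    rw [shuffleSum, Finset.smul_sum]
    refine Finset.sum_congr rfl fun σ _ => ?_
    rw [mul_smul, koszulSign_one]
    congr 2
    change P (insertArgs Q k σ _) = _
    congr 1
    ext1 j
    exact insertArgs_seq Q k σ Z j
  · rw [shuffleSum, Finset.smul_sum]
    refine Finset.sum_congr rfl fun σ _ => ?_
    rw [mul_smul, koszulSign_one]
    congr 2
    have h1 (j : Fin p) : permFun σ j = σ (Fin.castAdd q j) := by
      simp [permFun, show (j : ℕ) < p + q by omega]; rfl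
    have h2 (i : Fin q) : permFun σ (p + i) = σ (Fin.natAdd p i) := by
      simp [permFun]; rfl
    simp only [h1, h2]; rfl

theorem seq_eq_curryLeft {n : ℕ} (P : PreCochain K V W (n + 1)) (f : ℕ → ⋀[K]^2 V) :
    (P fun j => f j) = P.curryLeft (f 0) fun j => f (j + 1) := by
  rw [MultilinearMap.curryLeft_apply]
  congr 1
  ext1 j
  refine Fin.cases ?_ (fun j => ?_) j <;> simp

theorem insFun_zero_zero (s : ℕ → ℕ) : insFun 0 s 0 = 0 := by simp [insFun]

theorem insFun_zero_succ (s : ℕ → ℕ) (a : ℕ) : insFun 0 s (a + 1) = s a + 1 := by simp [insFun]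

theorem insFun_of_lt {p a : ℕ} (s : ℕ → ℕ) (h : a < p) : insFun p s a = s a + 1 := by
  simp [insFun, h]

theorem insFun_self (p : ℕ) (s : ℕ → ℕ) : insFun p s p = 0 := by simp [insFun]

theorem insFun_add_succ (p a : ℕ) (s : ℕ → ℕ) : insFun p s (p + (a + 1)) = s (p + a) + 1 := by
  rw [insFun, if_neg (by omega), if_neg (by omega)]; congr 2

theorem insSeq_cons {p q : ℕ} (P : PreCochain K V V (p + 1)) (Q : PreCochain K V V q) (k : ℕ)
    (s : ℕ → ℕ) (Z : ℕ → ⋀[K]^2 V) :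
    (P fun j => insSeq Q (k + 1) (insFun 0 s) Z j) =
      P.curryLeft (Z 0) fun j => insSeq Q k s (fun a => Z (a + 1)) j := by
  rw [seq_eq_curryLeft]
  have h0 : insSeq Q (k + 1) (insFun 0 s) Z 0 = Z 0 := by
    simp [insSeq, insFun_zero_zero]
  rw [h0]
  congr 1
  ext1 j
  have h1 (i : ℕ) : insFun 0 s (k + 1 + i) = s (k + i) + 1 := by
    rw [add_right_comm, insFun_zero_succ]
  simp only [insSeq, add_lt_add_iff_right, insFun_zero_succ, add_left_inj, h1]
  have h2 : k + 1 + q = k + q + 1 := by omega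
  have h3 : (j : ℕ) + 1 + q = j + q + 1 := by omega
  rw [h2, h3]

theorem insSeq_ins {q : ℕ} (Q : PreCochain K V V (q + 1)) (k : ℕ)
    (s : ℕ → ℕ) (Z : ℕ → ⋀[K]^2 V) (j : ℕ) :
    insSeq Q k (insFun k s) Z j = insSeq (Q.curryLeft (Z 0)) k s (fun a => Z (a + 1)) j := by
  unfold insSeq
  split_ifs with h1 h2
  · rw [insFun_of_lt s h1]
  · rw [seq_eq_curryLeft Q (fun i => Z (insFun k s (k + i)))]
    simp only [add_zero, insFun_self, insFun_add_succ]
    rfl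
  · rfl

theorem neg_one_pow_mul_sg (k q : ℕ) (d : ℕ → ℤ) (hd : ∀ j, d j = 1) :
    (-1 : K) ^ (k * (q + 1)) * sg K (1 * ∑ j ∈ Finset.range k, d j) = (-1) ^ (k * q) := by
  have e : (1 : ℤ) * ∑ j ∈ Finset.range k, d j = (k : ℤ) := by simp [hd]
  rw [e, sg_natCast, mul_add, pow_add, mul_assoc, mul_one, ← mul_pow]
  simp

theorem circ_succ_succ {p q : ℕ} (P : PreCochain K V V (p + 1)) (Q : PreCochain K V V (q + 1))
    (Z : ℕ → ⋀[K]^2 V) :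
    circ P Q (fun j : Fin (p + 1 + (q + 1)) => Z j) =
      (-1 : K) ^ (q + 1) • circ (P.curryLeft (Z 0)) Q (fun j : Fin (p + (q + 1)) => Z (j + 1)) +
      circ P (Q.curryLeft (Z 0)) (fun j : Fin (p + 1 + q) => Z (j + 1)) := by
  have key (k : ℕ) : k + 1 + (q + 1) = k + (q + 1) + 1 := by omega
  have key2 (k : ℕ) : k + (q + 1) = k + 1 + q := by omega
  rw [circ_seq, circ_seq _ _ (fun a => Z (a + 1)), circ_seq _ _ (fun a => Z (a + 1))]
  have hout : (-1 : K) ^ ((p + 1) * (q + 1)) • shuffleSum K (fun _ => 1) (p + 1) (p + 1 + (q + 1))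
        (fun s => (P fun j => Z (s j)) ∘ₗ (Q fun i => Z (s (p + 1 + i)))) =
      (-1 : K) ^ (q + 1) • ((-1 : K) ^ (p * (q + 1)) • shuffleSum K (fun _ => 1) p (p + (q + 1))
        (fun s => (P.curryLeft (Z 0) fun j => Z (s j + 1)) ∘ₗ (Q fun i => Z (s (p + i) + 1)))) +
      (-1 : K) ^ ((p + 1) * q) • shuffleSum K (fun _ => 1) (p + 1) (p + 1 + q)
        (fun s => (P fun j => Z (s j + 1)) ∘ₗ
          (Q.curryLeft (Z 0) fun i => Z (s (p + 1 + i) + 1))) := by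
    rw [key p, shuffleSum_succ_succ, if_pos (by omega), smul_add]
    congr 1
    · rw [smul_smul, ← pow_add]
      congr 1
      · congr 1; ring
      · congr 1
        ext1 s
        rw [seq_eq_curryLeft P (fun j => Z (insFun 0 s j))]
        simp only [insFun_zero_zero, insFun_zero_succ]
        have h1 (i : ℕ) : insFun 0 s (p + 1 + i) = s (p + i) + 1 := by
          rw [add_right_comm, insFun_zero_succ]
        simp only [h1]
    · rw [key2 p, ← neg_one_pow_mul_sg (p + 1) q (fun _ => 1) fun _ => rfl, mul_smul]
      congr 1
      rw [shuffleSum, shuffleSum, Finset.smul_sum]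
      refine Finset.sum_congr rfl fun σ _ => ?_
      rw [smul_comm]
      congr 3
      · congr 1
        ext1 j
        rw [insFun_of_lt _ j.2]
      · rw [seq_eq_curryLeft Q (fun i => Z (insFun (p + 1) (permFun σ) (p + 1 + i)))]
        simp only [add_zero, insFun_self, insFun_add_succ]
  have hins (k : ℕ) : (-1 : K) ^ ((k + 1) * (q + 1)) •
        shuffleSum K (fun _ => 1) (k + 1) (k + 1 + (q + 1))
          (fun s => P fun j => insSeq Q (k + 1) s Z j) =
      (-1 : K) ^ (q + 1) • ((-1 : K) ^ (k * (q + 1)) • shuffleSum K (fun _ => 1) k (k + (q + 1))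
        (fun s => P.curryLeft (Z 0) fun j => insSeq Q k s (fun a => Z (a + 1)) j)) +
      (-1 : K) ^ ((k + 1) * q) • shuffleSum K (fun _ => 1) (k + 1) (k + 1 + q)
        (fun s => P fun j => insSeq (Q.curryLeft (Z 0)) (k + 1) s (fun a => Z (a + 1)) j) := by
    rw [key k, shuffleSum_succ_succ, if_pos (by omega), smul_add]
    congr 1
    · rw [smul_smul, ← pow_add]
      congr 1
      · congr 1; ring
      · simp only [insSeq_cons]
    · rw [key2 k, ← neg_one_pow_mul_sg (k + 1) q (fun _ => 1) fun _ => rfl, mul_smul]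
      congr 1
      rw [shuffleSum, shuffleSum, Finset.smul_sum]
      refine Finset.sum_congr rfl fun σ _ => ?_
      rw [smul_comm]
      simp only [insSeq_ins]
  have hzero : (-1 : K) ^ (0 * (q + 1)) • shuffleSum K (fun _ => 1) 0 (0 + (q + 1))
          (fun s => P fun j => insSeq Q 0 s Z j) =
      (-1 : K) ^ (0 * q) • shuffleSum K (fun _ => 1) 0 (0 + q)
        (fun s => P fun j => insSeq (Q.curryLeft (Z 0)) 0 s (fun a => Z (a + 1)) j) := by
    rw [← add_assoc, shuffleSum_zero_succ]
    simp only [insSeq_ins, zero_mul]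
  rw [hout, Finset.sum_range_succ', hzero]
  simp only [hins]
  rw [Finset.sum_range_succ' (fun k => (-1 : K) ^ (k * q) • shuffleSum K (fun _ => 1) k (k + q)
        (fun s => P fun j => insSeq (Q.curryLeft (Z 0)) k s (fun a => Z (a + 1)) j)) p,
    Finset.sum_add_distrib, smul_add, Finset.smul_sum]
  abel

theorem circ_succ_zero {p : ℕ} (P : PreCochain K V V (p + 1)) (Q : PreCochain K V V 0)
    (Z : ℕ → ⋀[K]^2 V) :
    circ P Q (fun j : Fin (p + 1 + 0) => Z j) =
      circ (P.curryLeft (Z 0)) Q (fun j : Fin (p + 0) => Z (j + 1)) +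
      P.curryLeft (wedgeDer (Q Fin.elim0) (Z 0)) (fun j => Z (j + 1)) := by
  have hQ (f : Fin 0 → ⋀[K]^2 V) : Q f = Q Fin.elim0 := congrArg Q (Subsingleton.elim _ _)
  rw [circ_seq, circ_seq _ _ (fun a => Z (a + 1))]
  have hout : shuffleSum K (fun _ => 1) (p + 1) (p + 1 + 0)
        (fun s => (P fun j => Z (s j)) ∘ₗ (Q fun i => Z (s (p + 1 + i)))) =
      shuffleSum K (fun _ => 1) p (p + 0)
        (fun s => (P.curryLeft (Z 0) fun j => Z (s j + 1)) ∘ₗ (Q fun i => Z (s (p + i) + 1))) := by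
    rw [add_zero, shuffleSum_succ_succ, if_neg (lt_irrefl p), add_zero]
    congr 1
    ext1 s
    rw [seq_eq_curryLeft P (fun j => Z (insFun 0 s j)), hQ, hQ fun i => Z (s (p + i) + 1)]
    simp only [insFun_zero_zero, insFun_zero_succ]
  have hins (k : ℕ) : shuffleSum K (fun _ => 1) (k + 1) (k + 1 + 0)
          (fun s => P fun j => insSeq Q (k + 1) s Z j) =
      shuffleSum K (fun _ => 1) k (k + 0)
        (fun s => P.curryLeft (Z 0) fun j => insSeq Q k s (fun a => Z (a + 1)) j) := by
    rw [add_zero, shuffleSum_succ_succ, if_neg (lt_irrefl k), add_zero]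
    simp only [insSeq_cons, add_zero]
  have hzero : shuffleSum K (fun _ => 1) 0 (0 + 0) (fun s => P fun j => insSeq Q 0 s Z j) =
      P.curryLeft (wedgeDer (Q Fin.elim0) (Z 0)) (fun j => Z (j + 1)) := by
    rw [shuffleSum_size_zero, seq_eq_curryLeft]
    simp [insSeq, hQ]
  rw [Finset.sum_range_succ']
  simp only [mul_zero, pow_zero, one_smul, hout, hins, hzero]
  abel

theorem circ_zero_succ {q : ℕ} (P : PreCochain K V V 0) (Q : PreCochain K V V (q + 1))
    (Z : ℕ → ⋀[K]^2 V) :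
    circ P Q (fun j : Fin (0 + (q + 1)) => Z j) =
      circ P (Q.curryLeft (Z 0)) (fun j : Fin (0 + q) => Z (j + 1)) := by
  rw [circ_seq, circ_seq _ _ (fun a => Z (a + 1))]
  have hP (f : Fin 0 → ⋀[K]^2 V) : P f = P Fin.elim0 := congrArg P (Subsingleton.elim _ _)
  simp only [Finset.range_zero, Finset.sum_empty, zero_add, zero_mul, pow_zero, one_smul]
  rw [shuffleSum_zero_succ]
  congr 1
  ext1 s
  rw [seq_eq_curryLeft Q (fun i => Z (insFun 0 s i)), hP, hP fun j => Z (s j + 1)]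
  simp only [insFun_zero_zero, insFun_zero_succ]

theorem circ_zero_zero (P : PreCochain K V V 0) (Q : PreCochain K V V 0)
    (f : Fin (0 + 0) → ⋀[K]^2 V) : circ P Q f = P Fin.elim0 ∘ₗ Q Fin.elim0 := by
  have hP (P : PreCochain K V V 0) (f : Fin 0 → ⋀[K]^2 V) : P f = P Fin.elim0 :=
    congrArg P (Subsingleton.elim _ _)
  have hf : f = fun j : Fin (0 + 0) => (fun _ => 0 : ℕ → ⋀[K]^2 V) j := funext fun j => j.elim0
  rw [hf, circ_seq P Q (fun _ => 0)]
  simp [shuffleSum_size_zero, hP]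

end CircRecursion

section Contraction
variable {K V W : Type*} [Field K] [AddCommGroup V] [Module K V] [AddCommGroup W] [Module K W]

/-- The value of a total cochain at the first `n` members of a sequence of elements of `∧²V`. -/
noncomputable def evalSeq (n : ℕ) (Z : ℕ → ⋀[K]^2 V) : TotalCochain K V W →ₗ[K] V →ₗ[K] W where
  toFun A := (A n).1 fun j => Z j
  map_add' A B := by simp [DirectSum.add_apply]
  map_smul' c A := by simp [DirectSum.smul_apply]

theorem evalSeq_lof {m n : ℕ} (h : m = n) (Z : ℕ → ⋀[K]^2 V) (A : Cochain K V W m) :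
    evalSeq n Z (DirectSum.lof K ℕ (fun n => Cochain K V W n) m A) = A.1 fun j => Z j := by
  subst h
  simp [evalSeq]

theorem evalSeq_lof_of_ne {m n : ℕ} (h : m ≠ n) (Z : ℕ → ⋀[K]^2 V) (A : Cochain K V W m) :
    evalSeq n Z (DirectSum.lof K ℕ (fun n => Cochain K V W n) m A) = 0 := by
  simp [evalSeq, DirectSum.lof_eq_of, DirectSum.of_eq_of_ne _ _ _ h.symm]

theorem exists_seq {n : ℕ} (X : Fin n → ⋀[K]^2 V) : ∃ Z : ℕ → ⋀[K]^2 V, X = fun j : Fin n => Z j :=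
  ⟨fun a => if h : a < n then X ⟨a, h⟩ else 0, by ext1 j; simp⟩

theorem TotalCochain.ext_evalSeq {A B : TotalCochain K V W}
    (h : ∀ n Z, evalSeq n Z A = evalSeq n Z B) : A = B := by
  refine DFinsupp.ext fun n => Subtype.ext (MultilinearMap.ext fun X => ?_)
  obtain ⟨Z, rfl⟩ := exists_seq X
  exact h n Z

/-- Contraction of a cochain with an element of `∧²V`, in the first argument. -/
noncomputable def contrC (X : ⋀[K]^2 V) (n : ℕ) : Cochain K V W (n + 1) →ₗ[K] Cochain K V W n where
  toFun P := ⟨P.1.curryLeft X, fun Y i x y hi hY =>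
    P.2 (Fin.cons X Y) i.succ x y (by simp [hi]) (by simpa using hY)⟩
  map_add' P Q := by ext; simp
  map_smul' c P := by ext; simp

/-- Contraction on the direct sum; it vanishes on `C⁰`. -/
noncomputable def contrFun (X : ⋀[K]^2 V) : TotalCochain K V W →ₗ[K] TotalCochain K V W :=
  DirectSum.toModule K ℕ _ fun n => match n with
    | 0 => 0
    | n + 1 => DirectSum.lof K ℕ (fun n => Cochain K V W n) n ∘ₗ contrC X n

theorem contrFun_lof_succ (X : ⋀[K]^2 V) (n : ℕ) (P : Cochain K V W (n + 1)) :
    contrFun X (DirectSum.lof K ℕ (fun n => Cochain K V W n) (n + 1) P) =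
      DirectSum.lof K ℕ (fun n => Cochain K V W n) n (contrC X n P) := by
  rw [contrFun, DirectSum.toModule_lof]; rfl

theorem contrFun_lof_zero (X : ⋀[K]^2 V) (P : Cochain K V W 0) :
    contrFun X (DirectSum.lof K ℕ (fun n => Cochain K V W n) 0 P) = 0 := by
  rw [contrFun, DirectSum.toModule_lof]; rfl

/-- The sequence `X, Z 0, Z 1, …`. -/
def consSeq {α : Type*} (X : α) (Z : ℕ → α) : ℕ → α
  | 0 => X
  | n + 1 => Z n

theorem TotalCochain.linearMap_ext {M : Type*} [AddCommGroup M] [Module K M]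
    {f f' : TotalCochain K V W →ₗ[K] M}
    (h : ∀ n P, f (DirectSum.lof K ℕ (fun n => Cochain K V W n) n P) =
      f' (DirectSum.lof K ℕ (fun n => Cochain K V W n) n P)) (A) : f A = f' A :=
  congrArg (fun F => F A) (DirectSum.linearMap_ext K fun n => LinearMap.ext (h n))

theorem evalSeq_contrFun (X : ⋀[K]^2 V) (n : ℕ) (Z : ℕ → ⋀[K]^2 V) (A : TotalCochain K V W) :
    evalSeq n Z (contrFun X A) = evalSeq (n + 1) (consSeq X Z) A := by
  refine TotalCochain.linearMap_ext (f := evalSeq n Z ∘ₗ contrFun X) (fun m P => ?_) A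
  rw [LinearMap.comp_apply]
  rcases m with _ | m
  · rw [contrFun_lof_zero, map_zero, evalSeq_lof_of_ne (by omega)]
  · rw [contrFun_lof_succ]
    by_cases h : m = n
    · rw [evalSeq_lof h, evalSeq_lof (by omega), seq_eq_curryLeft]; rfl
    · rw [evalSeq_lof_of_ne h, evalSeq_lof_of_ne (by omega)]

theorem evalSeq_consSeq_add (X Y : ⋀[K]^2 V) (n : ℕ) (Z : ℕ → ⋀[K]^2 V) (A : TotalCochain K V W) :
    evalSeq (n + 1) (consSeq (X + Y) Z) A =
      evalSeq (n + 1) (consSeq X Z) A + evalSeq (n + 1) (consSeq Y Z) A := by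
  change ((A (n + 1)).1 fun j => _) = ((A (n + 1)).1 fun j => _) + ((A (n + 1)).1 fun j => _)
  rw [seq_eq_curryLeft, seq_eq_curryLeft _ (consSeq X Z), seq_eq_curryLeft _ (consSeq Y Z)]
  simp [consSeq]

theorem evalSeq_consSeq_smul (c : K) (X : ⋀[K]^2 V) (n : ℕ) (Z : ℕ → ⋀[K]^2 V)
    (A : TotalCochain K V W) :
    evalSeq (n + 1) (consSeq (c • X) Z) A = c • evalSeq (n + 1) (consSeq X Z) A := by
  change ((A (n + 1)).1 fun j => _) = c • ((A (n + 1)).1 fun j => _)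
  rw [seq_eq_curryLeft, seq_eq_curryLeft _ (consSeq X Z)]
  simp [consSeq]

/-- Contraction `X ↦ A(X, -)` as a bilinear map. -/
noncomputable def contr : ⋀[K]^2 V →ₗ[K] TotalCochain K V W →ₗ[K] TotalCochain K V W :=
  LinearMap.mk₂ K (fun X A => contrFun X A)
    (fun X Y A => TotalCochain.ext_evalSeq fun n Z => by
      simp only [map_add, evalSeq_contrFun, evalSeq_consSeq_add])
    (fun c X A => TotalCochain.ext_evalSeq fun n Z => by
      simp only [map_smul, evalSeq_contrFun, evalSeq_consSeq_smul])
    (fun X A B => map_add _ A B) (fun c X A => map_smul _ c A)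

theorem evalSeq_contr (X : ⋀[K]^2 V) (n : ℕ) (Z : ℕ → ⋀[K]^2 V) (A : TotalCochain K V W) :
    evalSeq n Z (contr X A) = evalSeq (n + 1) (consSeq X Z) A := evalSeq_contrFun X n Z A

theorem contr_lof_succ (X : ⋀[K]^2 V) (n : ℕ) (P : Cochain K V W (n + 1)) :
    contr X (DirectSum.lof K ℕ (fun n => Cochain K V W n) (n + 1) P) =
      DirectSum.lof K ℕ (fun n => Cochain K V W n) n (contrC X n P) := contrFun_lof_succ X n P

theorem contr_lof_zero (X : ⋀[K]^2 V) (P : Cochain K V W 0) :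
    contr X (DirectSum.lof K ℕ (fun n => Cochain K V W n) 0 P) = 0 := contrFun_lof_zero X P

/-- The component of degree zero. -/
noncomputable def degZero : TotalCochain K V W →ₗ[K] V →ₗ[K] W := evalSeq 0 fun _ => 0

theorem evalSeq_zero (Z : ℕ → ⋀[K]^2 V) (A : TotalCochain K V W) : evalSeq 0 Z A = degZero A :=
  congrArg (A 0).1 (Subsingleton.elim _ _)

theorem consSeq_head_tail {α : Type*} (Z : ℕ → α) : consSeq (Z 0) (fun a => Z (a + 1)) = Z := by
  ext1 a; cases a <;> rfl

theorem TotalCochain.ext_contr {A B : TotalCochain K V W} (h0 : degZero A = degZero B)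
    (h : ∀ X, contr X A = contr X B) : A = B := by
  refine TotalCochain.ext_evalSeq fun n Z => ?_
  rcases n with _ | n
  · rw [evalSeq_zero, evalSeq_zero, h0]
  · rw [← consSeq_head_tail Z, ← evalSeq_contr, ← evalSeq_contr, h]

theorem degZero_lof_zero (P : Cochain K V W 0) :
    degZero (DirectSum.lof K ℕ (fun n => Cochain K V W n) 0 P) = P.1 Fin.elim0 := by
  rw [degZero, evalSeq_lof rfl]; exact congrArg P.1 (Subsingleton.elim _ _)

theorem degZero_lof_succ (n : ℕ) (P : Cochain K V W (n + 1)) :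
    degZero (DirectSum.lof K ℕ (fun n => Cochain K V W n) (n + 1) P) = 0 :=
  evalSeq_lof_of_ne (by omega) _ _

theorem degZero_ofHom (f : V →ₗ[K] W) : degZero (ofHom f) = f := by
  rw [ofHom, degZero_lof_zero]; rfl

theorem contr_ofHom (X : ⋀[K]^2 V) (f : V →ₗ[K] W) : contr X (ofHom f) = 0 := contr_lof_zero X _

/-! ### The grading -/

theorem lof_mem_cochainGrading (n : ℕ) (P : Cochain K V W n) :
    DirectSum.lof K ℕ (fun n => Cochain K V W n) n P ∈ cochainGrading K V W n := by
  intro m hm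
  rw [DirectSum.lof_eq_of, DirectSum.of_eq_of_ne]
  exact fun h => hm (by rw [h])

theorem eq_zero_of_mem_of_neg {d : ℤ} (hd : d < 0) {A : TotalCochain K V W}
    (hA : A ∈ cochainGrading K V W d) : A = 0 :=
  DFinsupp.ext fun n => hA n (by omega)

theorem eq_lof_of_mem {n : ℕ} {A : TotalCochain K V W} (hA : A ∈ cochainGrading K V W n) :
    A = DirectSum.lof K ℕ (fun n => Cochain K V W n) n (A n) := by
  refine DFinsupp.ext fun m => ?_
  by_cases h : m = n
  · subst h; simp [DirectSum.lof_eq_of]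
  · rw [hA m (by omega), DirectSum.lof_eq_of, DirectSum.of_eq_of_ne _ _ _ h]

theorem ofHom_mem (f : V →ₗ[K] W) : ofHom f ∈ cochainGrading K V W 0 := lof_mem_cochainGrading 0 _

theorem contr_mem (X : ⋀[K]^2 V) {d : ℤ} {A : TotalCochain K V W}
    (hA : A ∈ cochainGrading K V W d) : contr X A ∈ cochainGrading K V W (d - 1) := by
  intro n hn
  refine Subtype.ext (MultilinearMap.ext fun Y => ?_)
  obtain ⟨Z, rfl⟩ := exists_seq Y
  change evalSeq n Z (contr X A) = 0
  rw [evalSeq_contr]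
  change (A (n + 1)).1 _ = 0
  rw [hA (n + 1) (by push_cast; omega)]
  rfl

theorem degZero_eq_zero_of_mem {d : ℤ} (hd : d ≠ 0) {A : TotalCochain K V W}
    (hA : A ∈ cochainGrading K V W d) : degZero A = 0 := by
  change (A 0).1 _ = 0
  rw [hA 0 (by simpa using hd.symm)]
  rfl

/-- Homogeneous elements vanish when a property closed under contraction kills their
components of degree zero. -/
theorem induction_contr {p : TotalCochain K V W → Prop} (hc : ∀ A X, p A → p (contr X A))
    (h0 : ∀ A, p A → degZero A = 0) {A : TotalCochain K V W} (hA : p A) : A = 0 := by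
  refine TotalCochain.ext_evalSeq fun n => ?_
  induction n generalizing A with
  | zero => intro Z; rw [evalSeq_zero, h0 A hA, map_zero]
  | succ n ih =>
    intro Z
    rw [← consSeq_head_tail Z, ← evalSeq_contr, ih (hc A _ hA), map_zero, map_zero]

end Contraction

section PreLie
variable {K V : Type*} [Field K] [AddCommGroup V] [Module K V]

/-- The circle product on `C*(V, V)`. -/
noncomputable def circT :
    TotalCochain K V V →ₗ[K] TotalCochain K V V →ₗ[K] TotalCochain K V V :=
  DirectSum.toModule K ℕ _ fun p => LinearMap.flip <| DirectSum.toModule K ℕ _ fun q =>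
    LinearMap.flip <| (circC p q).compr₂ (DirectSum.lof K ℕ (fun n => Cochain K V V n) (p + q))

theorem circT_lof (p q : ℕ) (P : Cochain K V V p) (Q : Cochain K V V q) :
    circT (DirectSum.lof K ℕ (fun n => Cochain K V V n) p P)
      (DirectSum.lof K ℕ (fun n => Cochain K V V n) q Q) =
    DirectSum.lof K ℕ (fun n => Cochain K V V n) (p + q) (circC p q P Q) := by
  simp [circT]

/-- The action of (the degree zero part of) a cochain on `∧²V`. -/
noncomputable def actWedge : TotalCochain K V V →ₗ[K] (⋀[K]^2 V →ₗ[K] ⋀[K]^2 V) :=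
  wedgeDer ∘ₗ degZero

theorem evalSeq_circT_lof {p q n : ℕ} (h : p + q = n) (Z : ℕ → ⋀[K]^2 V) (P : Cochain K V V p)
    (Q : Cochain K V V q) :
    evalSeq n Z (circT (DirectSum.lof K ℕ (fun n => Cochain K V V n) p P)
      (DirectSum.lof K ℕ (fun n => Cochain K V V n) q Q)) =
      circ P.1 Q.1 fun j : Fin (p + q) => Z j := by
  rw [circT_lof, evalSeq_lof h]; rfl

theorem evalSeq_circT_lof_of_ne {p q n : ℕ} (h : p + q ≠ n) (Z : ℕ → ⋀[K]^2 V)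
    (P : Cochain K V V p) (Q : Cochain K V V q) :
    evalSeq n Z (circT (DirectSum.lof K ℕ (fun n => Cochain K V V n) p P)
      (DirectSum.lof K ℕ (fun n => Cochain K V V n) q Q)) = 0 := by
  rw [circT_lof, evalSeq_lof_of_ne h]

theorem TotalCochain.linearMap_ext₂ {W M : Type*} [AddCommGroup W] [Module K W]
    [AddCommGroup M] [Module K M] {f f' : TotalCochain K V W →ₗ[K] TotalCochain K V W →ₗ[K] M}
    (h : ∀ p P q Q, f (DirectSum.lof K ℕ (fun n => Cochain K V W n) p P)
        (DirectSum.lof K ℕ (fun n => Cochain K V W n) q Q) =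
      f' (DirectSum.lof K ℕ (fun n => Cochain K V W n) p P)
        (DirectSum.lof K ℕ (fun n => Cochain K V W n) q Q)) (A B) : f A B = f' A B :=
  congrArg (fun F => F B) (TotalCochain.linearMap_ext
    (fun p P => LinearMap.ext (TotalCochain.linearMap_ext (h p P))) A)

theorem degZero_circT (A B : TotalCochain K V V) :
    degZero (circT A B) = degZero A ∘ₗ degZero B := by
  let F' : TotalCochain K V V →ₗ[K] TotalCochain K V V →ₗ[K] (V →ₗ[K] V) :=
    LinearMap.mk₂ K (fun A B => degZero A ∘ₗ degZero B)
      (fun A A' B => by rw [map_add, LinearMap.add_comp])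
      (fun c A B => by rw [map_smul, LinearMap.smul_comp])
      (fun A B B' => by rw [map_add, LinearMap.comp_add])
      (fun c A B => by rw [map_smul, LinearMap.comp_smul])
  suffices h : circT.compr₂ degZero A B = F' A B by
    simpa only [F', LinearMap.compr₂_apply, LinearMap.mk₂_apply] using h
  refine TotalCochain.linearMap_ext₂ (fun p P q Q => ?_) A B
  simp only [F', LinearMap.compr₂_apply, LinearMap.mk₂_apply]
  rcases p with _ | p
  · rcases q with _ | q
    · rw [degZero_lof_zero, degZero_lof_zero, degZero, evalSeq_circT_lof (by omega)]
      exact circ_zero_zero _ _ _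
    · rw [degZero_lof_succ q Q, LinearMap.comp_zero]
      exact evalSeq_circT_lof_of_ne (by omega) _ _ _
  · rw [degZero_lof_succ p P, LinearMap.zero_comp]
    exact evalSeq_circT_lof_of_ne (by omega) _ _ _

theorem actWedge_lof_zero (Q : Cochain K V V 0) :
    actWedge (DirectSum.lof K ℕ (fun n => Cochain K V V n) 0 Q) = wedgeDer (Q.1 Fin.elim0) := by
  rw [actWedge, LinearMap.comp_apply, degZero_lof_zero]

theorem actWedge_lof_succ (q : ℕ) (Q : Cochain K V V (q + 1)) :
    actWedge (DirectSum.lof K ℕ (fun n => Cochain K V V n) (q + 1) Q) = 0 := by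
  rw [actWedge, LinearMap.comp_apply, degZero_lof_succ, map_zero]

set_option maxHeartbeats 1000000 in
theorem contr_circT_lof (X : ⋀[K]^2 V) (p q : ℕ) (P : Cochain K V V p) (Q : Cochain K V V q) :
    contr X (circT (DirectSum.lof K ℕ (fun n => Cochain K V V n) p P)
        (DirectSum.lof K ℕ (fun n => Cochain K V V n) q Q)) =
      (-1 : K) ^ q • circT (contr X (DirectSum.lof K ℕ (fun n => Cochain K V V n) p P))
        (DirectSum.lof K ℕ (fun n => Cochain K V V n) q Q) +
      circT (DirectSum.lof K ℕ (fun n => Cochain K V V n) p P)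
        (contr X (DirectSum.lof K ℕ (fun n => Cochain K V V n) q Q)) +
      contr (actWedge (DirectSum.lof K ℕ (fun n => Cochain K V V n) q Q) X)
        (DirectSum.lof K ℕ (fun n => Cochain K V V n) p P) := by
  refine TotalCochain.ext_evalSeq fun n Z => ?_
  rw [evalSeq_contr, map_add, map_add, map_smul]
  rcases p with _ | p
  · simp only [contr_lof_zero X P, contr_lof_zero _ P, map_zero, LinearMap.zero_apply, smul_zero,
      zero_add, add_zero]
    rcases q with _ | q
    · simp only [contr_lof_zero X Q, map_zero]
      rw [evalSeq_circT_lof_of_ne (by omega)]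
    · rw [contr_lof_succ X q Q]
      by_cases h : 0 + q = n
      · rw [evalSeq_circT_lof (by omega), evalSeq_circT_lof h]
        exact circ_zero_succ P.1 Q.1 (consSeq X Z)
      · rw [evalSeq_circT_lof_of_ne (by omega), evalSeq_circT_lof_of_ne h]
  · rcases q with _ | q
    · simp only [contr_lof_zero X Q, contr_lof_succ X p P, contr_lof_succ _ p P, map_zero,
        add_zero, actWedge_lof_zero, pow_zero, one_smul]
      by_cases h : p + 0 = n
      · rw [evalSeq_circT_lof (by omega), evalSeq_circT_lof h, evalSeq_lof (m := p) h]
        exact circ_succ_zero P.1 Q.1 (consSeq X Z)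
      · rw [evalSeq_circT_lof_of_ne (by omega), evalSeq_circT_lof_of_ne h, evalSeq_lof_of_ne (m := p) h,
          add_zero]
    · simp only [contr_lof_succ X p P, contr_lof_succ X q Q, actWedge_lof_succ,
        LinearMap.zero_apply, map_zero, add_zero]
      by_cases h : p + 1 + q = n
      · have h1 : p + 1 + (q + 1) = n + 1 := by omega
        have h2 : p + (q + 1) = n := by omega
        rw [evalSeq_circT_lof h1, evalSeq_circT_lof h2, evalSeq_circT_lof h]
        exact circ_succ_succ P.1 Q.1 (consSeq X Z)
      · have h1 : p + 1 + (q + 1) ≠ n + 1 := by omega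
        have h2 : p + (q + 1) ≠ n := by omega
        rw [evalSeq_circT_lof_of_ne h1, evalSeq_circT_lof_of_ne h2,
          evalSeq_circT_lof_of_ne h, smul_zero, add_zero]

set_option maxHeartbeats 1000000 in
theorem contr_circT (X : ⋀[K]^2 V) (A : TotalCochain K V V) {q : ℤ} {B : TotalCochain K V V}
    (hB : B ∈ cochainGrading K V V q) :
    contr X (circT A B) = sg K q • circT (contr X A) B + circT A (contr X B) +
      contr (actWedge B X) A := by
  rcases lt_or_ge q 0 with hq | hq
  · simp [eq_zero_of_mem_of_neg hq hB]
  lift q to ℕ using hq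
  obtain ⟨Q, rfl⟩ : ∃ Q, B = DirectSum.lof K ℕ (fun n => Cochain K V V n) q Q :=
    ⟨_, eq_lof_of_mem hB⟩
  rw [sg_natCast]
  generalize hB' : DirectSum.lof K ℕ (fun n => Cochain K V V n) q Q = B
  have key : contr X ∘ₗ circT.flip B = (-1 : K) ^ q • circT.flip B ∘ₗ contr X +
      circT.flip (contr X B) + contr (actWedge B X) := by
    refine LinearMap.ext (TotalCochain.linearMap_ext fun p P => ?_)
    simp only [LinearMap.comp_apply, LinearMap.flip_apply, LinearMap.add_apply,
      LinearMap.smul_apply]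
    subst hB'
    exact contr_circT_lof X p q P Q
  simpa only [LinearMap.comp_apply, LinearMap.flip_apply, LinearMap.add_apply,
      LinearMap.smul_apply] using LinearMap.congr_fun key A

theorem circT_mem {p q : ℤ} {A B : TotalCochain K V V} (hA : A ∈ cochainGrading K V V p)
    (hB : B ∈ cochainGrading K V V q) : circT A B ∈ cochainGrading K V V (p + q) := by
  rcases lt_or_ge p 0 with hp | hp
  · simp [eq_zero_of_mem_of_neg hp hA]
  rcases lt_or_ge q 0 with hq | hq
  · simp [eq_zero_of_mem_of_neg hq hB]
  lift p to ℕ using hp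
  lift q to ℕ using hq
  rw [eq_lof_of_mem hA, eq_lof_of_mem hB, circT_lof]
  exact_mod_cast lof_mem_cochainGrading (p + q) _

theorem nrBracket_eq {p q : ℤ} {A B : TotalCochain K V V} (hA : A ∈ cochainGrading K V V p)
    (hB : B ∈ cochainGrading K V V q) :
    nrBracket A B = circT A B - sg K (p * q) • circT B A := by
  rcases lt_or_ge p 0 with hp | hp
  · simp [eq_zero_of_mem_of_neg hp hA]
  rcases lt_or_ge q 0 with hq | hq
  · simp [eq_zero_of_mem_of_neg hq hB]
  lift p to ℕ using hp
  lift q to ℕ using hq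
  rw [eq_lof_of_mem hA, eq_lof_of_mem hB, circT_lof, circT_lof, nrBracket_lof]
  congr 2
  rw [← sg_natCast, Nat.cast_mul]

end PreLie

section AbstractPreLie
variable {K T L E : Type*} [Field K] [AddCommGroup T] [Module K T] [AddCommGroup L] [Module K L]
  [AddCommGroup E] [Module K E]

theorem sg_eq_one_or (n : ℤ) : sg K n = 1 ∨ sg K n = -1 := by
  rcases Int.even_or_odd n with h | h
  · exact Or.inl (sg_even h)
  · exact Or.inr (sg_odd h)

/-- A graded vector space with a product of degree `0` that is determined by its compatibility with
contractions of degree `-1`. -/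
structure IsContractionAlgebra (𝒯 : ℤ → Submodule K T) (m : T →ₗ[K] T →ₗ[K] T)
    (i : L →ₗ[K] T →ₗ[K] T) (a : T →ₗ[K] L →ₗ[K] L) (c : T →ₗ[K] E) : Prop where
  eq_zero_of_neg : ∀ d : ℤ, d < 0 → ∀ x ∈ 𝒯 d, x = 0
  mul_mem : ∀ p q x y, x ∈ 𝒯 p → y ∈ 𝒯 q → m x y ∈ 𝒯 (p + q)
  contr_mem : ∀ p x X, x ∈ 𝒯 p → i X x ∈ 𝒯 (p - 1)
  act_eq_zero : ∀ p x, p ≠ 0 → x ∈ 𝒯 p → a x = 0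
  contr_mul : ∀ X x q y, y ∈ 𝒯 q → i X (m x y) = sg K q • m (i X x) y + m x (i X y) + i (a y X) x
  act_symm : ∀ x y X, a x (a y X) - a (m x y) X = a y (a x X) - a (m y x) X
  ext : ∀ x, c x = 0 → (∀ X, i X x = 0) → x = 0
  assoc : ∀ x y z, c (m (m x y) z) = c (m x (m y z))

variable {𝒯 : ℤ → Submodule K T} {m : T →ₗ[K] T →ₗ[K] T} {i : L →ₗ[K] T →ₗ[K] T}
  {a : T →ₗ[K] L →ₗ[K] L} {c : T →ₗ[K] E}

theorem IsContractionAlgebra.contr_assoc (h : IsContractionAlgebra 𝒯 m i a c) {q r : ℤ} (x : T)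
    {y z : T} (hy : y ∈ 𝒯 q) (hz : z ∈ 𝒯 r) (X : L) :
    i X (m (m x y) z - m x (m y z)) =
      (sg K q * sg K r) • (m (m (i X x) y) z - m (i X x) (m y z)) +
      sg K r • (m (m x (i X y)) z - m x (m (i X y) z)) +
      (m (m x y) (i X z) - m x (m y (i X z))) +
      (sg K r • m (i (a y X) x) z + sg K q • m (i (a z X) x) y +
        i (a y (a z X) - a (m y z) X) x) := by
  rw [map_sub, h.contr_mul X _ r z hz, h.contr_mul X x _ _ (h.mul_mem q r y z hy hz),
    h.contr_mul X x q y hy, h.contr_mul X y r z hz, h.contr_mul (a z X) x q y hy, sg_add]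
  simp only [map_add, map_smul, LinearMap.add_apply, LinearMap.smul_apply, map_sub,
    LinearMap.sub_apply]
  module

/-- The graded right pre-Lie identity. -/
theorem IsContractionAlgebra.preLie (h : IsContractionAlgebra 𝒯 m i a c) {p q r : ℤ} {x y z : T}
    (hx : x ∈ 𝒯 p) (hy : y ∈ 𝒯 q) (hz : z ∈ 𝒯 r) :
    m (m x y) z - m x (m y z) = sg K (q * r) • (m (m x z) y - m x (m z y)) := by
  obtain ⟨n, hn⟩ : ∃ n : ℕ, p + q + r < n := ⟨(p + q + r).toNat + 1, by omega⟩
  induction n generalizing p q r x y z with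
  | zero =>
    have : p < 0 ∨ q < 0 ∨ r < 0 := by push_cast at hn; omega
    rcases this with h' | h' | h'
    · simp [h.eq_zero_of_neg _ h' _ hx]
    · simp [h.eq_zero_of_neg _ h' _ hy]
    · simp [h.eq_zero_of_neg _ h' _ hz]
  | succ n ih =>
    rcases lt_or_ge q 0 with h' | hq
    · simp [h.eq_zero_of_neg _ h' _ hy]
    rcases lt_or_ge r 0 with h' | hr
    · simp [h.eq_zero_of_neg _ h' _ hz]
    refine sub_eq_zero.1 (h.ext _ ?_ fun X => ?_)
    · simp only [map_sub, map_smul, h.assoc, sub_self, smul_zero]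
    push_cast at hn
    rw [map_sub, sub_eq_zero, map_smul, h.contr_assoc x hy hz, h.contr_assoc x hz hy,
      ih (h.contr_mem p x X hx) hy hz (by omega), ih hx (h.contr_mem q y X hy) hz (by omega),
      ih hx hy (h.contr_mem r z X hz) (by omega)]
    have e1 : sg K ((q - 1) * r) = sg K (q * r) * sg K r := by
      rw [← sg_add]; exact sg_eq_of_even ⟨q * r, by ring⟩
    have e2 : sg K (q * (r - 1)) = sg K (q * r) * sg K q := by
      rw [← sg_add]; exact sg_eq_of_even ⟨q * r, by ring⟩
    have e3 (n : ℤ) : sg K n * sg K n = 1 := by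
      rw [← sg_add]; exact sg_even ⟨n, rfl⟩
    have key : (sg K r • m (i (a y X) x) z + sg K q • m (i (a z X) x) y +
        i (a y (a z X) - a (m y z) X) x) = sg K (q * r) •
        (sg K q • m (i (a z X) x) y + sg K r • m (i (a y X) x) z +
        i (a z (a y X) - a (m z y) X) x) := by
      rcases Int.even_or_odd (q * r) with he | he
      · rw [sg_even he, one_smul, h.act_symm]; abel
      · obtain ⟨hq', hr'⟩ := Int.odd_mul.1 he
        have hq0 : q ≠ 0 := by rintro rfl; simp at hq'
        have hr0 : r ≠ 0 := by rintro rfl; simp at hr'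
        have a1 := h.act_eq_zero q y hq0 hy
        have a2 := h.act_eq_zero r z hr0 hz
        have a3 := h.act_eq_zero (q + r) _ (by omega) (h.mul_mem q r y z hy hz)
        have a4 := h.act_eq_zero (r + q) _ (by omega) (h.mul_mem r q z y hz hy)
        simp [a1, a2, a3, a4]
    rw [key, e1, e2]
    simp only [smul_add, smul_smul]
    have e4 : sg K r * (sg K (q * r) * sg K r) = sg K (q * r) := by
      rw [mul_left_comm, e3, mul_one]
    rw [e4]
    have e5 : sg K (q * r) * (sg K r * sg K q) = sg K q * sg K r * sg K (q * r) := by ring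
    rw [e5]
    abel

end AbstractPreLie

section AbstractVoronov
variable {K T A : Type*} [Field K] [AddCommMonoid T] [Module K T] [AddCommMonoid A] [Module K A]

/-- The laws of a graded Lie algebra, in terms of homogeneous elements. -/
structure IsGradedLie (𝒯 : ℤ → Submodule K T) (B : T →ₗ[K] T →ₗ[K] T) : Prop where
  bracket_mem : ∀ {p q x y}, x ∈ 𝒯 p → y ∈ 𝒯 q → B x y ∈ 𝒯 (p + q)
  skew : ∀ {p q x y}, x ∈ 𝒯 p → y ∈ 𝒯 q → B x y = - sg K (p * q) • B y x
  jacobi : ∀ {p q r x y z}, x ∈ 𝒯 p → y ∈ 𝒯 q → z ∈ 𝒯 r →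
    B (B x y) z = B x (B y z) + sg K (q * r) • B (B x z) y

theorem IsContractionAlgebra.isGradedLie {T L E : Type*} [AddCommGroup T] [Module K T]
    [AddCommGroup L] [Module K L]
    [AddCommGroup E] [Module K E] {c : T →ₗ[K] E}
    {𝒯 : ℤ → Submodule K T} {m B : T →ₗ[K] T →ₗ[K] T} {i : L →ₗ[K] T →ₗ[K] T}
    {a : T →ₗ[K] L →ₗ[K] L} (h : IsContractionAlgebra 𝒯 m i a c)
    (hB : ∀ {p q x y}, x ∈ 𝒯 p → y ∈ 𝒯 q → B x y = m x y - sg K (p * q) • m y x) :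
    IsGradedLie 𝒯 B := by
  have hmem : ∀ {p q x y}, x ∈ 𝒯 p → y ∈ 𝒯 q → B x y ∈ 𝒯 (p + q) := by
    intro p q x y hx hy
    rw [hB hx hy]
    refine sub_mem (h.mul_mem p q x y hx hy) (Submodule.smul_mem _ _ ?_)
    rw [add_comm]; exact h.mul_mem q p y x hy hx
  refine ⟨hmem, fun {p q x y} hx hy => ?_, fun {p q r x y z} hx hy hz => ?_⟩
  · rw [hB hx hy, hB hy hx, mul_comm q p]
    rcases sg_eq_one_or (K := K) (p * q) with h | h <;> rw [h] <;> module
  · have hA := h.preLie hx hy hz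
    have hBB := h.preLie hy hx hz
    have hC := h.preLie hz hx hy
    rw [hB (hmem hx hy) hz, hB hx (hmem hy hz), hB (hmem hx hz) hy, hB hx hy, hB hy hz, hB hx hz]
    simp only [map_sub, map_smul, LinearMap.sub_apply, LinearMap.smul_apply, add_mul, mul_add,
      sg_add]
    rw [mul_comm r q]
    rcases sg_eq_one_or (K := K) (p * q) with h1 | h1 <;>
    rcases sg_eq_one_or (K := K) (q * r) with h2 | h2 <;>
    rcases sg_eq_one_or (K := K) (p * r) with h3 | h3 <;>
    simp only [h1, h2, h3, one_smul, neg_smul, mul_one, mul_neg, neg_neg]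
      at hA hBB hC ⊢
    · linear_combination (norm := module) hA - hBB + hC
    · linear_combination (norm := module) hA - hBB - hC
    · linear_combination (norm := module) hA - hBB - hC
    · linear_combination (norm := module) hA - hBB + hC
    · linear_combination (norm := module) hA + hBB + hC
    · linear_combination (norm := module) hA + hBB - hC
    · linear_combination (norm := module) hA + hBB - hC
    · linear_combination (norm := module) hA + hBB + hC

theorem IsContractionAlgebra.contr_bracket_zero {T L E : Type*} [AddCommGroup T] [Module K T]
    [AddCommGroup L] [Module K L]
    [AddCommGroup E] [Module K E] {c : T →ₗ[K] E}
    {𝒯 : ℤ → Submodule K T} {m B : T →ₗ[K] T →ₗ[K] T} {i : L →ₗ[K] T →ₗ[K] T}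
    {a : T →ₗ[K] L →ₗ[K] L} (h : IsContractionAlgebra 𝒯 m i a c)
    (hB : ∀ {p q x y}, x ∈ 𝒯 p → y ∈ 𝒯 q → B x y = m x y - sg K (p * q) • m y x)
    (X : L) {d : ℤ} {x e : T} (hx : x ∈ 𝒯 d) (he : e ∈ 𝒯 0) :
    i X (B x e) = B (i X x) e + i (a e X) x := by
  have he' (Y : L) : i Y e = 0 := h.eq_zero_of_neg _ (by norm_num) _ (h.contr_mem 0 e Y he)
  rw [hB hx he, hB (h.contr_mem d x X hx) he, map_sub, map_smul, h.contr_mul X x 0 e he,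
    h.contr_mul X e d x hx, he', he', mul_zero, mul_zero, sg_zero]
  simp only [map_zero, LinearMap.zero_apply, smul_zero, one_smul, add_zero, zero_add]
  abel

theorem linearMap_eq_of_iSup_eq_top {M : Type*} [AddCommMonoid M] [Module K M]
    {𝒯 : ℤ → Submodule K T} (hT : ⨆ d, 𝒯 d = ⊤) {f f' : T →ₗ[K] M}
    (h : ∀ d, ∀ x ∈ 𝒯 d, f x = f' x) : f = f' := by
  ext x
  have hx : x ∈ ⨆ d, 𝒯 d := by rw [hT]; trivial
  induction hx using Submodule.iSup_induction' with
  | mem d x hx => exact h d x hx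
  | zero => simp
  | add x y _ _ hx hy => rw [map_add, map_add, hx, hy]

/-- Bracketing with an element of degree zero is a derivation. -/
theorem IsGradedLie.leibniz_zero {𝒯 : ℤ → Submodule K T} {B : T →ₗ[K] T →ₗ[K] T}
    (h : IsGradedLie 𝒯 B) (hT : ⨆ d, 𝒯 d = ⊤) {e : T} (he : e ∈ 𝒯 0) (x y : T) :
    B (B x y) e = B x (B y e) + B (B x e) y := by
  have : B.compr₂ (B.flip e) = B.compl₂ (B.flip e) + B ∘ₗ B.flip e := by
    refine linearMap_eq_of_iSup_eq_top hT fun p x hx =>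
      linearMap_eq_of_iSup_eq_top hT fun q y hy => ?_
    simp only [LinearMap.compr₂_apply, LinearMap.flip_apply, LinearMap.add_apply,
      LinearMap.compl₂_apply, LinearMap.comp_apply]
    rw [h.jacobi hx hy he, mul_zero, sg_zero, one_smul]
  simpa only [LinearMap.compr₂_apply, LinearMap.flip_apply, LinearMap.add_apply,
    LinearMap.compl₂_apply, LinearMap.comp_apply] using LinearMap.congr_fun₂ this x y

/-- Data for higher derived brackets: a graded Lie algebra, an abelian subalgebra and a projection
onto it whose kernel is a subalgebra. -/
structure IsVoronovData (𝒯 : ℤ → Submodule K T) (B : T →ₗ[K] T →ₗ[K] T) (𝒜 : ℤ → Submodule K A)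
    (ι : A →ₗ[K] T) (P : T →ₗ[K] A) : Prop extends IsGradedLie 𝒯 B where
  incl_mem : ∀ {d a}, a ∈ 𝒜 d → ι a ∈ 𝒯 d
  proj_mem : ∀ {d x}, x ∈ 𝒯 d → P x ∈ 𝒜 d
  proj_incl : ∀ a, P (ι a) = a
  abelian : ∀ {p q a b}, a ∈ 𝒜 p → b ∈ 𝒜 q → B (ι a) (ι b) = 0
  ker_bracket : ∀ {p q x y}, x ∈ 𝒯 p → y ∈ 𝒯 q → P x = 0 → P y = 0 → P (B x y) = 0

/-- `[⋯[[Y, x₀], x₁], ⋯, x_{n-1}]`. -/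
def iter (B : T →ₗ[K] T →ₗ[K] T) (ι : A →ₗ[K] T) : ℕ → (ℕ → A) → T →ₗ[K] T
  | 0, _ => LinearMap.id
  | n + 1, x => iter B ι n (fun j => x (j + 1)) ∘ₗ B.flip (ι (x 0))

section Iter
variable (B : T →ₗ[K] T →ₗ[K] T) (ι : A →ₗ[K] T)

theorem iter_zero (x : ℕ → A) (Y : T) : iter B ι 0 x Y = Y := rfl

theorem iter_succ (n : ℕ) (x : ℕ → A) (Y : T) :
    iter B ι (n + 1) x Y = iter B ι n (fun j => x (j + 1)) (B Y (ι (x 0))) := rfl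

theorem iter_congr {n : ℕ} {x x' : ℕ → A} (h : ∀ j < n, x j = x' j) (Y : T) :
    iter B ι n x Y = iter B ι n x' Y := by
  induction n generalizing x x' Y with
  | zero => rfl
  | succ n ih =>
    rw [iter_succ, iter_succ, h 0 (by omega), ih fun j hj => h (j + 1) (by omega)]

theorem iter_add (n k : ℕ) (x : ℕ → A) (Y : T) :
    iter B ι (n + k) x Y = iter B ι k (fun j => x (n + j)) (iter B ι n x Y) := by
  induction n generalizing x Y with
  | zero => simp [iter_zero]
  | succ n ih =>
    rw [add_right_comm, iter_succ, ih, iter_succ]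
    simp only [add_right_comm]

theorem iter_succ' (n : ℕ) (x : ℕ → A) (Y : T) :
    iter B ι (n + 1) x Y = B (iter B ι n x Y) (ι (x n)) := iter_add B ι n 1 x Y

end Iter

variable {𝒯 : ℤ → Submodule K T} {B : T →ₗ[K] T →ₗ[K] T} {𝒜 : ℤ → Submodule K A}
  {ι : A →ₗ[K] T} {P : T →ₗ[K] A}

namespace IsVoronovData

theorem proj_bracket (h : IsVoronovData 𝒯 B 𝒜 ι P) {p q : ℤ} {x y : T} (hx : x ∈ 𝒯 p)
    (hy : y ∈ 𝒯 q) : P (B x y) = P (B x (ι (P y))) + P (B (ι (P x)) y) := by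
  let _ : AddCommGroup T := Module.addCommMonoidToAddCommGroup K
  let _ : AddCommGroup A := Module.addCommMonoidToAddCommGroup K
  have hx' := h.incl_mem (h.proj_mem hx)
  have hy' := h.incl_mem (h.proj_mem hy)
  have h1 := h.ker_bracket (sub_mem hx hx') (sub_mem hy hy')
    (by rw [map_sub, h.proj_incl, sub_self]) (by rw [map_sub, h.proj_incl, sub_self])
  have h2 := h.abelian (h.proj_mem hx) (h.proj_mem hy)
  simp only [map_sub, LinearMap.sub_apply, h2, sub_zero] at h1
  linear_combination (norm := module) h1

theorem bracket_swap (h : IsVoronovData 𝒯 B 𝒜 ι P) {y p q : ℤ} {Y : T} {a b : A} (hY : Y ∈ 𝒯 y)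
    (ha : a ∈ 𝒜 p) (hb : b ∈ 𝒜 q) :
    B (B Y (ι a)) (ι b) = sg K (p * q) • B (B Y (ι b)) (ι a) := by
  rw [h.jacobi hY (h.incl_mem ha) (h.incl_mem hb), h.abelian ha hb, map_zero, zero_add]

theorem iter_mem (h : IsVoronovData 𝒯 B 𝒜 ι P) {y : ℤ} {Y : T} (hY : Y ∈ 𝒯 y) {d : ℕ → ℤ}
    {x : ℕ → A} (hx : ∀ j, x j ∈ 𝒜 (d j)) (n : ℕ) :
    iter B ι n x Y ∈ 𝒯 (y + ∑ j ∈ Finset.range n, d j) := by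
  induction n with
  | zero => simpa [iter_zero] using hY
  | succ n ih =>
    rw [iter_succ', Finset.sum_range_succ, ← add_assoc]
    exact h.bracket_mem ih (h.incl_mem (hx n))

/-- Moving the first element from position `p` to the front. -/
theorem iter_insFun (h : IsVoronovData 𝒯 B 𝒜 ι P) {d : ℕ → ℤ} {x : ℕ → A}
    (hx : ∀ j, x j ∈ 𝒜 (d j)) {p n : ℕ} (hp : p ≤ n) {y : ℤ} {Y : T} (hY : Y ∈ 𝒯 y) (s : ℕ → ℕ) :
    iter B ι (n + 1) (fun j => x (insFun p s j)) Y =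
      sg K (d 0 * ∑ j ∈ Finset.range p, d (s j + 1)) •
        iter B ι n (fun j => x (s j + 1)) (B Y (ι (x 0))) := by
  induction p generalizing n y Y s with
  | zero => simp [iter_succ, insFun, sg_zero]
  | succ p ih =>
    obtain ⟨n, rfl⟩ : ∃ k, n = k + 1 := ⟨n - 1, by omega⟩
    have e (j : ℕ) : insFun (p + 1) s (j + 1) = insFun p (fun a => s (a + 1)) j := by
      unfold insFun
      simp only [add_lt_add_iff_right, add_left_inj, add_tsub_cancel_right]
      split_ifs with h1 h2
      · rfl
      · rfl
      · rw [Nat.sub_add_cancel (by omega)]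
    rw [iter_succ]
    simp only [e]
    rw [ih (by omega) (h.bracket_mem hY (h.incl_mem (hx _))), iter_succ,
      h.bracket_swap hY (hx _) (hx 0), map_smul, smul_smul, ← sg_add, Finset.sum_range_succ']
    congr 2
    rw [show insFun (p + 1) s 0 = s 0 + 1 by simp [insFun]]; ring

theorem iter_perm (h : IsVoronovData 𝒯 B 𝒜 ι P) {d : ℕ → ℤ} {x : ℕ → A}
    (hx : ∀ j, x j ∈ 𝒜 (d j)) {n : ℕ} {y : ℤ} {Y : T} (hY : Y ∈ 𝒯 y) (σ : Equiv.Perm (Fin n)) :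
    iter B ι n (fun j => x (permFun σ j)) Y =
      ((koszulSign (fun a : Fin n => d a) σ : ℤ) : K) • iter B ι n x Y := by
  induction n generalizing d x y Y with
  | zero => simp [koszulSign, iter_zero]
  | succ n ih =>
    obtain ⟨⟨p, τ⟩, rfl⟩ := (insPerm_bijective n).surjective σ
    simp only
    rw [permFun_insPerm, h.iter_insFun hx (by omega) hY, koszulSign_insPerm_cast,
      mul_comm (Int.cast _), mul_smul, iter_succ]
    congr 1
    exact ih (fun j => hx (j + 1)) (h.bracket_mem hY (h.incl_mem (hx 0))) τ

end IsVoronovData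

/-- The sum `∑ ε(σ) P[Y, P[X, x_{σ(1)}, …, x_{σ(i)}], x_{σ(i+1)}, …, x_{σ(n)}]` over all shuffles. -/
noncomputable def nestedSum (B : T →ₗ[K] T →ₗ[K] T) (ι : A →ₗ[K] T) (P : T →ₗ[K] A) (n : ℕ)
    (d : ℕ → ℤ) (x : ℕ → A) (Y X : T) : A :=
  ∑ i ∈ Finset.range (n + 1), shuffleSum K d i n fun s =>
    P (iter B ι (n - i) (fun t => x (s (i + t)))
      (B Y (ι (P (iter B ι i (fun j => x (s j)) X)))))

namespace IsVoronovData

theorem nestedSum_succ (h : IsVoronovData 𝒯 B 𝒜 ι P) {d : ℕ → ℤ} {x : ℕ → A}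
    (hx : ∀ j, x j ∈ 𝒜 (d j)) (n : ℕ) {y u : ℤ} {Y X : T} (hY : Y ∈ 𝒯 y) (hX : X ∈ 𝒯 u) :
    nestedSum B ι P (n + 1) d x Y X =
      nestedSum B ι P n (fun j => d (j + 1)) (fun j => x (j + 1)) Y (B X (ι (x 0))) +
      sg K (d 0 * u) •
        nestedSum B ι P n (fun j => d (j + 1)) (fun j => x (j + 1)) (B Y (ι (x 0))) X := by
  rw [nestedSum, sum_shuffleSum_succ]
  congr 1
  · refine Finset.sum_congr rfl fun i hi => ?_
    congr 1
    ext1 s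
    have e (t : ℕ) : insFun 0 s (i + 1 + t) = s (i + t) + 1 := by
      rw [add_right_comm]; simp [insFun]
    have e1 (t : ℕ) : insFun 0 s (t + 1) = s t + 1 := by simp [insFun]
    simp only [iter_succ, e, e1, Nat.add_sub_add_right]
    rw [show insFun 0 s 0 = 0 by simp [insFun]]
  · rw [nestedSum, Finset.smul_sum]
    refine Finset.sum_congr rfl fun i hi => ?_
    rw [shuffleSum, shuffleSum, Finset.smul_sum]
    refine Finset.sum_congr rfl fun σ _ => ?_
    rw [smul_comm (sg K (d 0 * u))]
    congr 1
    generalize permFun σ = s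
    have hin : n + 1 - i = n - i + 1 := by have := Finset.mem_range.1 hi; omega
    have e1 : iter B ι i (fun j => x (insFun i s j)) X = iter B ι i (fun j => x (s j + 1)) X :=
      iter_congr _ _ (fun j hj => by simp [insFun, hj]) _
    have e2 (t : ℕ) : insFun i s (i + (t + 1)) = s (i + t) + 1 := by
      rw [insFun, if_neg (by omega), if_neg (by omega)]; congr 2
    have e3 : insFun i s (i + 0) = 0 := by simp [insFun]
    rw [e1, hin, iter_succ, e3]
    simp only [e2]
    have hmem := h.proj_mem (h.iter_mem hX (fun j => hx (s j + 1)) i)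
    rw [h.bracket_swap hY hmem (hx 0), map_smul, map_smul, smul_smul, ← sg_add]
    congr 1
    exact sg_eq_of_even ⟨d 0 * u + d 0 * ∑ j ∈ Finset.range i, d (s j + 1), by ring⟩ |>.trans rfl

theorem proj_iter_bracket (h : IsVoronovData 𝒯 B 𝒜 ι P) {d : ℕ → ℤ} {x : ℕ → A}
    (hx : ∀ j, x j ∈ 𝒜 (d j)) (n : ℕ) {y u : ℤ} {Y X : T} (hY : Y ∈ 𝒯 y) (hX : X ∈ 𝒯 u) :
    P (iter B ι n x (B Y X)) =
      nestedSum B ι P n d x Y X + (-sg K (y * u)) • nestedSum B ι P n d x X Y := by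
  induction n generalizing d x y u Y X with
  | zero =>
    simp only [nestedSum, zero_add, Finset.sum_range_one, shuffleSum_size_zero, iter_zero]
    rw [h.proj_bracket hY hX, h.skew (h.incl_mem (h.proj_mem hY)) hX, map_smul]
    rfl
  | succ n ih =>
    have hx0 := h.incl_mem (hx 0)
    rw [iter_succ, h.jacobi hY hX hx0, map_add, map_add, map_smul, map_smul,
      ih (fun j => hx (j + 1)) hY (h.bracket_mem hX hx0),
      ih (fun j => hx (j + 1)) (h.bracket_mem hY hx0) hX,
      h.nestedSum_succ hx n hY hX, h.nestedSum_succ hx n hX hY]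
    simp only [mul_add, add_mul, sg_add]
    rw [mul_comm u (d 0), mul_comm y (d 0)]
    rcases sg_eq_one_or (K := K) (d 0 * u) with h1 | h1 <;>
    rcases sg_eq_one_or (K := K) (d 0 * y) with h2 | h2 <;>
    rcases sg_eq_one_or (K := K) (y * u) with h3 | h3 <;>
    rw [h1, h2, h3] <;> module

theorem nestedSum_eq_zero [CharZero K] (h : IsVoronovData 𝒯 B 𝒜 ι P) {d : ℕ → ℤ} {x : ℕ → A}
    (hx : ∀ j, x j ∈ 𝒜 (d j)) (n : ℕ) {Δ : T} (hΔ : Δ ∈ 𝒯 1) (hΔΔ : B Δ Δ = 0) :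
    nestedSum B ι P n d x Δ Δ = 0 := by
  have := h.proj_iter_bracket hx n hΔ hΔ
  rw [hΔΔ, map_zero, map_zero, mul_one, sg_one, neg_neg, one_smul, ← two_smul K] at this
  exact (smul_eq_zero.1 this.symm).resolve_left two_ne_zero

end IsVoronovData

section Weight

theorem iter_weight {E : T} (hE : ∀ x y, B (B x y) E = B x (B y E) + B (B x E) y)
    (hι : ∀ a, B (ι a) E = (-1 : K) • ι a) {w : K} {Y : T} (hY : B Y E = w • Y) (n : ℕ) (x : ℕ → A) :
    B (iter B ι n x Y) E = (w - n) • iter B ι n x Y := by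
  induction n with
  | zero => simpa [iter_zero] using hY
  | succ n ih =>
    rw [iter_succ', hE, hι, ih]
    simp only [map_neg, map_smul, LinearMap.smul_apply]
    push_cast
    module

theorem proj_iter_eq_zero {E : T} (hE : ∀ x y, B (B x y) E = B x (B y E) + B (B x E) y)
    (hι : ∀ a, B (ι a) E = (-1 : K) • ι a) (hP : ∀ x, P (B x E) = (-1 : K) • P x)
    {w : K} {Y : T} (hY : B Y E = w • Y) {n : ℕ} (hn : w + 1 ≠ n) (x : ℕ → A) :
    P (iter B ι n x Y) = 0 := by
  let _ : AddCommGroup A := Module.addCommMonoidToAddCommGroup K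
  have h1 := hP (iter B ι n x Y)
  rw [iter_weight hE hι hY, map_smul, neg_one_smul, eq_neg_iff_add_eq_zero] at h1
  have h2 : (w + 1 - n) • P (iter B ι n x Y) = 0 := by
    rw [← h1]; module
  exact (smul_eq_zero.1 h2).resolve_left (sub_ne_zero.2 hn)

end Weight

section Twist
variable [CharZero K]

/-- The terms of the exponential series of `[-, α]`, applied to `Δ`. -/
noncomputable def expTerm (B : T →ₗ[K] T →ₗ[K] T) (ι : A →ₗ[K] T) (α : A) (Δ : T) (n : ℕ) : T :=
  ((n.factorial : K))⁻¹ • iter B ι n (fun _ => α) Δ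

theorem bracket_expTerm (α : A) (Δ : T) (n : ℕ) :
    B (expTerm B ι α Δ n) (ι α) = ((n : K) + 1) • expTerm B ι α Δ (n + 1) := by
  rw [expTerm, expTerm, map_smul, LinearMap.smul_apply, ← iter_succ' B ι n (fun _ => α),
    smul_smul, Nat.factorial_succ]
  congr 1
  have h1 : (n.factorial : K) ≠ 0 := by exact_mod_cast n.factorial_ne_zero
  have h2 : (n : K) + 1 ≠ 0 := by exact_mod_cast n.succ_ne_zero
  push_cast
  field_simp

theorem sum_antidiagonal_bracket_expTerm {α : A}
    (hα : ∀ x y, B (B x y) (ι α) = B x (B y (ι α)) + B (B x (ι α)) y) {Δ : T} (hΔ : B Δ Δ = 0)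
    (n : ℕ) : ∑ ij ∈ Finset.HasAntidiagonal.antidiagonal n,
      B (expTerm B ι α Δ ij.1) (expTerm B ι α Δ ij.2) = 0 := by
  induction n with
  | zero => simp [expTerm, iter_zero, hΔ]
  | succ n ih =>
    have h1 : ((n : K) + 1) • ∑ ij ∈ Finset.HasAntidiagonal.antidiagonal (n + 1),
        B (expTerm B ι α Δ ij.1) (expTerm B ι α Δ ij.2) =
        B (∑ ij ∈ Finset.HasAntidiagonal.antidiagonal n,
          B (expTerm B ι α Δ ij.1) (expTerm B ι α Δ ij.2)) (ι α) := by
      have e : ((n : K) + 1) • ∑ ij ∈ Finset.HasAntidiagonal.antidiagonal (n + 1),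
          B (expTerm B ι α Δ ij.1) (expTerm B ι α Δ ij.2) =
          ∑ ij ∈ Finset.HasAntidiagonal.antidiagonal (n + 1), (ij.2 : K) •
            B (expTerm B ι α Δ ij.1) (expTerm B ι α Δ ij.2) +
          ∑ ij ∈ Finset.HasAntidiagonal.antidiagonal (n + 1), (ij.1 : K) •
            B (expTerm B ι α Δ ij.1) (expTerm B ι α Δ ij.2) := by
        rw [Finset.smul_sum, ← Finset.sum_add_distrib]
        refine Finset.sum_congr rfl fun ij hij => ?_
        rw [← add_smul]
        congr 1
        have := Finset.HasAntidiagonal.mem_antidiagonal.1 hij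
        have h' : ((ij.1 + ij.2 : ℕ) : K) = ((n + 1 : ℕ) : K) := by rw [this]
        push_cast at h'
        rw [← h', add_comm]
      rw [e, Finset.Nat.sum_antidiagonal_succ', Finset.Nat.sum_antidiagonal_succ, map_sum,
        LinearMap.sum_apply]
      simp only [Nat.cast_zero, zero_smul, zero_add, hα, bracket_expTerm, map_smul,
        LinearMap.smul_apply, Finset.sum_add_distrib, Nat.cast_add, Nat.cast_one]
    rw [ih, map_zero, LinearMap.zero_apply] at h1
    exact (smul_eq_zero.1 h1).resolve_left (by exact_mod_cast n.succ_ne_zero)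

/-- The twist `Δ + [Δ, α] + ½[[Δ, α], α] + ⅙[[[Δ, α], α], α]` of `Δ` by `α`. -/
noncomputable def twistElem (B : T →ₗ[K] T →ₗ[K] T) (ι : A →ₗ[K] T) (α : A) (Δ : T) : T :=
  ∑ n ∈ Finset.range 4, expTerm B ι α Δ n

theorem bracket_twistElem {α : A}
    (hα : ∀ x y, B (B x y) (ι α) = B x (B y (ι α)) + B (B x (ι α)) y) {Δ : T} (hΔ : B Δ Δ = 0)
    (h4 : ∀ n, 4 ≤ n → iter B ι n (fun _ => α) Δ = 0) :
    B (twistElem B ι α Δ) (twistElem B ι α Δ) = 0 := by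
  have h (n) := sum_antidiagonal_bracket_expTerm (B := B) (ι := ι) hα hΔ n
  have h4' (n) (hn : 4 ≤ n) : expTerm B ι α Δ n = 0 := by rw [expTerm, h4 n hn, smul_zero]
  have hsum : ∑ n ∈ Finset.range 7, ∑ ij ∈ Finset.HasAntidiagonal.antidiagonal n,
      B (expTerm B ι α Δ ij.1) (expTerm B ι α Δ ij.2) = 0 :=
    Finset.sum_eq_zero fun n _ => h n
  rw [← hsum, twistElem]
  simp only [Finset.sum_range_succ, Finset.sum_range_zero, Finset.Nat.sum_antidiagonal_succ,
    Finset.Nat.antidiagonal_zero, Finset.sum_singleton, zero_add, Nat.reduceAdd, map_add,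
    LinearMap.add_apply, h4' 4 le_rfl, h4' 5 (by norm_num), h4' 6 (by norm_num), map_zero,
    LinearMap.zero_apply, add_zero]
  abel

end Twist

/-- The sequence extending a finite family by zero. -/
def extendSeq {α : Type*} [Zero α] {n : ℕ} (x : Fin n → α) (j : ℕ) : α :=
  if h : j < n then x ⟨j, h⟩ else 0

theorem extendSeq_val {α : Type*} [Zero α] {n : ℕ} (x : Fin n → α) (j : Fin n) :
    extendSeq x j = x j := by simp [extendSeq]

theorem extendSeq_permFun {α : Type*} [Zero α] {n : ℕ} (x : Fin n → α) (σ : Equiv.Perm (Fin n))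
    {j : ℕ} (hj : j < n) : extendSeq x (permFun σ j) = x (σ ⟨j, hj⟩) := by
  simp [extendSeq, permFun, hj]

theorem extendSeq_mem {n : ℕ} {d : Fin n → ℤ} {x : Fin n → A} (hx : ∀ i, x i ∈ 𝒜 (d i)) (j : ℕ) :
    extendSeq x j ∈ 𝒜 (extendSeq d j) := by
  unfold extendSeq
  split_ifs with h
  · exact hx _
  · exact zero_mem _

/-- Higher derived brackets of a Maurer-Cartan element in the kernel of the projection form an
`L_∞`-algebra. -/
theorem IsVoronovData.isLInfinityAlgebra {A : Type*} [AddCommGroup A] [Module K A] [CharZero K]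
    {𝒜 : ℤ → Submodule K A} {ι : A →ₗ[K] T} {P : T →ₗ[K] A} (h : IsVoronovData 𝒯 B 𝒜 ι P)
    (hint : DirectSum.IsInternal 𝒜) {Δ : T} (hΔ : Δ ∈ 𝒯 1) (hΔΔ : B Δ Δ = 0) (hPΔ : P Δ = 0)
    {l : (k : ℕ) → MultilinearMap K (fun _ : Fin k => A) A}
    (hl : ∀ k, 1 ≤ k → ∀ x : ℕ → A, l k (fun j => x j) = P (iter B ι k x Δ)) :
    IsLInfinityAlgebra 𝒜 l := by
  have hl' (k : ℕ) (hk : 1 ≤ k) (x : Fin k → A) : l k x = P (iter B ι k (extendSeq x) Δ) := by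
    rw [← hl k hk]; simp only [extendSeq_val]
  refine ⟨hint, fun k hk d x hx => ?_, fun n hn d x hx σ => ?_, fun n hn d x hx => ?_⟩
  · rw [hl' k hk]
    have := h.proj_mem (h.iter_mem hΔ (extendSeq_mem hx) k)
    rw [← Fin.sum_univ_eq_sum_range (extendSeq d)] at this
    simpa only [extendSeq_val, add_comm] using this
  · rw [hl' n hn x]
    have := h.iter_perm (extendSeq_mem hx) hΔ σ
    simp only [extendSeq_val] at this
    rw [← map_smul P, ← this]
    have e : (fun i => x (σ i)) = fun j : Fin n => extendSeq x (permFun σ j) := by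
      ext1 j; rw [extendSeq_permFun x σ j.2]
    rw [e, hl n hn fun j => extendSeq x (permFun σ j)]
  · have := h.nestedSum_eq_zero (extendSeq_mem hx) n hΔ hΔΔ
    rw [nestedSum, Finset.sum_range_succ', add_eq_left.2 (by simp [iter_zero, hPΔ, shuffleSum]),
      ← Fin.sum_univ_eq_sum_range (fun i => shuffleSum K (extendSeq d) (i + 1) n fun s =>
        P (iter B ι (n - (i + 1)) (fun t => extendSeq x (s (i + 1 + t)))
      (B Δ (ι (P (iter B ι (i + 1) (fun j => extendSeq x (s j)) Δ))))))] at this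
    rw [← this]
    refine Finset.sum_congr rfl fun i _ => ?_
    rw [shuffleSum]
    refine Finset.sum_congr rfl fun σ _ => ?_
    simp only [extendSeq_val]
    congr 1
    have e1 : (fun s : Fin (i + 1) => x (σ ⟨s, by omega⟩)) =
        fun j : Fin (i + 1) => extendSeq x (permFun σ j) := by
      ext1 j; rw [extendSeq_permFun x σ (by omega)]
    rw [e1, hl (i + 1) (by omega) fun j => extendSeq x (permFun σ j)]
    generalize P (iter B ι (i + 1) (fun j => extendSeq x (permFun σ j)) Δ) = b
    have e2 : Matrix.vecCons b (fun t : Fin (n - 1 - i) => x (σ ⟨i + 1 + t, by omega⟩)) =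
        fun j : Fin (n - 1 - i + 1) => (fun j : ℕ => Nat.casesOn j b
          fun t => extendSeq x (permFun σ (i + 1 + t)) : ℕ → A) j := by
      ext1 j
      refine Fin.cases ?_ (fun t => ?_) j
      · simp
      · simp only [Matrix.cons_val_succ, Fin.val_succ]
        rw [extendSeq_permFun x σ (by omega)]
    rw [e2, hl _ (by omega), iter_succ, Nat.sub_sub, add_comm 1]
    rfl

end AbstractVoronov

section Wedge
variable {K V W : Type*} [Field K] [AddCommGroup V] [Module K V] [AddCommGroup W] [Module K W]

theorem wedge_linearMap_ext {f f' : ⋀[K]^2 V →ₗ[K] W}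
    (h : ∀ x y, f (wedge K x y) = f' (wedge K x y)) : f = f' := by
  refine exteriorPower.linearMap_ext (AlternatingMap.ext fun v => ?_)
  have e : v = ![v 0, v 1] := by ext i; fin_cases i <;> rfl
  rw [e]
  exact h _ _

theorem wedge_add_left (x x' y : V) : wedge K (x + x') y = wedge K x y + wedge K x' y :=
  alt_add_left _ _ _ _

theorem wedge_add_right (x y y' : V) : wedge K x (y + y') = wedge K x y + wedge K x y' :=
  alt_add_right _ _ _ _

theorem wedge_zero_left (y : V) : wedge K 0 y = 0 := by
  have := wedge_add_left (K := K) 0 0 y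
  simpa using this

theorem wedge_zero_right (x : V) : wedge K x 0 = 0 := by
  have := wedge_add_right (K := K) x 0 0
  simpa using this

theorem map_wedge (f : V →ₗ[K] W) (x y : V) :
    exteriorPower.map 2 f (wedge K x y) = wedge K (f x) (f y) := by
  have e : (f ∘ ![x, y]) = ![f x, f y] := by ext t; fin_cases t <;> rfl
  rw [wedge, exteriorPower.map_apply_ιMulti, e]; rfl

theorem wedgeDer_symm (S T : V →ₗ[K] V) (X : ⋀[K]^2 V) :
    wedgeDer S (wedgeDer T X) - wedgeDer (S ∘ₗ T) X =
      wedgeDer T (wedgeDer S X) - wedgeDer (T ∘ₗ S) X := by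
  have : wedgeDer S ∘ₗ wedgeDer T - wedgeDer (S ∘ₗ T) =
      wedgeDer T ∘ₗ wedgeDer S - wedgeDer (T ∘ₗ S) := by
    refine wedge_linearMap_ext fun x y => ?_
    simp only [LinearMap.sub_apply, LinearMap.comp_apply, wedgeDer_wedge, map_add]
    abel
  exact LinearMap.congr_fun this X

/-- If `T` maps the image of `f` to itself, by `S`, then so does the induced map on `∧²`. -/
theorem wedgeDer_map {f : W →ₗ[K] V} {T : V →ₗ[K] V} {S : W →ₗ[K] W} (h : T ∘ₗ f = f ∘ₗ S)
    (X : ⋀[K]^2 W) :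
    wedgeDer T (exteriorPower.map 2 f X) = exteriorPower.map 2 f (wedgeDer S X) := by
  have : wedgeDer T ∘ₗ exteriorPower.map 2 f = exteriorPower.map 2 f ∘ₗ wedgeDer S := by
    refine wedge_linearMap_ext fun x y => ?_
    have h' (x : W) : T (f x) = f (S x) := LinearMap.congr_fun h x
    simp only [LinearMap.comp_apply, wedgeDer_wedge, map_add, map_wedge, h']
  exact LinearMap.congr_fun this X

end Wedge

section ConcreteLie
variable {K V W : Type*} [Field K] [AddCommGroup V] [Module K V] [AddCommGroup W] [Module K W]

theorem isContractionAlgebra_circT :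
    IsContractionAlgebra (cochainGrading K V V) circT contr actWedge degZero where
  eq_zero_of_neg _ hd _ hx := eq_zero_of_mem_of_neg hd hx
  mul_mem _ _ _ _ hx hy := circT_mem hx hy
  contr_mem _ _ X hx := contr_mem X hx
  act_eq_zero _ x hp hx := by
    rw [actWedge, LinearMap.comp_apply, degZero_eq_zero_of_mem hp hx, map_zero]
  contr_mul X x _ _ hy := contr_circT X x hy
  act_symm x y X := by
    simp only [actWedge, LinearMap.comp_apply, degZero_circT]
    exact wedgeDer_symm _ _ X
  ext x h0 h := TotalCochain.ext_contr (by rw [h0, map_zero]) fun X => by rw [h X, map_zero]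
  assoc x y z := by simp only [degZero_circT, LinearMap.comp_assoc]

theorem isGradedLie_nrBracket : IsGradedLie (cochainGrading K V V) nrBracket :=
  isContractionAlgebra_circT.isGradedLie fun hx hy => nrBracket_eq hx hy

theorem nrBracket_ofHom {d : ℤ} {A : TotalCochain K V V} (hA : A ∈ cochainGrading K V V d)
    (f : V →ₗ[K] V) : nrBracket A (ofHom f) = circT A (ofHom f) - circT (ofHom f) A := by
  rw [nrBracket_eq hA (ofHom_mem f), mul_zero, sg_zero, one_smul]

theorem contr_eq_zero_of_mem_zero (X : ⋀[K]^2 V) {A : TotalCochain K V W}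
    (hA : A ∈ cochainGrading K V W 0) : contr X A = 0 :=
  eq_zero_of_mem_of_neg (by norm_num) (contr_mem X hA)

theorem contr_nrBracket_ofHom (X : ⋀[K]^2 V) {d : ℤ} {A : TotalCochain K V V}
    (hA : A ∈ cochainGrading K V V d) (f : V →ₗ[K] V) :
    contr X (nrBracket A (ofHom f)) =
      nrBracket (contr X A) (ofHom f) + contr (wedgeDer f X) A := by
  have := isContractionAlgebra_circT.contr_bracket_zero (B := nrBracket (K := K) (V := V))
    nrBracket_eq X hA (ofHom_mem f)
  rwa [actWedge, LinearMap.comp_apply, degZero_ofHom] at this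

theorem degZero_nrBracket_ofHom {d : ℤ} {A : TotalCochain K V V}
    (hA : A ∈ cochainGrading K V V d) (f : V →ₗ[K] V) :
    degZero (nrBracket A (ofHom f)) = degZero A ∘ₗ f - f ∘ₗ degZero A := by
  rw [nrBracket_ofHom hA, LinearMap.map_sub, degZero_circT, degZero_circT, degZero_ofHom]

theorem nrBracket_mem_zero {d : ℤ} {A : TotalCochain K V V} (hA : A ∈ cochainGrading K V V d)
    (f : V →ₗ[K] V) : nrBracket A (ofHom f) ∈ cochainGrading K V V d := by
  have := isGradedLie_nrBracket.bracket_mem hA (ofHom_mem f)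
  rwa [add_zero] at this

theorem isInternal_cochainGrading : DirectSum.IsInternal (cochainGrading K V W) := by
  classical
  have hcomp (f : DirectSum ℤ fun d => cochainGrading K V W d) (n : ℕ) :
      DirectSum.coeAddMonoidHom (cochainGrading K V W) f n = (f n : TotalCochain K V W) n := by
    induction f using DirectSum.induction_on with
    | zero => simp
    | of d x =>
      rw [DirectSum.coeAddMonoidHom_of]
      by_cases h : d = n
      · subst h; rw [DirectSum.of_eq_same]
      · rw [DirectSum.of_eq_of_ne _ _ _ (Ne.symm h)]
        exact x.2 n (Ne.symm h)
    | add f f' h h' => rw [map_add, DirectSum.add_apply, h, h', DirectSum.add_apply]; rfl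
  constructor
  · refine (injective_iff_map_eq_zero _).2 fun f hf => ?_
    refine DFinsupp.ext fun d => Subtype.ext ?_
    refine DFinsupp.ext fun n => ?_
    by_cases h : (n : ℤ) = d
    · subst h
      rw [← hcomp, hf]; rfl
    · exact (f d).2 n h
  · intro A
    induction A using DirectSum.induction_on with
    | zero => exact ⟨0, map_zero _⟩
    | of n P =>
      exact ⟨DirectSum.of (fun d => cochainGrading K V W d) n ⟨_, lof_mem_cochainGrading n P⟩,
        DirectSum.coeAddMonoidHom_of _ _ _⟩
    | add A A' h h' =>
      obtain ⟨f, rfl⟩ := h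
      obtain ⟨f', rfl⟩ := h'
      exact ⟨f + f', map_add _ _ _⟩

theorem iSup_cochainGrading : ⨆ d, cochainGrading K V W d = ⊤ :=
  isInternal_cochainGrading.submodule_iSup_eq_top

theorem nrBracket_nrBracket_ofHom (A B : TotalCochain K V V) (f : V →ₗ[K] V) :
    nrBracket (nrBracket A B) (ofHom f) =
      nrBracket A (nrBracket B (ofHom f)) + nrBracket (nrBracket A (ofHom f)) B :=
  isGradedLie_nrBracket.leibniz_zero iSup_cochainGrading (ofHom_mem f) A B

end ConcreteLie

section Functoriality
variable {K V W V' W' : Type*} [Field K] [AddCommGroup V] [Module K V] [AddCommGroup W]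
  [Module K W] [AddCommGroup V'] [Module K V'] [AddCommGroup W'] [Module K W']

/-- The map on total cochains induced by `f : V' → V` and `u : W → W'`. -/
noncomputable def mapT (f : V' →ₗ[K] V) (u : W →ₗ[K] W') :
    TotalCochain K V W →ₗ[K] TotalCochain K V' W' := DirectSum.lmap (Cochain.map f u)

theorem evalSeq_mapT (f : V' →ₗ[K] V) (u : W →ₗ[K] W') (n : ℕ) (Z : ℕ → ⋀[K]^2 V')
    (A : TotalCochain K V W) :
    evalSeq n Z (mapT f u A) = u ∘ₗ evalSeq n (fun j => exteriorPower.map 2 f (Z j)) A ∘ₗ f := by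
  ext v
  change (DirectSum.lmap (Cochain.map f u) A n).1 _ v = _
  rw [DirectSum.lmap_apply, Cochain.map_apply]
  rfl

theorem degZero_mapT (f : V' →ₗ[K] V) (u : W →ₗ[K] W') (A : TotalCochain K V W) :
    degZero (mapT f u A) = u ∘ₗ degZero A ∘ₗ f := by
  rw [degZero, evalSeq_mapT, evalSeq_zero]

theorem contr_mapT (f : V' →ₗ[K] V) (u : W →ₗ[K] W') (X : ⋀[K]^2 V') (A : TotalCochain K V W) :
    contr X (mapT f u A) = mapT f u (contr (exteriorPower.map 2 f X) A) := by
  refine TotalCochain.ext_evalSeq fun n Z => ?_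
  rw [evalSeq_contr, evalSeq_mapT, evalSeq_mapT, evalSeq_contr]
  have : (fun j => exteriorPower.map 2 f (consSeq X Z j)) =
      consSeq (exteriorPower.map 2 f X) fun j => exteriorPower.map 2 f (Z j) := by
    ext1 j
    cases j <;> rfl
  rw [this]

theorem mapT_mem (f : V' →ₗ[K] V) (u : W →ₗ[K] W') {d : ℤ} {A : TotalCochain K V W}
    (hA : A ∈ cochainGrading K V W d) : mapT f u A ∈ cochainGrading K V' W' d := by
  intro n hn
  rw [mapT, DirectSum.lmap_apply, hA n hn, map_zero]

end Functoriality

section Weights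
set_option maxHeartbeats 2000000
variable {K g h : Type*} [Field K] [AddCommGroup g] [Module K g] [AddCommGroup h] [Module K h]

theorem inclF_eq : inclF K g h = mapT (LinearMap.fst K g h) (LinearMap.inr K g h) := rfl

theorem projF_eq : projF K g h = mapT (LinearMap.inl K g h) (LinearMap.snd K g h) := rfl

theorem projF_inclF (a : TotalCochain K g h) : projF K g h (inclF K g h a) = a := by
  refine TotalCochain.ext_evalSeq fun n Z => ?_
  have e (X : ⋀[K]^2 g) : exteriorPower.map 2 (LinearMap.fst K g h)
      (exteriorPower.map 2 (LinearMap.inl K g h) X) = X := by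
    rw [← LinearMap.comp_apply, ← exteriorPower.map_comp, LinearMap.fst_comp_inl,
      exteriorPower.map_id, LinearMap.id_apply]
  rw [projF_eq, inclF_eq, evalSeq_mapT, evalSeq_mapT]
  simp only [e]
  ext v
  simp

theorem inclF_ofHom (H : g →ₗ[K] h) :
    inclF K g h (ofHom H) = ofHom (LinearMap.inr K g h ∘ₗ H ∘ₗ LinearMap.fst K g h) := by
  refine TotalCochain.ext_contr ?_ fun X => ?_
  · rw [inclF_eq, degZero_mapT, degZero_ofHom, degZero_ofHom]
  · rw [inclF_eq, contr_mapT, contr_ofHom, contr_ofHom, map_zero]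

variable (K g h) in
/-- The projection of `g ⊕ h` onto `h`; the bracket with it is the weight grading. -/
noncomputable def weightHom : g × h →ₗ[K] g × h := LinearMap.inr K g h ∘ₗ LinearMap.snd K g h

theorem weightHom_apply (v : g × h) : weightHom K g h v = (0, v.2) := rfl

/-- Homogeneous elements of weight less than `-1` vanish. -/
theorem eq_zero_of_weight [CharZero K] {d w : ℤ} (hw : w ≤ -2)
    {A : TotalCochain K (g × h) (g × h)} (hA : A ∈ cochainGrading K (g × h) (g × h) d)
    (hwA : nrBracket A (ofHom (weightHom K g h)) = (w : K) • A) : A = 0 := by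
  obtain ⟨n, hn⟩ : ∃ n : ℕ, d < n := ⟨d.toNat + 1, by omega⟩
  induction n generalizing d w A with
  | zero => exact eq_zero_of_mem_of_neg (by simpa using hn) hA
  | succ n ih =>
    push_cast at hn
    have h1 {e : ℤ} (he : 0 ≤ e) {X : ⋀[K]^2 (g × h)}
        (hX : wedgeDer (weightHom K g h) X = (e : K) • X) : contr X A = 0 := by
      refine ih (w := w - e) (by omega) (contr_mem X hA) ?_ (by omega)
      have := contr_nrBracket_ofHom X hA (weightHom K g h)
      rw [hwA, hX, map_smul, map_smul, LinearMap.smul_apply] at this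
      rw [Int.cast_sub, sub_smul, this, add_sub_cancel_right]
    have hc : contr.flip A = 0 := by
      refine wedge_linearMap_ext fun x y => ?_
      obtain ⟨x, u⟩ := x
      obtain ⟨y, v⟩ := y
      have e1 : (x, u) = (x, 0) + ((0, u) : g × h) := by simp
      have e2 : (y, v) = (y, 0) + ((0, v) : g × h) := by simp
      rw [LinearMap.flip_apply, LinearMap.zero_apply, e1, e2, wedge_add_left, wedge_add_right,
        wedge_add_right]
      have z : ((0, 0) : g × h) = 0 := rfl
      have c1 := h1 (e := 0) le_rfl (X := wedge K ((x, 0) : g × h) (y, 0)) (by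
        simp [wedgeDer_wedge, weightHom_apply, z, wedge_zero_left, wedge_zero_right])
      have c2 := h1 (e := 1) (by norm_num) (X := wedge K ((x, 0) : g × h) (0, v)) (by
        simp [wedgeDer_wedge, weightHom_apply, z, wedge_zero_left])
      have c3 := h1 (e := 1) (by norm_num) (X := wedge K ((0, u) : g × h) (y, 0)) (by
        simp [wedgeDer_wedge, weightHom_apply, z, wedge_zero_right])
      have c4 := h1 (e := 2) (by norm_num) (X := wedge K ((0, u) : g × h) (0, v)) (by
        simp [wedgeDer_wedge, weightHom_apply, two_smul])
      simp only [map_add, LinearMap.add_apply, c1, c2, c3, c4, add_zero]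
    have hw0 : (w : K) ≠ 0 := by exact_mod_cast (by omega : w ≠ 0)
    have hw1 : (w : K) + 1 ≠ 0 := by exact_mod_cast (by omega : w + 1 ≠ 0)
    have hw2 : (w : K) - 1 ≠ 0 := by exact_mod_cast (by omega : w - 1 ≠ 0)
    have h0 := degZero_nrBracket_ofHom hA (weightHom K g h)
    rw [hwA, map_smul] at h0
    have hd : degZero A = 0 := by
      have key (v : g × h) := LinearMap.congr_fun h0 v
      simp only [LinearMap.smul_apply, LinearMap.sub_apply, LinearMap.comp_apply,
        weightHom_apply] at key
      refine LinearMap.prod_ext (LinearMap.ext fun x => ?_) (LinearMap.ext fun u => ?_)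
      · have k := key (x, 0)
        have z : ((0, 0) : g × h) = 0 := rfl
        simp only [z, map_zero, zero_sub, Prod.ext_iff, Prod.smul_fst, Prod.smul_snd,
          Prod.fst_neg, Prod.snd_neg, neg_zero] at k
        obtain ⟨k1, k2⟩ := k
        refine Prod.ext ((smul_eq_zero.1 k1).resolve_left hw0) ?_
        have k3 : ((w : K) + 1) • (degZero A (x, 0)).2 = 0 := by
          rw [add_smul, one_smul]
          exact eq_neg_iff_add_eq_zero.1 k2
        exact (smul_eq_zero.1 k3).resolve_left hw1
      · have k := key (0, u)
        simp only [Prod.ext_iff, Prod.smul_fst, Prod.smul_snd, Prod.fst_sub, Prod.snd_sub,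
          sub_zero, sub_self] at k
        obtain ⟨k1, k2⟩ := k
        refine Prod.ext ?_ ((smul_eq_zero.1 k2).resolve_left hw0)
        have k3 : ((w : K) - 1) • (degZero A (0, u)).1 = 0 := by
          rw [sub_smul, one_smul]
          exact sub_eq_zero.2 k1
        exact (smul_eq_zero.1 k3).resolve_left hw2
    exact TotalCochain.ext_contr (by rw [hd, map_zero]) fun X => by
      rw [map_zero]; exact LinearMap.congr_fun hc X

theorem projF_nrBracket_weightHom (A : TotalCochain K (g × h) (g × h)) :
    projF K g h (nrBracket A (ofHom (weightHom K g h))) = (-1 : K) • projF K g h A := by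
  suffices H : projF K g h ∘ₗ nrBracket.flip (ofHom (weightHom K g h)) = (-1 : K) • projF K g h from
    LinearMap.congr_fun H A
  refine linearMap_eq_of_iSup_eq_top iSup_cochainGrading fun d A hA => ?_
  rw [LinearMap.comp_apply, LinearMap.flip_apply, LinearMap.smul_apply, neg_one_smul,
    eq_neg_iff_add_eq_zero]
  refine induction_contr (p := fun C => ∃ d, ∃ A ∈ cochainGrading K (g × h) (g × h) d,
    C = projF K g h (nrBracket A (ofHom (weightHom K g h))) + projF K g h A) ?_ ?_ ⟨d, A, hA, rfl⟩
  · rintro _ X ⟨d, A, hA, rfl⟩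
    refine ⟨d - 1, _, contr_mem (exteriorPower.map 2 (LinearMap.inl K g h) X) hA, ?_⟩
    have e : wedgeDer (weightHom K g h) (exteriorPower.map 2 (LinearMap.inl K g h) X) = 0 := by
      rw [wedgeDer_map (S := 0) (by ext x <;> simp [weightHom]), map_zero, LinearMap.zero_apply,
        map_zero]
    rw [map_add, projF_eq, contr_mapT, contr_mapT, contr_nrBracket_ofHom _ hA, e, map_zero,
      LinearMap.zero_apply, add_zero]
  · rintro _ ⟨d, A, hA, rfl⟩
    rw [map_add, projF_eq, degZero_mapT, degZero_mapT, degZero_nrBracket_ofHom hA]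
    ext x
    have z : ((0, 0) : g × h) = 0 := rfl
    simp [weightHom, z]

theorem nrBracket_inclF_weightHom (a : TotalCochain K g h) :
    nrBracket (inclF K g h a) (ofHom (weightHom K g h)) = (-1 : K) • inclF K g h a := by
  suffices H : nrBracket.flip (ofHom (weightHom K g h)) ∘ₗ inclF K g h = (-1 : K) • inclF K g h from
    LinearMap.congr_fun H a
  refine linearMap_eq_of_iSup_eq_top iSup_cochainGrading fun d a ha => ?_
  rw [LinearMap.comp_apply, LinearMap.flip_apply, LinearMap.smul_apply, neg_one_smul,
    eq_neg_iff_add_eq_zero]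
  refine induction_contr (p := fun C => ∃ d, ∃ a ∈ cochainGrading K g h d,
    C = nrBracket (inclF K g h a) (ofHom (weightHom K g h)) + inclF K g h a) ?_ ?_ ⟨d, a, ha, rfl⟩
  · rintro _ X ⟨d, a, ha, rfl⟩
    refine ⟨d - 1, _, contr_mem (exteriorPower.map 2 (LinearMap.fst K g h) X) ha, ?_⟩
    have e : exteriorPower.map 2 (LinearMap.fst K g h) (wedgeDer (weightHom K g h) X) = 0 := by
      rw [← wedgeDer_map (T := 0) (by ext x <;> simp [weightHom]), map_zero, LinearMap.zero_apply]
    rw [map_add, contr_nrBracket_ofHom _ (by rw [inclF_eq]; exact mapT_mem _ _ ha), inclF_eq,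
      contr_mapT, contr_mapT, e, map_zero, LinearMap.zero_apply, map_zero, add_zero]
  · rintro _ ⟨d, a, ha, rfl⟩
    rw [map_add, degZero_nrBracket_ofHom (by rw [inclF_eq]; exact mapT_mem _ _ ha), inclF_eq,
      degZero_mapT]
    ext x <;> simp [weightHom]

theorem inclF_mem {d : ℤ} {a : TotalCochain K g h} (ha : a ∈ cochainGrading K g h d) :
    inclF K g h a ∈ cochainGrading K (g × h) (g × h) d := mapT_mem _ _ ha

theorem projF_mem {d : ℤ} {A : TotalCochain K (g × h) (g × h)}
    (hA : A ∈ cochainGrading K (g × h) (g × h) d) : projF K g h A ∈ cochainGrading K g h d :=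
  mapT_mem _ _ hA

theorem nrBracket_inclF_inclF [CharZero K] {p q : ℤ} {a b : TotalCochain K g h}
    (ha : a ∈ cochainGrading K g h p) (hb : b ∈ cochainGrading K g h q) :
    nrBracket (inclF K g h a) (inclF K g h b) = 0 := by
  refine eq_zero_of_weight (w := -2) le_rfl
    (isGradedLie_nrBracket.bracket_mem (inclF_mem ha) (inclF_mem hb)) ?_
  rw [nrBracket_nrBracket_ofHom, nrBracket_inclF_weightHom, nrBracket_inclF_weightHom, map_smul,
    map_smul, LinearMap.smul_apply, ← add_smul]
  congr 1
  norm_num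

theorem projF_circT {p q : ℤ} {A B : TotalCochain K (g × h) (g × h)}
    (hA : A ∈ cochainGrading K (g × h) (g × h) p) (hB : B ∈ cochainGrading K (g × h) (g × h) q)
    (hPA : projF K g h A = 0) (hPB : projF K g h B = 0) : projF K g h (circT A B) = 0 := by
  obtain ⟨n, hn⟩ : ∃ n : ℕ, p + q < n := ⟨(p + q).toNat + 1, by omega⟩
  induction n generalizing p q A B with
  | zero => rw [eq_zero_of_mem_of_neg (by simpa using hn) (circT_mem hA hB), map_zero]
  | succ n ih =>
    push_cast at hn
    have hc {A : TotalCochain K (g × h) (g × h)} (hPA : projF K g h A = 0) (X : ⋀[K]^2 g) :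
        projF K g h (contr (exteriorPower.map 2 (LinearMap.inl K g h) X) A) = 0 := by
      rw [projF_eq, ← contr_mapT, ← projF_eq, hPA, map_zero]
    have hB0 : LinearMap.snd K g h ∘ₗ degZero B ∘ₗ LinearMap.inl K g h = 0 := by
      rw [← degZero_mapT, ← projF_eq, hPB, map_zero]
    refine TotalCochain.ext_contr ?_ fun X => ?_
    · have hA0 : LinearMap.snd K g h ∘ₗ degZero A ∘ₗ LinearMap.inl K g h = 0 := by
        rw [← degZero_mapT, ← projF_eq, hPA, map_zero]
      rw [map_zero, projF_eq, degZero_mapT, degZero_circT]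
      ext x
      have h1 : (degZero B (x, 0)).2 = 0 := LinearMap.congr_fun hB0 x
      have h2 : degZero B (x, 0) = ((degZero B (x, 0)).1, 0) := Prod.ext rfl h1
      change (degZero A (degZero B (x, 0))).2 = 0
      rw [h2]
      exact LinearMap.congr_fun hA0 _
    · set S := LinearMap.fst K g h ∘ₗ degZero B ∘ₗ LinearMap.inl K g h
      have hS : degZero B ∘ₗ LinearMap.inl K g h = LinearMap.inl K g h ∘ₗ S := by
        refine LinearMap.ext fun x => Prod.ext rfl ?_
        exact LinearMap.congr_fun hB0 x
      rw [map_zero, projF_eq, contr_mapT, ← projF_eq, contr_circT _ A hB, actWedge,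
        LinearMap.comp_apply, wedgeDer_map hS]
      simp only [map_add, map_smul]
      rw [hc hPA, ih (contr_mem _ hA) hB (hc hPA X) hPB (by omega),
        ih hA (contr_mem _ hB) hPA (hc hPB X) (by omega), smul_zero, add_zero, add_zero]

theorem isVoronovData [CharZero K] :
    IsVoronovData (cochainGrading K (g × h) (g × h)) nrBracket (cochainGrading K g h)
      (inclF K g h) (projF K g h) where
  toIsGradedLie := isGradedLie_nrBracket
  incl_mem := inclF_mem
  proj_mem := projF_mem
  proj_incl := projF_inclF
  abelian := nrBracket_inclF_inclF
  ker_bracket {p q x y} hx hy hPx hPy := by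
    rw [nrBracket_eq hx hy, map_sub, map_smul, projF_circT hx hy hPx hPy,
      projF_circT hy hx hPy hPx, smul_zero, sub_zero]

end Weights

section SquareZero
variable {K T L E : Type*} [Field K] [AddCommGroup T] [Module K T] [AddCommGroup L] [Module K L]
  [AddCommGroup E] [Module K E]

theorem IsContractionAlgebra.contr_contr_sq {𝒯 : ℤ → Submodule K T} {m : T →ₗ[K] T →ₗ[K] T}
    {i : L →ₗ[K] T →ₗ[K] T} {a : T →ₗ[K] L →ₗ[K] L} {c : T →ₗ[K] E}
    (h : IsContractionAlgebra 𝒯 m i a c) {x : T} (hx : x ∈ 𝒯 1) (X Y : L) :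
    i Y (i X (m x x)) = m (i Y x) (i X x) - m (i X x) (i Y x) + i (a (i X x) Y) x := by
  have hX : i X x ∈ 𝒯 0 := h.contr_mem 1 x X hx
  have hYX : i Y (i X x) = 0 := h.eq_zero_of_neg _ (by norm_num) _ (h.contr_mem 0 _ Y hX)
  have ha := h.act_eq_zero 1 x one_ne_zero hx
  rw [h.contr_mul X x 1 x hx, map_add, map_add, map_smul, h.contr_mul Y (i X x) 1 x hx,
    h.contr_mul Y x 0 _ hX, hYX, ha, sg_one, sg_zero]
  simp only [map_zero, LinearMap.zero_apply, neg_smul, one_smul, add_zero, zero_add, neg_zero]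
  abel

theorem IsContractionAlgebra.eq_zero_of_mem_two {𝒯 : ℤ → Submodule K T} {m : T →ₗ[K] T →ₗ[K] T}
    {i : L →ₗ[K] T →ₗ[K] T} {a : T →ₗ[K] L →ₗ[K] L} {c : T →ₗ[K] E}
    (h : IsContractionAlgebra 𝒯 m i a c) (hc : ∀ d ≠ 0, ∀ x ∈ 𝒯 d, c x = 0) {x : T}
    (hx : x ∈ 𝒯 2) (h0 : ∀ X Y, c (i Y (i X x)) = 0) : x = 0 := by
  refine h.ext x (hc 2 (by norm_num) x hx) fun X => ?_
  have hX : i X x ∈ 𝒯 1 := h.contr_mem 2 x X hx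
  refine h.ext _ (hc 1 one_ne_zero _ hX) fun Y => ?_
  have hY : i Y (i X x) ∈ 𝒯 0 := h.contr_mem 1 _ Y hX
  refine h.ext _ (h0 X Y) fun Z => ?_
  exact h.eq_zero_of_neg _ (by norm_num) _ (h.contr_mem 0 _ Z hY)

end SquareZero

section DegreeOne
set_option maxHeartbeats 2000000
variable {K V W : Type*} [Field K] [AddCommGroup V] [Module K V] [AddCommGroup W] [Module K W]

/-- The trilinear map given by the component of degree `1`. -/
noncomputable def tri (A : TotalCochain K V W) (x y z : V) : W :=
  degZero (contr (wedge K x y) A) z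

theorem tri_add (A B : TotalCochain K V W) (x y z : V) :
    tri (A + B) x y z = tri A x y z + tri B x y z := by
  simp only [tri, map_add, LinearMap.add_apply]

theorem tri_smul (c : K) (A : TotalCochain K V W) (x y z : V) :
    tri (c • A) x y z = c • tri A x y z := by
  simp only [tri, map_smul, LinearMap.smul_apply]

theorem tri_zero (x y z : V) : tri (0 : TotalCochain K V W) x y z = 0 := by
  simp only [tri, map_zero, LinearMap.zero_apply]

theorem ext_tri {A B : TotalCochain K V W} (hA : A ∈ cochainGrading K V W 1)
    (hB : B ∈ cochainGrading K V W 1) (h : ∀ x y z, tri A x y z = tri B x y z) : A = B := by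
  refine TotalCochain.ext_contr ?_ fun X => TotalCochain.ext_contr ?_ fun Y => ?_
  · rw [degZero_eq_zero_of_mem one_ne_zero hA, degZero_eq_zero_of_mem one_ne_zero hB]
  · have : degZero ∘ₗ contr.flip A = degZero ∘ₗ contr.flip B :=
      wedge_linearMap_ext fun x y => LinearMap.ext fun z => h x y z
    exact LinearMap.congr_fun this X
  · rw [contr_eq_zero_of_mem_zero Y (contr_mem X hA), contr_eq_zero_of_mem_zero Y (contr_mem X hB)]

theorem tri_nrBracket_ofHom {A : TotalCochain K V V} (hA : A ∈ cochainGrading K V V 1)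
    (f : V →ₗ[K] V) (x y z : V) :
    tri (nrBracket A (ofHom f)) x y z =
      tri A (f x) y z + tri A x (f y) z + tri A x y (f z) - f (tri A x y z) := by
  rw [tri, contr_nrBracket_ofHom _ hA, map_add, degZero_nrBracket_ofHom (contr_mem _ hA),
    wedgeDer_wedge]
  simp only [map_add, LinearMap.add_apply, LinearMap.sub_apply, LinearMap.comp_apply, tri]
  abel

theorem tri_mapT {V' W' : Type*} [AddCommGroup V'] [Module K V'] [AddCommGroup W'] [Module K W']
    (f : V' →ₗ[K] V) (u : W →ₗ[K] W') (A : TotalCochain K V W) (x y z : V') :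
    tri (mapT f u A) x y z = u (tri A (f x) (f y) (f z)) := by
  rw [tri, contr_mapT, degZero_mapT, map_wedge]; rfl

/-- A trilinear alternating bracket, as an element of `C*(V, V)`. -/
noncomputable def bracketT (m : V [⋀^Fin 3]→ₗ[K] V) : TotalCochain K V V :=
  DirectSum.lof K ℕ (fun n => Cochain K V V n) 1 (ofBracket m)

theorem bracketT_mem (m : V [⋀^Fin 3]→ₗ[K] V) : bracketT m ∈ cochainGrading K V V 1 :=
  lof_mem_cochainGrading 1 _

theorem tri_bracketT (m : V [⋀^Fin 3]→ₗ[K] V) (x y z : V) :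
    tri (bracketT m) x y z = m ![x, y, z] := by
  rw [tri, degZero, evalSeq_contr, bracketT, evalSeq_lof rfl, ← ofBracket_apply]
  congr 2
  ext1 j
  obtain rfl : j = 0 := Fin.ext (by omega)
  rfl

/-- A 3-Lie bracket has square zero. -/
theorem nrBracket_bracketT_self {m : V [⋀^Fin 3]→ₗ[K] V} (hm : IsThreeLieBracket m) :
    nrBracket (bracketT m) (bracketT m) = 0 := by
  have hmem := bracketT_mem m
  suffices h : circT (bracketT m) (bracketT m) = 0 by
    rw [nrBracket_eq hmem hmem, h, smul_zero, sub_zero]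
  refine isContractionAlgebra_circT.eq_zero_of_mem_two
    (fun d hd x hx => degZero_eq_zero_of_mem hd hx) (circT_mem hmem hmem) ?_
  intro X Y
  rw [isContractionAlgebra_circT.contr_contr_sq hmem, map_add, map_sub, degZero_circT,
    degZero_circT]
  generalize hΔ : bracketT m = Δ
  have ht (x y z) : degZero (contr (wedge K x y) Δ) z = m ![x, y, z] := by
    rw [← hΔ]; exact tri_bracketT m x y z
  let φ : ⋀[K]^2 V →ₗ[K] (V →ₗ[K] V) := degZero ∘ₗ contr.flip Δ
  have hφ (x y z : V) : φ (wedge K x y) z = m ![x, y, z] := ht x y z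
  suffices h : (LinearMap.mul K (Module.End K V)).compl₁₂ φ φ -
      ((LinearMap.mul K (Module.End K V)).compl₁₂ φ φ).flip +
      (wedgeDer ∘ₗ φ).flip.compr₂ φ = 0 from LinearMap.congr_fun₂ h Y X
  refine wedge_linearMap_ext fun x₃ x₄ => wedge_linearMap_ext fun x₁ x₂ => LinearMap.ext fun x₅ => ?_
  simp only [LinearMap.add_apply, LinearMap.sub_apply, LinearMap.compl₁₂_apply,
    LinearMap.flip_apply, LinearMap.compr₂_apply, LinearMap.comp_apply, LinearMap.mul_apply',
    Module.End.mul_apply, LinearMap.zero_apply, wedgeDer_wedge, map_add, hφ]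
  rw [hm x₁ x₂ x₃ x₄ x₅]
  abel

end DegreeOne

section Semidirect
set_option maxHeartbeats 2000000
variable {K g h : Type*} [Field K] [AddCommGroup g] [Module K g] [AddCommGroup h] [Module K h]

theorem alt_three_rotate {M N : Type*} [AddCommGroup M] [Module K M] [AddCommGroup N] [Module K N]
    (m : M [⋀^Fin 3]→ₗ[K] N) (x y z : M) : m ![x, y, z] = m ![y, z, x] := by
  have h1 := m.map_swap ![y, z, x] (i := 0) (j := 1) (by decide)
  have h2 := m.map_swap ![z, y, x] (i := 0) (j := 2) (by decide)
  have e1 : ![y, z, x] ∘ Equiv.swap (0 : Fin 3) 1 = ![z, y, x] := by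
    ext t; fin_cases t <;> rfl
  have e2 : ![z, y, x] ∘ Equiv.swap (0 : Fin 3) 2 = ![x, y, z] := by
    ext t; fin_cases t <;> rfl
  rw [e1] at h1
  rw [e2] at h2
  rw [h2, h1, neg_neg]

theorem isThreeLieBracket_semidirect {π : g [⋀^Fin 3]→ₗ[K] g} (hπ : IsThreeLieBracket π)
    {μ : h [⋀^Fin 3]→ₗ[K] h} (hμ : IsThreeLieBracket μ)
    {ρ : g [⋀^Fin 2]→ₗ[K] Module.End K h} (hρ : IsAction π μ ρ) :
    IsThreeLieBracket (semidirectBracket π μ ρ) := by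
  have μadd (a b v w : h) : μ ![a + b, v, w] = μ ![a, v, w] + μ ![b, v, w] :=
    μ.toMultilinearMap.cons_add ![v, w] a b
  have μ1 (a b c d e f : g) (u u' u'' c' v w : h) :
      μ ![ρ ![a, b] u + ρ ![c, d] u' + ρ ![e, f] u'' + c', v, w] = μ ![c', v, w] := by
    rw [μadd, μadd, μadd, hρ.rho_mem_center a b u v w, hρ.rho_mem_center c d u' v w,
      hρ.rho_mem_center e f u'' v w, zero_add, zero_add, zero_add]
  have μ2 (a b c d e f : g) (u u' u'' c' v w : h) :
      μ ![v, ρ ![a, b] u + ρ ![c, d] u' + ρ ![e, f] u'' + c', w] = μ ![v, c', w] := by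
    rw [alt_three_rotate μ, μ1, ← alt_three_rotate μ]
  have μ3 (a b c d e f : g) (u u' u'' c' v w : h) :
      μ ![v, w, ρ ![a, b] u + ρ ![c, d] u' + ρ ![e, f] u'' + c'] = μ ![v, w, c'] := by
    rw [alt_three_rotate μ, μ2, ← alt_three_rotate μ]
  rintro ⟨x₁, u₁⟩ ⟨x₂, u₂⟩ ⟨x₃, u₃⟩ ⟨x₄, u₄⟩ ⟨x₅, u₅⟩
  simp only [semidirectBracket_apply, Prod.mk_add_mk]
  refine Prod.ext (hπ x₁ x₂ x₃ x₄ x₅) ?_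
  simp only [μ1, μ2, μ3, map_add, hρ.rho_bracket_eq_zero]
  have mul (a b c d : g) (u : h) : ρ ![a, b] (ρ ![c, d] u) =
      ρ ![π ![a, b, c], d] u + ρ ![c, π ![a, b, d]] u + ρ ![c, d] (ρ ![a, b] u) :=
    LinearMap.congr_fun (hρ.rho_mul_rho a b c d) u
  have br (a b c d : g) (u : h) : ρ ![a, π ![b, c, d]] u =
      ρ ![c, d] (ρ ![a, b] u) - ρ ![b, d] (ρ ![a, c] u) + ρ ![b, c] (ρ ![a, d] u) :=
    LinearMap.congr_fun (hρ.rho_bracket a b c d) u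
  have h1 := br x₂ x₃ x₄ x₅ u₁
  have h2 := br x₁ x₃ x₄ x₅ u₂
  rw [mul x₁ x₂ x₃ x₄ u₅, mul x₁ x₂ x₄ x₅ u₃, mul x₁ x₂ x₅ x₃ u₄, h1,
    alt_swap ρ (π ![x₃, x₄, x₅]) x₁, LinearMap.neg_apply, h2, alt_swap ρ x₅ x₃, alt_swap ρ x₃ x₁,
    alt_swap ρ x₄ x₁, alt_swap ρ x₅ x₁, hμ u₁ u₂ u₃ u₄ u₅]
  simp only [LinearMap.neg_apply, map_neg]
  abel

variable (π : g [⋀^Fin 3]→ₗ[K] g) (μ : h [⋀^Fin 3]→ₗ[K] h)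
  (ρ : g [⋀^Fin 2]→ₗ[K] Module.End K h)

theorem tri_semidirect (x y z : g × h) :
    tri (bracketT (semidirectBracket π μ ρ)) x y z =
      (π ![x.1, y.1, z.1], ρ ![x.1, y.1] z.2 + ρ ![y.1, z.1] x.2 + ρ ![z.1, x.1] y.2 +
        μ ![x.2, y.2, z.2]) := by
  rw [tri_bracketT]
  exact semidirectBracket_apply π μ ρ x.1 y.1 z.1 x.2 y.2 z.2

theorem bracketT_semidirect_eq_add :
    bracketT (semidirectBracket π μ ρ) =
      bracketT (semidirectBracket π 0 ρ) + bracketT (semidirectBracket 0 μ 0) := by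
  refine ext_tri (bracketT_mem _) (add_mem (bracketT_mem _) (bracketT_mem _)) fun x y z => ?_
  rw [tri_add, tri_semidirect, tri_semidirect, tri_semidirect]
  simp

theorem alt_two_zero_left (f : g [⋀^Fin 2]→ₗ[K] Module.End K h) (x : g) : f ![0, x] = 0 :=
  f.map_coord_zero (i := 0) rfl

theorem alt_two_zero_right (f : g [⋀^Fin 2]→ₗ[K] Module.End K h) (x : g) : f ![x, 0] = 0 :=
  f.map_coord_zero (i := 1) rfl

theorem alt_three_zero₁ {M N : Type*} [AddCommGroup M] [Module K M] [AddCommGroup N] [Module K N]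
    (m : M [⋀^Fin 3]→ₗ[K] N) (x y : M) : m ![0, x, y] = 0 := m.map_coord_zero (i := 0) rfl

theorem alt_three_zero₂ {M N : Type*} [AddCommGroup M] [Module K M] [AddCommGroup N] [Module K N]
    (m : M [⋀^Fin 3]→ₗ[K] N) (x y : M) : m ![x, 0, y] = 0 := m.map_coord_zero (i := 1) rfl

theorem alt_three_zero₃ {M N : Type*} [AddCommGroup M] [Module K M] [AddCommGroup N] [Module K N]
    (m : M [⋀^Fin 3]→ₗ[K] N) (x y : M) : m ![x, y, 0] = 0 := m.map_coord_zero (i := 2) rfl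

/-- The part `π + ρ` has weight `0`. -/
theorem weight_action : nrBracket (bracketT (semidirectBracket π 0 ρ)) (ofHom (weightHom K g h)) =
    (0 : K) • bracketT (semidirectBracket π 0 ρ) := by
  refine ext_tri (nrBracket_mem_zero (bracketT_mem _) _)
    (Submodule.smul_mem _ _ (bracketT_mem _)) fun x y z => ?_
  rw [tri_nrBracket_ofHom (bracketT_mem _), tri_smul]
  simp only [tri_semidirect, weightHom_apply]
  ext <;> simp [alt_two_zero_left, alt_two_zero_right, alt_three_zero₁, alt_three_zero₂,
    alt_three_zero₃]
  abel

/-- The part `μ` has weight `2`. -/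
theorem weight_bracket : nrBracket (bracketT (semidirectBracket (0 : g [⋀^Fin 3]→ₗ[K] g) μ 0))
      (ofHom (weightHom K g h)) = (2 : K) • bracketT (semidirectBracket 0 μ 0) := by
  refine ext_tri (nrBracket_mem_zero (bracketT_mem _) _)
    (Submodule.smul_mem _ _ (bracketT_mem _)) fun x y z => ?_
  rw [tri_nrBracket_ofHom (bracketT_mem _), tri_smul]
  simp only [tri_semidirect, weightHom_apply]
  ext
  · simp
  · simp [two_smul]

theorem projF_iter_eq_zero [CharZero K] {n : ℕ} (h1 : n ≠ 1) (h3 : n ≠ 3)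
    (x : ℕ → TotalCochain K g h) : projF K g h (iter nrBracket (inclF K g h) n x
      (bracketT (semidirectBracket π μ ρ))) = 0 := by
  have hE (A B : TotalCochain K (g × h) (g × h)) :=
    nrBracket_nrBracket_ofHom A B (weightHom K g h)
  rw [bracketT_semidirect_eq_add, map_add, map_add,
    proj_iter_eq_zero hE nrBracket_inclF_weightHom projF_nrBracket_weightHom (weight_action π ρ),
    proj_iter_eq_zero hE nrBracket_inclF_weightHom projF_nrBracket_weightHom (weight_bracket μ),
    add_zero]
  · exact_mod_cast h3.symm
  · exact_mod_cast h1.symm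

theorem iter_const_eq_zero [CharZero K] {α : TotalCochain K g h} (hα : α ∈ cochainGrading K g h 0)
    {n : ℕ} (hn : 4 ≤ n) : iter nrBracket (inclF K g h) n (fun _ => α)
      (bracketT (semidirectBracket π μ ρ)) = 0 := by
  have hE (A B : TotalCochain K (g × h) (g × h)) :=
    nrBracket_nrBracket_ofHom A B (weightHom K g h)
  have hmem (m : (g × h) [⋀^Fin 3]→ₗ[K] (g × h)) :=
    isVoronovData.iter_mem (bracketT_mem m) (fun _ : ℕ => hα) n
  rw [bracketT_semidirect_eq_add, map_add]
  have w0 := iter_weight hE nrBracket_inclF_weightHom (weight_action π ρ) n fun _ => α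
  have w2 := iter_weight hE nrBracket_inclF_weightHom (weight_bracket (g := g) μ) n fun _ => α
  rw [eq_zero_of_weight (w := 0 - n) (by omega) (hmem _) (by rw [w0]; push_cast; rfl),
    eq_zero_of_weight (w := 2 - n) (by omega) (hmem _) (by rw [w2]; push_cast; rfl), add_zero]

end Semidirect

section AbstractTwist
variable {K A T : Type*} [Field K] [AddCommGroup A] [Module K A] [AddCommMonoid T] [Module K T]
  {l : (k : ℕ) → MultilinearMap K (fun _ : Fin k => A) A} {α : A}

theorem twist_eq_sum (hl : ∀ k, 4 ≤ k → l k = 0) (k : ℕ) :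
    twist l α k = ∑ n ∈ Finset.range 4, ((n.factorial : K))⁻¹ • insertLeft α n k (l (n + k)) := by
  refine finsum_eq_sum_of_support_subset _ fun n hn => ?_
  by_contra hc
  rw [Finset.mem_coe, Finset.mem_range, not_lt] at hc
  refine hn (MultilinearMap.ext fun x => ?_)
  simp only [smul_apply, insertLeft_apply, hl (n + k) (by omega), zero_apply, smul_zero]

theorem twist_apply_eq_sum (hl : ∀ k, 4 ≤ k → l k = 0) (k : ℕ) (x : Fin k → A) :
    twist l α k x =
      ∑ n ∈ Finset.range 4, ((n.factorial : K))⁻¹ • l (n + k) (Fin.append (fun _ => α) x) := by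
  rw [twist_eq_sum hl, sum_apply]
  exact Finset.sum_congr rfl fun n _ => by rw [smul_apply, insertLeft_apply]

theorem twist_apply_eq_iter {B : T →ₗ[K] T →ₗ[K] T} {ι : A →ₗ[K] T} {P : T →ₗ[K] A} {Δ : T}
    (hl : ∀ k, 4 ≤ k → l k = 0)
    (hiter : ∀ k (x : ℕ → A), l k (fun j : Fin k => x j) = P (iter B ι k x Δ)) (k : ℕ)
    (x : ℕ → A) :
    twist l α k (fun j : Fin k => x j) = P (iter B ι k x (twistElem B ι α Δ)) := by
  rw [twist_apply_eq_sum hl, twistElem, map_sum, map_sum]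
  refine Finset.sum_congr rfl fun n _ => ?_
  have e : (Fin.append (fun _ : Fin n => α) fun j : Fin k => x j) =
      fun j : Fin (n + k) => (fun i : ℕ => if i < n then α else x (i - n)) j := by
    ext1 j
    refine Fin.addCases (fun i => ?_) (fun i => ?_) j <;> simp
  rw [expTerm, map_smul, map_smul, e,
    hiter (n + k) fun i => if i < n then α else x (i - n), iter_add,
    iter_congr B ι (x' := fun _ => α) (fun j hj => if_pos hj)]
  congr 3
  simp

theorem twist_one (h2 : l 2 = 0) (hl : ∀ k, 4 ≤ k → l k = 0) (x : A) :
    twist l α 1 ![x] = l 1 ![x] + (1 / 2 : K) • l 3 ![α, α, x] := by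
  have e0 : Fin.append (fun _ : Fin 0 => α) ![x] = ![x] := by ext j; fin_cases j; rfl
  have e2 : Fin.append (fun _ : Fin 2 => α) ![x] = ![α, α, x] := by ext j; fin_cases j <;> rfl
  rw [twist_apply_eq_sum hl]
  simp only [Finset.sum_range_succ, Finset.sum_range_zero, zero_add, Nat.reduceAdd, h2,
    hl 4 le_rfl, zero_apply, smul_zero, add_zero, e2]
  norm_num [Nat.factorial]
  exact congrArg (l 1) e0

theorem twist_two (h2 : l 2 = 0) (hl : ∀ k, 4 ≤ k → l k = 0) (x y : A) :
    twist l α 2 ![x, y] = l 3 ![α, x, y] := by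
  have e1 : Fin.append (fun _ : Fin 1 => α) ![x, y] = ![α, x, y] := by
    ext j; fin_cases j <;> rfl
  rw [twist_apply_eq_sum hl]
  simp only [Finset.sum_range_succ, Finset.sum_range_zero, zero_add, Nat.reduceAdd, h2,
    hl 4 le_rfl, hl 5 (by norm_num), zero_apply, smul_zero, add_zero, e1]
  norm_num [Nat.factorial]

theorem twist_three (hl : ∀ k, 4 ≤ k → l k = 0) (x y z : A) :
    twist l α 3 ![x, y, z] = l 3 ![x, y, z] := by
  have e0 : Fin.append (fun _ : Fin 0 => α) ![x, y, z] = ![x, y, z] := by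
    ext j; fin_cases j <;> rfl
  rw [twist_apply_eq_sum hl]
  simp only [Finset.sum_range_succ, Finset.sum_range_zero, zero_add, Nat.reduceAdd,
    hl 4 le_rfl, hl 5 (by norm_num), hl 6 (by norm_num), zero_apply, smul_zero,
    add_zero]
  norm_num [Nat.factorial]
  exact congrArg (l 3) e0

theorem twist_eq_zero (hl : ∀ k, 4 ≤ k → l k = 0) {k : ℕ} (hk : 4 ≤ k) : twist l α k = 0 :=
  MultilinearMap.ext fun x => by
    rw [twist_apply_eq_sum hl]
    exact Finset.sum_eq_zero fun n _ => by rw [hl _ (by omega)]; simp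

theorem isMaurerCartan_of_eq {𝒜 : ℤ → Submodule K A} (h2 : l 2 = 0) (hl : ∀ k, 4 ≤ k → l k = 0)
    (hα : α ∈ 𝒜 0) (h : l 1 (fun _ => α) + (6 : K)⁻¹ • l 3 (fun _ => α) = 0) :
    IsMaurerCartan 𝒜 l α where
  mem_zero := hα
  finite_support := (Set.finite_lt_nat 3).subset fun n hn => by
    by_contra hc
    exact hn (by rw [hl _ (by simp at hc; omega)]; rfl)
  equation := by
    rw [finsum_eq_sum_of_support_subset (s := Finset.range 3)]
    · simp only [Finset.sum_range_succ, Finset.sum_range_zero, zero_add, Nat.reduceAdd, h2,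
        zero_apply, smul_zero, add_zero]
      rw [← h]
      norm_num [Nat.factorial]
    · intro n hn
      by_contra hc
      rw [Finset.mem_coe, Finset.mem_range, not_lt] at hc
      exact hn (by simp only [hl (n + 1) (by omega), zero_apply, smul_zero])

theorem IsVoronovData.twistElem_mem {𝒯 : ℤ → Submodule K T} {𝒜 : ℤ → Submodule K A}
    {B : T →ₗ[K] T →ₗ[K] T} {ι : A →ₗ[K] T} {P : T →ₗ[K] A} (h : IsVoronovData 𝒯 B 𝒜 ι P) {Δ : T}
    (hΔ : Δ ∈ 𝒯 1) (hα : α ∈ 𝒜 0) : twistElem B ι α Δ ∈ 𝒯 1 :=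
  Submodule.sum_mem _ fun n _ => Submodule.smul_mem _ _ <| by
    simpa using h.iter_mem hΔ (fun _ : ℕ => hα) n

theorem proj_twistElem {B : T →ₗ[K] T →ₗ[K] T} {ι : A →ₗ[K] T} {P : T →ₗ[K] A} {Δ : T}
    (hiter : ∀ k (x : ℕ → A), l k (fun j : Fin k => x j) = P (iter B ι k x Δ)) (h0 : l 0 = 0)
    (h2 : l 2 = 0) (h : l 1 (fun _ => α) + (6 : K)⁻¹ • l 3 (fun _ => α) = 0) :
    P (twistElem B ι α Δ) = 0 := by
  rw [twistElem, map_sum]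
  simp only [expTerm, map_smul, ← hiter _ fun _ => α, Finset.sum_range_succ, Finset.sum_range_zero,
    h0, h2, zero_apply, smul_zero, add_zero, zero_add]
  rw [← h]
  norm_num [Nat.factorial]

end AbstractTwist

section DerivedBracketFormulas
variable {K g h : Type*} [Field K] [AddCommGroup g] [Module K g] [AddCommGroup h] [Module K h]
set_option maxHeartbeats 2000000
set_option synthInstance.maxHeartbeats 200000

theorem iteratedBracket_apply (Δ : TotalCochain K (g × h) (g × h)) (k : ℕ)
    (x : ℕ → TotalCochain K g h) :
    iteratedBracket Δ k (fun j : Fin k => x j) = iter nrBracket (inclF K g h) k x Δ := by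
  induction k with
  | zero => rfl
  | succ k ih => rw [iter_succ', ← ih]; rfl

variable (π : g [⋀^Fin 3]→ₗ[K] g) (μ : h [⋀^Fin 3]→ₗ[K] h) (ρ : g [⋀^Fin 2]→ₗ[K] Module.End K h)

theorem derivedBracket_apply (k : ℕ) (x : ℕ → TotalCochain K g h) :
    derivedBracket π μ ρ k (fun j : Fin k => x j) =
      projF K g h (iter nrBracket (inclF K g h) k x (bracketT (semidirectBracket π μ ρ))) :=
  congrArg (projF K g h) (iteratedBracket_apply _ k x)

theorem derivedBracket_eq_zero [CharZero K] {k : ℕ} (h1 : k ≠ 1) (h3 : k ≠ 3) :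
    derivedBracket π μ ρ k = 0 := by
  refine MultilinearMap.ext fun x => ?_
  have := derivedBracket_apply π μ ρ k (extendSeq x)
  simp only [extendSeq_val] at this
  rw [this, projF_iter_eq_zero π μ ρ h1 h3]
  rfl

theorem projF_bracketT [CharZero K] : projF K g h (bracketT (semidirectBracket π μ ρ)) = 0 :=
  projF_iter_eq_zero π μ ρ (n := 0) (by norm_num) (by norm_num) fun _ => 0

variable {π μ ρ}

theorem isLInfinityAlgebra_derivedBracket [CharZero K] (hπ : IsThreeLieBracket π)
    (hμ : IsThreeLieBracket μ) (hρ : IsAction π μ ρ) :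
    IsLInfinityAlgebra (cochainGrading K g h) (derivedBracket π μ ρ) :=
  isVoronovData.isLInfinityAlgebra isInternal_cochainGrading (bracketT_mem _)
    (nrBracket_bracketT_self (isThreeLieBracket_semidirect hπ hμ hρ)) (projF_bracketT π μ ρ)
    fun k _ x => derivedBracket_apply π μ ρ k x

/-- The Maurer-Cartan equation of a crossed homomorphism. -/
theorem derivedBracket_crossedHom [CharZero K] {H : g →ₗ[K] h} (hH : IsCrossedHom π μ ρ H) :
    derivedBracket π μ ρ 1 (fun _ => ofHom H) +
      (6 : K)⁻¹ • derivedBracket π μ ρ 3 (fun _ => ofHom H) = 0 := by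
  rw [derivedBracket_apply π μ ρ 1 fun _ => ofHom H, derivedBracket_apply π μ ρ 3 fun _ => ofHom H]
  simp only [iter_succ', iter_zero, inclF_ofHom]
  set f : g × h →ₗ[K] g × h := LinearMap.inr K g h ∘ₗ H ∘ₗ LinearMap.fst K g h
  have hf (x : g × h) : f x = (0, H x.1) := rfl
  have m0 := bracketT_mem (semidirectBracket π μ ρ)
  have m1 := nrBracket_mem_zero m0 f
  have m2 := nrBracket_mem_zero m1 f
  have m3 := nrBracket_mem_zero m2 f
  refine ext_tri (add_mem (projF_mem m1) (Submodule.smul_mem _ _ (projF_mem m3)))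
    (Submodule.zero_mem _) fun x y z => ?_
  rw [tri_add, tri_smul, tri_zero, projF_eq, tri_mapT, tri_mapT]
  simp only [tri_nrBracket_ofHom m2, tri_nrBracket_ofHom m1, tri_nrBracket_ofHom m0, hf,
    tri_semidirect, LinearMap.inl_apply, map_zero, alt_two_zero_left, alt_two_zero_right,
    alt_three_zero₁, alt_three_zero₂, alt_three_zero₃, LinearMap.snd_apply, Prod.snd_add,
    Prod.snd_sub, Prod.fst_add, Prod.fst_sub, LinearMap.zero_apply, add_zero, zero_add, sub_zero,
    hH x y z]
  module

theorem isLInfinityAlgebra_twist [CharZero K] (hπ : IsThreeLieBracket π)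
    (hμ : IsThreeLieBracket μ) (hρ : IsAction π μ ρ) {H : g →ₗ[K] h}
    (hH : IsCrossedHom π μ ρ H) :
    IsLInfinityAlgebra (cochainGrading K g h) (twist (derivedBracket π μ ρ) (ofHom H)) := by
  have hmem := isVoronovData.twistElem_mem (bracketT_mem (semidirectBracket π μ ρ)) (ofHom_mem H)
  have hder (A B : TotalCochain K (g × h) (g × h)) :
      nrBracket (nrBracket A B) (inclF K g h (ofHom H)) =
        nrBracket A (nrBracket B (inclF K g h (ofHom H))) +
          nrBracket (nrBracket A (inclF K g h (ofHom H))) B := by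
    rw [inclF_ofHom]; exact nrBracket_nrBracket_ofHom A B _
  have hsq := bracket_twistElem hder
    (nrBracket_bracketT_self (isThreeLieBracket_semidirect hπ hμ hρ))
    fun n hn => iter_const_eq_zero π μ ρ (ofHom_mem H) hn
  have hproj := proj_twistElem (derivedBracket_apply π μ ρ)
    (derivedBracket_eq_zero π μ ρ (by norm_num) (by norm_num))
    (derivedBracket_eq_zero π μ ρ (by norm_num) (by norm_num)) (derivedBracket_crossedHom hH)
  exact isVoronovData.isLInfinityAlgebra isInternal_cochainGrading hmem hsq hproj
    fun k _ x => twist_apply_eq_iter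
      (fun k hk => derivedBracket_eq_zero π μ ρ (by omega) (by omega))
      (derivedBracket_apply π μ ρ) k x

end DerivedBracketFormulas

end ThreeLie

theorem mainTheorem9 {K g h : Type*} [Field K] [CharZero K] [AddCommGroup g] [Module K g]
    [AddCommGroup h] [Module K h]
    (π : g [⋀^Fin 3]→ₗ[K] g) (hπ : ThreeLie.IsThreeLieBracket π)
    (μ : h [⋀^Fin 3]→ₗ[K] h) (hμ : ThreeLie.IsThreeLieBracket μ)
    (ρ : g [⋀^Fin 2]→ₗ[K] Module.End K h) (hρ : ThreeLie.IsAction π μ ρ)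
    (H : g →ₗ[K] h) (hH : ThreeLie.IsCrossedHom π μ ρ H) :
    -- the `L_∞`-algebra `(C*(g, h), l₁, l₃)`, of which `H` is a Maurer-Cartan element
    ThreeLie.IsLInfinityAlgebra (ThreeLie.cochainGrading K g h) (ThreeLie.derivedBracket π μ ρ) ∧
    ThreeLie.derivedBracket π μ ρ 2 = 0 ∧
    (∀ k, 4 ≤ k → ThreeLie.derivedBracket π μ ρ k = 0) ∧
    ThreeLie.IsMaurerCartan (ThreeLie.cochainGrading K g h) (ThreeLie.derivedBracket π μ ρ)
      (ThreeLie.ofHom H) ∧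
    -- the `L_∞`-algebra obtained by twisting with `H`
    ThreeLie.IsLInfinityAlgebra (ThreeLie.cochainGrading K g h)
      (ThreeLie.twist (ThreeLie.derivedBracket π μ ρ) (ThreeLie.ofHom H)) ∧
    (∀ P, ThreeLie.twist (ThreeLie.derivedBracket π μ ρ) (ThreeLie.ofHom H) 1 ![P] =
      ThreeLie.derivedBracket π μ ρ 1 ![P] +
        (1 / 2 : K) • ThreeLie.derivedBracket π μ ρ 3 ![ThreeLie.ofHom H, ThreeLie.ofHom H, P]) ∧
    (∀ P Q, ThreeLie.twist (ThreeLie.derivedBracket π μ ρ) (ThreeLie.ofHom H) 2 ![P, Q] =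
      ThreeLie.derivedBracket π μ ρ 3 ![ThreeLie.ofHom H, P, Q]) ∧
    (∀ P Q R, ThreeLie.twist (ThreeLie.derivedBracket π μ ρ) (ThreeLie.ofHom H) 3 ![P, Q, R] =
      ThreeLie.derivedBracket π μ ρ 3 ![P, Q, R]) ∧
    (∀ k, 4 ≤ k → ThreeLie.twist (ThreeLie.derivedBracket π μ ρ) (ThreeLie.ofHom H) k = 0) := by
  have h2 : ThreeLie.derivedBracket π μ ρ 2 = 0 :=
    ThreeLie.derivedBracket_eq_zero π μ ρ (by norm_num) (by norm_num)
  have h4 (k : ℕ) (hk : 4 ≤ k) : ThreeLie.derivedBracket π μ ρ k = 0 :=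
    ThreeLie.derivedBracket_eq_zero π μ ρ (by omega) (by omega)
  exact ⟨ThreeLie.isLInfinityAlgebra_derivedBracket hπ hμ hρ, h2, h4,
    ThreeLie.isMaurerCartan_of_eq h2 h4 (ThreeLie.ofHom_mem H)
      (ThreeLie.derivedBracket_crossedHom hH),
    ThreeLie.isLInfinityAlgebra_twist hπ hμ hρ hH,
    ThreeLie.twist_one h2 h4, ThreeLie.twist_two h2 h4, ThreeLie.twist_three h4,
    fun k hk => ThreeLie.twist_eq_zero h4 hk⟩
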